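/- **Lemma 3.1 (Minkowski weighted Strichartz estimate).** Let $n\in\mathbb N$, $2\le p\le\infty$ and $\gamma\in\mathbb R$ satisfy $$\tfrac12-\tfrac1p<\gamma<\tfrac n2-\tfrac1p\qquad\text{and}\qquad \tfrac12<1-\gamma<\tfrac n2 .$$ Then there is a finite constant $C$, depending only on $n,p,\gamma$, such that whenever $u$ is a solution of the Minkowski wave equation $$(\partial_t^2-\Delta)u=F,\qquad u(0,\cdot)=f,\quad \partial_tu(0,\cdot)=g$$ for $t\ge 0$, $x\in\mathbb R^n$, one has $$\Bigl\||x|^{\frac n2-\frac{n+1}p-\gamma}u\Bigr\|_{L^p_tL^p_rL^2_\omega(\mathbb R_+\times\mathbb R^n)}\le C\Bigl(\|f\|_{\dot H^\gamma(\mathbb R^n)}+\|g\|_{\dot H^{\gamma-1}(\mathbb R^n)}+\Bigl\||x|^{-\frac n2+1-\gamma}F\Bigr\|_{L^1_tL^1_rL^2_\omega(\mathbb R_+\times\mathbb R^n)}\Bigr).$$ Here $\|h\|_{L^q_tL^q_rL^2_\omega(\mathbb R_+\times\mathbb R^n)}=\Bigl(\int_0^\infty\int_0^\infty\Bigl(\int_{S^{n-1}}|h(t,r\omega)|^2\,d\sigma(\omega)\Bigr)^{q/2}r^{n-1}\,dr\,dt\Bigr)^{1/q}$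 for $q<\infty$, with essential suprema in $t$ and $r$ for $q=\infty$, where $\sigma$ is the surface measure on $S^{n-1}$; and $\|T\|_{\dot H^s}=\|(\sqrt{-\Delta})^sT\|_{L^2}$, that is, $\|T\|_{\dot H^s}^2=(2\pi)^{-n}\int_{\mathbb R^n}\bigl||\xi|^s\hat T(\xi)\bigr|^2d\xi$ with $\hat T(\xi)=\int e^{-ix\cdot\xi}T(x)\,dx$ (and $\|T\|_{\dot H^s}=\infty$ if the tempered distribution $\hat T$ is not a function). Solutions are understood in the sense of distributions: $f,g$ are tempered distributions on $\mathbb R^n$, $u$ and $F$ are measurable functions on $(0,\infty)\times\mathbb R^n$, for every Schwartz function $\psi$ on $\mathbb R^n$ the function $t\mapsto\int F(t,x)\psi(x)\,dx$ is defined by absolutely convergent integrals for almost every $t>0$ and integrable on bounded time intervals, and there are families $U(t),V(t)$, $t\ge0$, of tempered distributions on $\mathbb R^n$ with $U(0)=f$, $V(0)=g$, with $U(t)=u(t,\cdot)$ for almost every $t>0$, and with $$\tfrac{d}{dt}\langle U(t),\psi\rangle=\langle V(t),\psi\rangle,\qquad \langle V(t),\psi\rangle=\langle V(0),\psi\rangle+\int_0^t\Bigl(\langle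 \Delta U(s),\psi\rangle+\int_{\mathbb R^n}F(s,x)\psi(x)\,dx\Bigr)ds$$ for all $t\ge0$ and all Schwartz functions $\psi$ (one-sided derivative at $t=0$). -/

import Mathlib

open MeasureTheory Set Filter
open scoped SchwartzMap FourierTransform Laplacian ENNReal NNReal

noncomputable section

/-- The Euclidean space `ℝⁿ`. -/
abbrev Rn (n : ℕ) : Type := EuclideanSpace ℝ (Fin n)

/-- The tempered distribution `T` is the function `h`: integration against `h` converges absolutely
on Schwartz functions and gives `T`.  (Taking for `ψ` a Gaussian one sees that `h` is measurable and
locally integrable, so `h` is determined by `T` almost everywhere.) -/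
def IsRepresentedBy {n : ℕ} (T : 𝓢'(Rn n, ℂ)) (h : Rn n → ℂ) : Prop :=
  ∀ ψ : 𝓢(Rn n, ℂ), Integrable (fun x => ψ x * h x) ∧ T ψ = ∫ x, ψ x * h x

/-- The homogeneous Sobolev norm `‖T‖_{Ḣˢ} = ‖(-Δ)^{s/2} T‖_{L²}` (for `|s| < n/2`), with values in
`[0, ∞]`: it is the `L²` norm of `|2πξ|ˢ h` if the Fourier transform of `T` is a function `h`, and
`∞` if it is not a function.  Mathlib's Fourier transform uses the kernel `exp(-2πi x·ξ)`, so that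
`√(-Δ)` is the multiplier `2π|ξ|`. -/
def homSobolevNorm {n : ℕ} (s : ℝ) (T : 𝓢'(Rn n, ℂ)) : ℝ≥0∞ :=
  ⨅ (h : Rn n → ℂ) (_ : IsRepresentedBy (𝓕 T) h),
    eLpNorm (fun ξ => (((2 * Real.pi * ‖ξ‖) ^ s : ℝ) : ℂ) * h ξ) 2 volume

/-- The mixed norm `‖h‖_{L^q_t L^q_r L²_ω(ℝ₊ × ℝⁿ)}`: the `L²` norm over the unit sphere with respect
to surface measure, then the `L^q` norm in `r ∈ (0, ∞)` with respect to `r^{n-1} dr`, then the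
`L^q` norm in `t ∈ (0, ∞)`. -/
def mixedNorm {n : ℕ} (q : ℝ≥0∞) (h : ℝ → Rn n → ℂ) : ℝ≥0∞ :=
  eLpNorm (fun t : ℝ =>
    eLpNorm (fun r : Ioi (0 : ℝ) =>
      eLpNorm (fun ω : Metric.sphere (0 : Rn n) 1 => h t (r.1 • ω.1)) 2
        (volume : Measure (Rn n)).toSphere)
      q (Measure.volumeIoiPow (n - 1)))
    q (volume.restrict (Ioi 0))

/-- The function `|x|ᵃ h(t, x)`. -/
def radialWeight {n : ℕ} (a : ℝ) (h : ℝ → Rn n → ℂ) : ℝ → Rn n → ℂ :=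
  fun t x => ((‖x‖ ^ a : ℝ) : ℂ) * h t x

/-- The measurable function `u` on `(0, ∞) × ℝⁿ` is a (distributional) solution of the Cauchy problem
`(∂ₜ² - Δ) u = F`, `u(0) = f`, `∂ₜ u(0) = g`.

Here `U t` is `u(t, ·)` and `V t` is `∂ₜ u(t, ·)`, both viewed as tempered distributions on `ℝⁿ`;
`U` is defined up to `t = 0` and is continuously differentiable in `t` with derivative `V` when
tested against Schwartz functions, and `∂ₜ V = Δ U + F` holds in integrated form (for `F` which is
only integrable in time), again tested against Schwartz functions. -/
structure IsWaveSolution {n : ℕ} (f g : 𝓢'(Rn n, ℂ)) (F u : ℝ → Rn n → ℂ) : Prop where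
  measurable_forcing : AEStronglyMeasurable (Function.uncurry F)
    ((volume.restrict (Ioi (0 : ℝ))).prod (volume : Measure (Rn n)))
  measurable_solution : AEStronglyMeasurable (Function.uncurry u)
    ((volume.restrict (Ioi (0 : ℝ))).prod (volume : Measure (Rn n)))
  integrable_forcing : ∀ ψ : 𝓢(Rn n, ℂ),
    (∀ᵐ t ∂(volume.restrict (Ioi (0 : ℝ))), Integrable (fun x => ψ x * F t x)) ∧
    ∀ t : ℝ, 0 ≤ t → IntervalIntegrable (fun s => ∫ x, ψ x * F s x) volume 0 t
  equation : ∃ U V : ℝ → 𝓢'(Rn n, ℂ),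
    (∀ᵐ t ∂(volume.restrict (Ioi (0 : ℝ))), IsRepresentedBy (U t) (u t)) ∧
    U 0 = f ∧ V 0 = g ∧
    ∀ ψ : 𝓢(Rn n, ℂ), ∀ t : ℝ, 0 ≤ t →
      HasDerivWithinAt (fun s => U s ψ) (V t ψ) (Ici 0) t ∧
      V t ψ = V 0 ψ + ∫ s in (0 : ℝ)..t, ((Δ (U s)) ψ + ∫ x, ψ x * F s x)

end

noncomputable section

/-! ### Polar coordinates -/

/-- The unit sphere of `ℝⁿ`. -/
abbrev unitSphere (n : ℕ) : Set (Rn n) := Metric.sphere (0 : Rn n) 1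

/-- The surface measure on the unit sphere of `ℝⁿ`. -/
abbrev sphereMeasure (n : ℕ) : Measure (unitSphere n) := (volume : Measure (Rn n)).toSphere

/-- The squared `L²` norm of `f` over the sphere of radius `r`, with respect to the surface measure
of the unit sphere. -/
def sphereSq {n : ℕ} (f : Rn n → ℂ) (r : ℝ) : ℝ≥0∞ :=
  ∫⁻ ω : unitSphere n, ‖f (r • ω.1)‖ₑ ^ 2 ∂(sphereMeasure n)

theorem lintegral_polar {n : ℕ} (hn : 0 < n) {f : Rn n → ℝ≥0∞} (hf : Measurable f) :
    ∫⁻ x, f x = ∫⁻ r : Ioi (0 : ℝ), ∫⁻ ω : unitSphere n, f (r.1 • ω.1)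
      ∂(sphereMeasure n) ∂(Measure.volumeIoiPow (n - 1)) := by
  have : Nonempty (Fin n) := ⟨⟨0, hn⟩⟩
  have h1 : ∫⁻ x, f x = ∫⁻ x in ({0}ᶜ : Set (Rn n)), f x := by
    rw [restrict_compl_singleton]
  have hm : MeasurableSet ({0}ᶜ : Set (Rn n)) := (measurableSet_singleton _).compl
  have hmp := (volume : Measure (Rn n)).measurePreserving_homeomorphUnitSphereProd
  simp only [finrank_euclideanSpace, Fintype.card_fin] at hmp
  have hg : Measurable (fun p : unitSphere n × Ioi (0 : ℝ) => f (p.2.1 • p.1.1)) :=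
    hf.comp ((measurable_subtype_coe.comp measurable_snd).smul
      (measurable_subtype_coe.comp measurable_fst))
  rw [h1, ← lintegral_subtype_comap hm]
  have h2 := hmp.lintegral_comp hg
  have h3 : ∀ x : ({0}ᶜ : Set (Rn n)),
      f (((homeomorphUnitSphereProd (Rn n)) x).2.1 • ((homeomorphUnitSphereProd (Rn n)) x).1.1)
        = f x := by
    intro x
    have hx : (x : Rn n) ≠ 0 := x.2
    simp [smul_smul, hx]
  simp only [h3] at h2
  rw [h2, lintegral_prod_symm _ hg.aemeasurable]

theorem ae_polar {n : ℕ} (hn : 0 < n) {p : Rn n → Prop} (hp : ∀ᵐ x, p x) :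
    ∀ᵐ r : Ioi (0 : ℝ) ∂(Measure.volumeIoiPow (n - 1)),
      ∀ᵐ ω : Metric.sphere (0 : Rn n) 1 ∂(sphereMeasure n), p (r.1 • ω.1) := by
  obtain ⟨s, hs, hsm, hs0⟩ := exists_measurable_superset_of_null (ae_iff.1 hp)
  have h := lintegral_polar hn (f := s.indicator 1) (measurable_one.indicator hsm)
  rw [lintegral_indicator_one hsm, hs0] at h
  have hmeas : Measurable (fun q : Ioi (0 : ℝ) × unitSphere n =>
      s.indicator (1 : Rn n → ℝ≥0∞) (q.1.1 • q.2.1)) :=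
    (measurable_one.indicator hsm).comp ((measurable_subtype_coe.comp measurable_fst).smul
      (measurable_subtype_coe.comp measurable_snd))
  have h2 := (lintegral_eq_zero_iff hmeas.lintegral_prod_right').1 h.symm
  filter_upwards [h2] with r hr
  have h3 := (lintegral_eq_zero_iff (hmeas.comp measurable_prodMk_left)).1 hr
  filter_upwards [h3] with ω hω
  by_contra hc
  have : r.1 • ω.1 ∈ s := hs hc
  simp [this] at hω

theorem measurable_sphereSq {n : ℕ} {X : Type*} [MeasurableSpace X] {f : X → Rn n → ℂ}
    (hf : Measurable (Function.uncurry f)) :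
    Measurable (fun p : X × ℝ => sphereSq (f p.1) p.2) := by
  unfold sphereSq
  refine Measurable.lintegral_prod_right' (f := fun q : (X × ℝ) × unitSphere n =>
    ‖f q.1.1 (q.1.2 • q.2.1)‖ₑ ^ 2) ?_
  have : Measurable (fun q : (X × ℝ) × unitSphere n =>
      Function.uncurry f (q.1.1, q.1.2 • q.2.1)) :=
    hf.comp ((measurable_fst.comp measurable_fst).prodMk
      ((measurable_snd.comp measurable_fst).smul (measurable_subtype_coe.comp measurable_snd)))
  exact this.enorm.pow_const 2

theorem Measurable.sphereSq {n : ℕ} {X Z : Type*} [MeasurableSpace X] [MeasurableSpace Z]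
    {f : X → Rn n → ℂ} (hf : Measurable (Function.uncurry f)) {a : Z → X} {ρ : Z → ℝ}
    (ha : Measurable a) (hρ : Measurable ρ) : Measurable (fun z => sphereSq (f (a z)) (ρ z)) := by
  have h := (measurable_sphereSq hf).comp (ha.prodMk hρ)
  simpa only [Function.comp_def] using h

theorem sphereSq_congr_ae {n : ℕ} (hn : 0 < n) {f g : Rn n → ℂ} (h : f =ᵐ[volume] g) :
    ∀ᵐ r : Ioi (0 : ℝ) ∂(Measure.volumeIoiPow (n - 1)), sphereSq f r.1 = sphereSq g r.1 := by
  filter_upwards [ae_polar hn h] with r hr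
  exact lintegral_congr_ae (hr.mono fun ω hω => by simp only [hω])

/-! ### A Schur test for oscillatory integral operators -/

theorem lintegral_enorm_sq_le_of_kernel {W Y : Type*} [MeasurableSpace W] [MeasurableSpace Y]
    (κ : Measure W) [IsFiniteMeasure κ] (ν : Measure Y) [SFinite ν] {e : W → Y → ℂ}
    (he : Measurable (Function.uncurry e)) (he1 : ∀ w y, ‖e w y‖ ≤ 1) {h : Y → ℂ}
    (hh : Integrable h ν) {B : ℝ≥0∞}
    (hB : ∀ᵐ y ∂ν, ∫⁻ y', ‖∫ w, e w y * (starRingEnd ℂ) (e w y') ∂κ‖ₑ ∂ν ≤ B) :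
    ∫⁻ w, ‖∫ y, e w y * h y ∂ν‖ₑ ^ 2 ∂κ ≤ B * ∫⁻ y, ‖h y‖ₑ ^ 2 ∂ν := by
  set G : W → ℂ := fun w => ∫ y, e w y * h y ∂ν with hG
  set k : Y × Y → ℂ := fun q => ∫ w, e w q.1 * (starRingEnd ℂ) (e w q.2) ∂κ with hk
  have hkm : StronglyMeasurable k := by
    refine StronglyMeasurable.integral_prod_right (f := fun q : (Y × Y) => fun w : W =>
      e w q.1 * (starRingEnd ℂ) (e w q.2)) ?_
    have h1 : Measurable (fun z : (Y × Y) × W => Function.uncurry e (z.2, z.1.1)) :=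
      he.comp (measurable_snd.prodMk (measurable_fst.comp measurable_fst))
    have h2 : Measurable (fun z : (Y × Y) × W => Function.uncurry e (z.2, z.1.2)) :=
      he.comp (measurable_snd.prodMk (measurable_snd.comp measurable_fst))
    exact (h1.mul (Complex.continuous_conj.measurable.comp h2)).stronglyMeasurable
  have hksymm : ∀ q : Y × Y, ‖k q.swap‖ₑ = ‖k q‖ₑ := by
    intro q
    have : k q.swap = (starRingEnd ℂ) (k q) := by
      simp only [hk, ← integral_conj]
      congr 1; ext w; simp [mul_comm]
    rw [this, ← ofReal_norm, RCLike.norm_conj, ofReal_norm]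
  -- the triple integrand
  set T : W × (Y × Y) → ℂ := fun z =>
    (e z.1 z.2.1 * (starRingEnd ℂ) (e z.1 z.2.2)) * (h z.2.1 * (starRingEnd ℂ) (h z.2.2)) with hT
  have hconj : Integrable (fun y => (starRingEnd ℂ) (h y)) ν := (Complex.conjCLE.integrable_comp_iff).2 hh
  have hhh : Integrable (fun q : Y × Y => h q.1 * (starRingEnd ℂ) (h q.2)) (ν.prod ν) :=
    hh.mul_prod hconj
  have hTi : Integrable T (κ.prod (ν.prod ν)) := by
    have h1 : Integrable (fun z : W × (Y × Y) => (1 : ℂ) * (h z.2.1 * (starRingEnd ℂ) (h z.2.2)))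
        (κ.prod (ν.prod ν)) := (integrable_const (1 : ℂ)).mul_prod hhh
    simp only [one_mul] at h1
    refine h1.bdd_mul (c := 1) ?_ ?_
    · have h1 : Measurable (fun z : W × (Y × Y) => Function.uncurry e (z.1, z.2.1)) :=
        he.comp (measurable_fst.prodMk (measurable_fst.comp measurable_snd))
      have h2 : Measurable (fun z : W × (Y × Y) => Function.uncurry e (z.1, z.2.2)) :=
        he.comp (measurable_fst.prodMk (measurable_snd.comp measurable_snd))
      exact (h1.mul (Complex.continuous_conj.measurable.comp h2)).aestronglyMeasurable
    · refine Eventually.of_forall fun z => ?_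
      rw [norm_mul, RCLike.norm_conj]
      exact mul_le_one₀ (he1 _ _) (norm_nonneg _) (he1 _ _)
  have hGG : ∀ w, G w * (starRingEnd ℂ) (G w) = ∫ q, T (w, q) ∂(ν.prod ν) := by
    intro w
    simp only [hG, ← integral_conj]
    rw [← integral_prod_mul]
    congr 1; ext q; simp only [hT, map_mul]; ring
  have hGm : Integrable (fun w => G w * (starRingEnd ℂ) (G w)) κ := by
    simp only [hGG]; exact hTi.integral_prod_left
  have h1 : ∫⁻ w, ‖G w‖ₑ ^ 2 ∂κ = ‖∫ w, G w * (starRingEnd ℂ) (G w) ∂κ‖ₑ := by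
    have h2 : ∀ w, G w * (starRingEnd ℂ) (G w) = ((‖G w‖ ^ 2 : ℝ) : ℂ) := by
      intro w; rw [Complex.mul_conj, Complex.normSq_eq_norm_sq]
    have h3 : Integrable (fun w => ‖G w‖ ^ 2) κ := by
      have := hGm.norm
      simpa [sq] using this
    simp only [h2]
    rw [integral_complex_ofReal, ← ofReal_norm, Complex.norm_real, Real.norm_of_nonneg
      (integral_nonneg fun _ => by positivity), ofReal_integral_eq_lintegral_ofReal h3
      (Eventually.of_forall fun _ => by positivity)]
    congr 1; ext w
    rw [ENNReal.ofReal_pow (norm_nonneg _), ofReal_norm]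
  have h4 : ∫ w, G w * (starRingEnd ℂ) (G w) ∂κ
      = ∫ q, k q * (h q.1 * (starRingEnd ℂ) (h q.2)) ∂(ν.prod ν) := by
    simp only [hGG]
    rw [integral_integral_swap (f := fun w q => T (w, q)) hTi]
    congr 1; ext q
    simp only [hT, hk]
    rw [integral_mul_const]
  have hhm : AEMeasurable (fun y => ‖h y‖ₑ) ν := hh.aestronglyMeasurable.enorm
  have hm1 : AEMeasurable (fun q : Y × Y => ‖k q‖ₑ * ‖h q.1‖ₑ ^ 2) (ν.prod ν) :=
    hkm.measurable.enorm.aemeasurable.mul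
      ((hhm.pow_const 2).comp_quasiMeasurePreserving Measure.quasiMeasurePreserving_fst)
  have h5 : ∫⁻ q, ‖k q‖ₑ * ‖h q.1‖ₑ ^ 2 ∂(ν.prod ν) ≤ B * ∫⁻ y, ‖h y‖ₑ ^ 2 ∂ν := by
    rw [lintegral_prod _ hm1, ← lintegral_const_mul'' _ (hhm.pow_const 2)]
    refine lintegral_mono_ae ?_
    filter_upwards [hB] with y hy
    rw [lintegral_mul_const' _ _ (by finiteness)]
    gcongr
  have h6 : ∫⁻ q, ‖k q‖ₑ * ‖h q.2‖ₑ ^ 2 ∂(ν.prod ν) = ∫⁻ q, ‖k q‖ₑ * ‖h q.1‖ₑ ^ 2 ∂(ν.prod ν) := by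
    rw [← (Measure.measurePreserving_swap (μ := ν) (ν := ν)).lintegral_comp_emb
      MeasurableEquiv.prodComm.measurableEmbedding]
    simp only [hksymm, Prod.snd_swap]
  rw [h1, h4]
  refine (enorm_integral_le_lintegral_enorm _).trans ?_
  have h7 : ∀ q : Y × Y, 2 * ‖k q * (h q.1 * (starRingEnd ℂ) (h q.2))‖ₑ ≤
      ‖k q‖ₑ * ‖h q.1‖ₑ ^ 2 + ‖k q‖ₑ * ‖h q.2‖ₑ ^ 2 := by
    intro q
    simp only [← ofReal_norm]
    rw [← ENNReal.ofReal_pow (norm_nonneg _), ← ENNReal.ofReal_pow (norm_nonneg _),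
      ← ENNReal.ofReal_mul (norm_nonneg _), ← ENNReal.ofReal_mul (norm_nonneg _),
      ← ENNReal.ofReal_add (by positivity) (by positivity), ← ENNReal.ofReal_ofNat,
      ← ENNReal.ofReal_mul (by norm_num)]
    refine ENNReal.ofReal_le_ofReal ?_
    rw [norm_mul, norm_mul, RCLike.norm_conj]
    nlinarith [mul_nonneg (norm_nonneg (k q)) (sq_nonneg (‖h q.1‖ - ‖h q.2‖))]
  have h8 : 2 * ∫⁻ q, ‖k q * (h q.1 * (starRingEnd ℂ) (h q.2))‖ₑ ∂(ν.prod ν)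
      ≤ 2 * (B * ∫⁻ y, ‖h y‖ₑ ^ 2 ∂ν) := by
    rw [← lintegral_const_mul' _ _ (by norm_num)]
    refine (lintegral_mono h7).trans ?_
    rw [lintegral_add_left' hm1, h6, two_mul]
    exact add_le_add h5 h5
  exact (ENNReal.mul_le_mul_iff_right (by norm_num) (by norm_num)).1 h8

theorem lintegral_volumeIoiPow (k : ℕ) {g : ℝ → ℝ≥0∞} (hg : Measurable g) :
    ∫⁻ r : Ioi (0 : ℝ), g r.1 ∂(Measure.volumeIoiPow k) =
      ∫⁻ r in Ioi (0 : ℝ), ENNReal.ofReal (r ^ k) * g r := by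
  rw [Measure.volumeIoiPow, lintegral_withDensity_eq_lintegral_mul _ (by fun_prop) (by fun_prop)]
  simp only [Pi.mul_apply]
  exact lintegral_subtype_comap measurableSet_Ioi (fun r => ENNReal.ofReal (r ^ k) * g r)

/-! ### Gaussian measures -/

section Osc

variable {V : Type*} [NormedAddCommGroup V] [InnerProductSpace ℝ V]

/-- The oscillating factor `exp (-2π i ⟪w, x⟫)` of the Fourier transform. -/
def osc (w x : V) : ℂ := Complex.exp (((-2 * Real.pi * inner ℝ w x : ℝ) : ℂ) * Complex.I)

theorem norm_osc (w x : V) : ‖osc w x‖ = 1 := Complex.norm_exp_ofReal_mul_I _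

@[fun_prop]
theorem Continuous.osc {X : Type*} [TopologicalSpace X] {f g : X → V} (hf : Continuous f)
    (hg : Continuous g) : Continuous (fun x => osc (f x) (g x)) := by
  unfold _root_.osc; fun_prop

theorem osc_mul_conj (w x y : V) : osc w x * (starRingEnd ℂ) (osc w y) = osc w (x - y) := by
  unfold osc
  rw [← Complex.exp_conj, ← Complex.exp_add, map_mul, Complex.conj_ofReal, Complex.conj_I,
    inner_sub_right]
  congr 1; push_cast; ring

end Osc

section Gaussian

variable {V : Type*} [NormedAddCommGroup V] [InnerProductSpace ℝ V] [FiniteDimensional ℝ V]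
  [MeasurableSpace V] [BorelSpace V]

/-- The Gaussian measure `exp (-b ‖w‖²) dw` (not normalised). -/
def gaussMeasure (V : Type*) [NormedAddCommGroup V] [InnerProductSpace ℝ V] [FiniteDimensional ℝ V]
    [MeasurableSpace V] [BorelSpace V] (b : ℝ) : Measure V :=
  volume.withDensity fun w => ENNReal.ofReal (Real.exp (-b * ‖w‖ ^ 2))

theorem integrable_rexp_neg_mul_sq_norm {b : ℝ} (hb : 0 < b) :
    Integrable (fun w : V => Real.exp (-b * ‖w‖ ^ 2)) := by
  have h := (GaussianFourier.integrable_cexp_neg_mul_sq_norm_add (V := V) (b := (b : ℂ))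
    (by simpa using hb) 0 0).norm
  refine h.congr (Eventually.of_forall fun w => ?_)
  simp only [Complex.norm_exp]
  congr 1
  have : -(b : ℂ) * (‖w‖ : ℂ) ^ 2 + 0 * ((inner ℝ 0 w : ℝ) : ℂ) = ((-b * ‖w‖ ^ 2 : ℝ) : ℂ) := by
    push_cast; ring
  rw [this, Complex.ofReal_re]

theorem lintegral_rexp_neg_mul_sq_norm {b : ℝ} (hb : 0 < b) :
    ∫⁻ w : V, ENNReal.ofReal (Real.exp (-b * ‖w‖ ^ 2)) =
      ENNReal.ofReal ((Real.pi / b) ^ (Module.finrank ℝ V / 2 : ℝ)) := by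
  rw [← ofReal_integral_eq_lintegral_ofReal (integrable_rexp_neg_mul_sq_norm hb)
    (Eventually.of_forall fun _ => (Real.exp_pos _).le),
    GaussianFourier.integral_rexp_neg_mul_sq_norm hb]

theorem isFiniteMeasure_gaussMeasure {b : ℝ} (hb : 0 < b) : IsFiniteMeasure (gaussMeasure V b) := by
  constructor
  rw [gaussMeasure, withDensity_apply _ MeasurableSet.univ, Measure.restrict_univ,
    lintegral_rexp_neg_mul_sq_norm hb]
  exact ENNReal.ofReal_lt_top

theorem fourier_eq_osc (f : V → ℂ) (x : V) : 𝓕 f x = ∫ v, osc v x * f v := by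
  rw [Real.fourier_eq']; rfl

theorem integral_osc_gaussMeasure {b : ℝ} (hb : 0 < b) (x : V) :
    ∫ w, osc w x ∂(gaussMeasure V b) = (((Real.pi / b) ^ (Module.finrank ℝ V / 2 : ℝ) *
      Real.exp (-(Real.pi ^ 2 / b) * ‖x‖ ^ 2) : ℝ) : ℂ) := by
  rw [gaussMeasure, integral_withDensity_eq_integral_toReal_smul (by fun_prop)
    (Eventually.of_forall fun _ => ENNReal.ofReal_lt_top)]
  have h := fourier_gaussian_innerProductSpace (V := V) (b := (b : ℂ)) (by simpa using hb) x
  rw [fourier_eq_osc] at h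
  have h2 : ∀ w : V, (ENNReal.ofReal (Real.exp (-b * ‖w‖ ^ 2))).toReal • osc w x =
      osc w x * Complex.exp (-(b : ℂ) * (‖w‖ : ℂ) ^ 2) := by
    intro w
    rw [ENNReal.toReal_ofReal (Real.exp_pos _).le, Complex.real_smul, mul_comm, Complex.ofReal_exp]
    push_cast; rfl
  simp only [h2]
  rw [h]
  push_cast
  rw [Complex.ofReal_cpow (by positivity)]
  push_cast
  congr 2
  ring

end Gaussian

/-! ### Spherical caps -/

theorem exists_cap_bound (n : ℕ) (hn : 0 < n) : ∃ C : ℝ≥0, ∀ lam : ℝ, 0 < lam →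
    ∀ ω₀ : unitSphere n,
    ∫⁻ ω : unitSphere n, ENNReal.ofReal (Real.exp (-lam ^ 2 * ‖ω₀.1 - ω.1‖ ^ 2))
      ∂(sphereMeasure n) ≤
      C * ENNReal.ofReal (min 1 (lam ^ (-((n : ℝ) - 1)))) := by
  set C1 : ℝ := Real.exp (1 / 4) * (8 * Real.pi) ^ ((n : ℝ) / 2) with hC1
  have hC1p : 0 < C1 := by positivity
  refine ⟨(sphereMeasure n univ).toNNReal + C1.toNNReal, fun lam hlam ω₀ => ?_⟩
  set I := ∫⁻ ω : unitSphere n,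
    ENNReal.ofReal (Real.exp (-lam ^ 2 * ‖ω₀.1 - ω.1‖ ^ 2)) ∂(sphereMeasure n) with hI
  have hI1 : I ≤ (sphereMeasure n univ).toNNReal := by
    rw [ENNReal.coe_toNNReal (measure_ne_top _ _)]
    calc I ≤ ∫⁻ _, 1 ∂(sphereMeasure n) := by
          refine lintegral_mono fun ω => ?_
          rw [← ENNReal.ofReal_one]
          refine ENNReal.ofReal_le_ofReal (Real.exp_le_one_iff.2 ?_)
          nlinarith [sq_nonneg lam, sq_nonneg ‖ω₀.1 - ω.1‖, mul_nonneg (sq_nonneg lam) (sq_nonneg ‖ω₀.1 - ω.1‖)]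
      _ = sphereMeasure n univ := by simp
  have hn1 : (1 : ℝ) ≤ n := by exact_mod_cast hn
  rcases le_total lam 1 with h1 | h1
  · have : 1 ≤ lam ^ (-((n : ℝ) - 1)) :=
      Real.one_le_rpow_of_pos_of_le_one_of_nonpos hlam h1 (by linarith)
    rw [min_eq_left this, ENNReal.ofReal_one, mul_one]
    exact hI1.trans (by push_cast; exact le_self_add)
  · have hle : lam ^ (-((n : ℝ) - 1)) ≤ 1 := Real.rpow_le_one_of_one_le_of_nonpos h1 (by linarith)
    rw [min_eq_right hle]
    suffices h : I ≤ ENNReal.ofReal C1 * ENNReal.ofReal (lam ^ (-((n : ℝ) - 1))) by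
      refine h.trans ?_
      gcongr
      push_cast
      exact le_add_self
    have hb : 0 < lam ^ 2 / 8 := by positivity
    have hG := lintegral_rexp_neg_mul_sq_norm (V := Rn n) hb
    rw [← lintegral_sub_right_eq_self _ ω₀.1, finrank_euclideanSpace, Fintype.card_fin,
      lintegral_polar hn (by fun_prop)] at hG
    set g : ℝ → ℝ≥0∞ := (Icc (1 : ℝ) (1 + 1 / lam)).indicator
      (fun _ => ENNReal.ofReal (Real.exp (-(1 / 4))) * I) with hg
    have hlow : ∫⁻ r : Ioi (0 : ℝ), g r.1 ∂(Measure.volumeIoiPow (n - 1)) ≤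
        ENNReal.ofReal ((Real.pi / (lam ^ 2 / 8)) ^ ((n : ℝ) / 2)) := by
      rw [← hG]
      refine lintegral_mono fun r => ?_
      simp only [hg]
      by_cases hr : r.1 ∈ Icc (1 : ℝ) (1 + 1 / lam)
      · rw [indicator_of_mem hr, hI, ← lintegral_const_mul' _ _ ENNReal.ofReal_ne_top]
        refine lintegral_mono fun ω => ?_
        rw [← ENNReal.ofReal_mul (Real.exp_pos _).le, ← Real.exp_add]
        refine ENNReal.ofReal_le_ofReal (Real.exp_le_exp.2 ?_)
        have hω : ‖ω.1‖ = 1 := by simp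
        have hω0 : ‖ω₀.1‖ = 1 := by simp
        obtain ⟨r, hr0⟩ := r
        simp only at hr ⊢
        have hil : 0 < 1 / lam := by positivity
        have hr2 : r ≤ 2 := by
          have : 1 / lam ≤ 1 := by rw [div_le_one hlam]; exact h1
          linarith [hr.2]
        have h3 : ‖r • ω.1 - ω₀.1‖ ≤ r * ‖ω₀.1 - ω.1‖ + 1 / lam := by
          have : r • ω.1 - ω₀.1 = r • (ω.1 - ω₀.1) + (r - 1) • ω₀.1 := by
            rw [smul_sub, sub_smul, one_smul]; abel
          rw [this]
          refine (norm_add_le _ _).trans ?_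
          rw [norm_smul, norm_smul, hω0, Real.norm_of_nonneg (by linarith [hr.1]),
            Real.norm_of_nonneg (by linarith [hr.1]), norm_sub_rev]
          linarith [hr.2]
        set d := ‖ω₀.1 - ω.1‖
        have hd : 0 ≤ d := norm_nonneg _
        have h4 : lam * ‖r • ω.1 - ω₀.1‖ ≤ 2 * (lam * d) + 1 := by
          have h5 : lam * ‖r • ω.1 - ω₀.1‖ ≤ lam * (2 * d + 1 / lam) := by
            gcongr
            refine h3.trans ?_
            gcongr
          calc _ ≤ _ := h5
            _ = _ := by field_simp
        have h6 : (lam * ‖r • ω.1 - ω₀.1‖) ^ 2 ≤ (2 * (lam * d) + 1) ^ 2 := by gcongr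
        nlinarith [sq_nonneg (2 * (lam * d) - 1)]
      · rw [indicator_of_notMem hr]; exact bot_le
    rw [lintegral_volumeIoiPow _ (measurable_const.indicator measurableSet_Icc)] at hlow
    have hlow2 : ENNReal.ofReal (1 / lam) * (ENNReal.ofReal (Real.exp (-(1 / 4))) * I) ≤
        ∫⁻ r in Ioi (0 : ℝ), ENNReal.ofReal (r ^ (n - 1)) * g r := by
      calc ENNReal.ofReal (1 / lam) * (ENNReal.ofReal (Real.exp (-(1 / 4))) * I)
          = ∫⁻ _ in Icc (1 : ℝ) (1 + 1 / lam), ENNReal.ofReal (Real.exp (-(1 / 4))) * I := by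
            rw [setLIntegral_const, Real.volume_Icc, mul_comm]; congr 2; ring
        _ ≤ ∫⁻ r in Icc (1 : ℝ) (1 + 1 / lam), ENNReal.ofReal (r ^ (n - 1)) * g r := by
            refine setLIntegral_mono' measurableSet_Icc fun r hr => ?_
            rw [hg, indicator_of_mem hr]
            refine le_mul_of_one_le_left bot_le ?_
            rw [← ENNReal.ofReal_one]
            exact ENNReal.ofReal_le_ofReal (one_le_pow₀ hr.1)
        _ ≤ _ := lintegral_mono_set fun r hr => lt_of_lt_of_le one_pos hr.1
    have h7 := hlow2.trans hlow
    have h8 : I = ENNReal.ofReal (lam * Real.exp (1 / 4)) *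
        (ENNReal.ofReal (1 / lam) * (ENNReal.ofReal (Real.exp (-(1 / 4))) * I)) := by
      rw [← mul_assoc, ← mul_assoc, ← ENNReal.ofReal_mul (by positivity),
        ← ENNReal.ofReal_mul (by positivity)]
      have : lam * Real.exp (1 / 4) * (1 / lam) * Real.exp (-(1 / 4)) = 1 := by
        rw [Real.exp_neg]; field_simp
      rw [this]; simp
    rw [h8]
    refine (mul_le_mul_right h7 _).trans (le_of_eq ?_)
    rw [← ENNReal.ofReal_mul (by positivity), ← ENNReal.ofReal_mul (by positivity)]
    congr 1
    rw [hC1, show Real.pi / (lam ^ 2 / 8) = (8 * Real.pi) * (lam ^ (-2 : ℝ)) by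
      rw [Real.rpow_neg hlam.le, Real.rpow_two]; field_simp,
      Real.mul_rpow (by positivity) (by positivity), ← Real.rpow_mul hlam.le]
    have : lam ^ (-((n : ℝ) - 1)) = lam * lam ^ (-2 * ((n : ℝ) / 2)) := by
      nth_rewrite 2 [← Real.rpow_one lam]
      rw [← Real.rpow_add hlam]; congr 1; ring
    rw [this]; ring

theorem lintegral_mul_sq_le {X : Type*} [MeasurableSpace X] {μ : Measure X} {f g : X → ℝ≥0∞}
    (hf : AEMeasurable f μ) (hg : AEMeasurable g μ) :
    (∫⁻ x, f x * g x ∂μ) ^ 2 ≤ (∫⁻ x, f x ^ 2 ∂μ) * ∫⁻ x, g x ^ 2 ∂μ := by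
  have h := ENNReal.lintegral_mul_le_Lp_mul_Lq μ Real.HolderConjugate.two_two hf hg
  calc (∫⁻ x, f x * g x ∂μ) ^ 2 ≤ _ := pow_le_pow_left' h 2
    _ = _ := by
      rw [mul_pow, ← ENNReal.rpow_natCast, ← ENNReal.rpow_natCast, ← ENNReal.rpow_mul,
        ← ENNReal.rpow_mul]
      norm_num

/-! ### Frequency-localised estimates -/

/-- The half-wave with profile `h` on the Fourier side (the sign of the phase is `ς`). -/
def halfWave {n : ℕ} (ς : ℝ) (h : Rn n → ℂ) (t : ℝ) (x : Rn n) : ℂ :=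
  ∫ ξ, osc ξ x * (osc t (ς * ‖ξ‖) * h ξ)

theorem osc_comm {V : Type*} [NormedAddCommGroup V] [InnerProductSpace ℝ V] (x y : V) :
    osc x y = osc y x := by
  unfold osc; rw [real_inner_comm]

theorem measurable_halfWave {n : ℕ} (ς : ℝ) {h : Rn n → ℂ} (hh : Measurable h) :
    Measurable (Function.uncurry (halfWave ς h)) := by
  unfold halfWave
  refine (StronglyMeasurable.integral_prod_right (f := fun p : ℝ × Rn n => fun ξ : Rn n =>
    osc ξ p.2 * (osc p.1 (ς * ‖ξ‖) * h ξ)) ?_).measurable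
  have h1 : Continuous (fun z : (ℝ × Rn n) × Rn n => osc z.2 z.1.2) := by fun_prop
  have h2 : Continuous (fun z : (ℝ × Rn n) × Rn n => osc z.1.1 (ς * ‖z.2‖)) := by fun_prop
  exact (h1.measurable.mul (h2.measurable.mul (hh.comp measurable_snd))).stronglyMeasurable

theorem norm_fourierIntegral_le {n : ℕ} {h : Rn n → ℂ} (x : Rn n) :
    ‖∫ ξ, osc ξ x * h ξ‖ ≤ ∫ ξ, ‖h ξ‖ := by
  refine (norm_integral_le_integral_norm _).trans (le_of_eq ?_)
  simp only [norm_mul, norm_osc, one_mul]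

theorem enorm_integral_osc_gaussMeasure {V : Type*} [NormedAddCommGroup V] [InnerProductSpace ℝ V]
    [FiniteDimensional ℝ V] [MeasurableSpace V] [BorelSpace V] {b : ℝ} (hb : 0 < b) (x : V) :
    ‖∫ w, osc w x ∂(gaussMeasure V b)‖ₑ =
      ENNReal.ofReal ((Real.pi / b) ^ (Module.finrank ℝ V / 2 : ℝ)) *
      ENNReal.ofReal (Real.exp (-(Real.pi ^ 2 / b) * ‖x‖ ^ 2)) := by
  rw [integral_osc_gaussMeasure hb, ← ofReal_norm, Complex.norm_real,
    Real.norm_of_nonneg (by positivity), ENNReal.ofReal_mul (by positivity)]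

theorem pi_mul_rpow_le {n : ℕ} (hn : 0 < n) {lam : ℝ} (h : 0 < lam) :
    min 1 ((Real.pi * lam) ^ (-((n : ℝ) - 1))) ≤ min 1 (lam ^ (-((n : ℝ) - 1))) := by
  refine min_le_min_left _ (Real.rpow_le_rpow_of_nonpos h ?_ ?_)
  · nlinarith [Real.pi_gt_three]
  · have : (1 : ℝ) ≤ n := by exact_mod_cast hn
    linarith

theorem exists_sphereSq_fourier_le (n : ℕ) (hn : 0 < n) : ∃ C : ℝ≥0, ∀ a r : ℝ, 0 < a → 0 < r →
    ∀ h : Rn n → ℂ, Integrable h → (∀ ξ, 2 * a ≤ ‖ξ‖ → h ξ = 0) →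
    sphereSq (fun x => ∫ ξ, osc ξ x * h ξ) r ≤
      C * ENNReal.ofReal (a ^ n * min 1 ((r * a) ^ (-((n : ℝ) - 1)))) * ∫⁻ ξ, ‖h ξ‖ₑ ^ 2 := by
  obtain ⟨C, hC⟩ := exists_cap_bound n hn
  refine ⟨(Real.exp 4 * Real.pi ^ ((n : ℝ) / 2)).toNNReal * C, fun a r ha hr h hh hsupp => ?_⟩
  set g : unitSphere n → ℂ := fun ω => ∫ ξ, osc ξ (r • ω.1) * h ξ with hg
  have hgc : Continuous g := by
    refine continuous_of_dominated (bound := fun ξ => ‖h ξ‖) ?_ ?_ hh.norm ?_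
    · intro ω
      have h1 : Continuous (fun ξ : Rn n => osc ξ (r • ω.1)) := by fun_prop
      exact h1.aestronglyMeasurable.mul hh.aestronglyMeasurable
    · intro ω; refine Eventually.of_forall fun ξ => ?_
      rw [norm_mul, norm_osc, one_mul]
    · refine Eventually.of_forall fun ξ => ?_
      fun_prop
  have hgb : ∀ ω, ‖g ω‖ ≤ ∫ ξ, ‖h ξ‖ := fun ω => norm_fourierIntegral_le _
  have hgi : Integrable (fun ω => (starRingEnd ℂ) (g ω)) (sphereMeasure n) :=
    Integrable.of_bound (Complex.continuous_conj.comp hgc).aestronglyMeasurable (∫ ξ, ‖h ξ‖)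
      (Eventually.of_forall fun ω => by rw [RCLike.norm_conj]; exact hgb ω)
  set T := ∫⁻ ω, ‖g ω‖ₑ ^ 2 ∂(sphereMeasure n) with hT
  change T ≤ _
  have hTfin : T ≠ ∞ := by
    refine ne_of_lt ?_
    calc T ≤ ∫⁻ _, ENNReal.ofReal (∫ ξ, ‖h ξ‖) ^ 2 ∂(sphereMeasure n) := by
          refine lintegral_mono fun ω => ?_
          rw [← ofReal_norm]
          gcongr
          exact hgb ω
      _ < ∞ := by
          rw [lintegral_const]
          exact ENNReal.mul_lt_top (by finiteness) (measure_lt_top _ _)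
  set G : Rn n → ℂ := fun ξ => ∫ ω, osc ξ (r • ω.1) * (starRingEnd ℂ) (g ω) ∂(sphereMeasure n) with hG
  have hGm : StronglyMeasurable G := by
    refine StronglyMeasurable.integral_prod_right (f := fun ξ : Rn n => fun ω : unitSphere n =>
      osc ξ (r • ω.1) * (starRingEnd ℂ) (g ω)) ?_
    refine Continuous.stronglyMeasurable ?_
    have h1 : Continuous (fun z : Rn n × unitSphere n => osc z.1 (r • z.2.1)) := by fun_prop
    exact h1.mul (Complex.continuous_conj.comp (hgc.comp continuous_snd))
  -- duality
  have hdual : T = ‖∫ ξ, h ξ * G ξ‖ₑ := by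
    have h1 : ∫ ξ, h ξ * G ξ = ∫ ω, ((‖g ω‖ ^ 2 : ℝ) : ℂ) ∂(sphereMeasure n) := by
      have hi : Integrable (Function.uncurry fun (ξ : Rn n) (ω : unitSphere n) =>
          osc ξ (r • ω.1) * (h ξ * (starRingEnd ℂ) (g ω))) (volume.prod (sphereMeasure n)) := by
        refine (hh.mul_prod hgi).bdd_mul (c := 1) ?_ ?_
        · have h1 : Continuous (fun z : Rn n × unitSphere n => osc z.1 (r • z.2.1)) := by fun_prop
          exact h1.aestronglyMeasurable
        · exact Eventually.of_forall fun z => (norm_osc _ _).le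
      calc ∫ ξ, h ξ * G ξ = ∫ ξ, ∫ ω, osc ξ (r • ω.1) * (h ξ * (starRingEnd ℂ) (g ω)) ∂(sphereMeasure n) := by
            congr 1; ext ξ
            simp only [hG]
            rw [← integral_const_mul]
            congr 1; ext ω; ring
        _ = ∫ ω, (∫ ξ, osc ξ (r • ω.1) * (h ξ * (starRingEnd ℂ) (g ω))) ∂(sphereMeasure n) :=
            integral_integral_swap hi
        _ = _ := by
            congr 1; ext ω
            have : ∀ ξ, osc ξ (r • ω.1) * (h ξ * (starRingEnd ℂ) (g ω)) =
                (osc ξ (r • ω.1) * h ξ) * (starRingEnd ℂ) (g ω) := fun ξ => by ring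
            simp only [this]
            rw [integral_mul_const, ← Complex.normSq_eq_norm_sq, ← Complex.mul_conj]
    have hi2 : Integrable (fun ω => ‖g ω‖ ^ 2) (sphereMeasure n) :=
      Integrable.of_bound (hgc.norm.pow 2).aestronglyMeasurable ((∫ ξ, ‖h ξ‖) ^ 2)
        (Eventually.of_forall fun ω => by
          rw [Real.norm_of_nonneg (by positivity)]
          gcongr; exact hgb ω)
    rw [h1, integral_complex_ofReal, ← ofReal_norm, Complex.norm_real, Real.norm_of_nonneg
      (integral_nonneg fun _ => by positivity), ofReal_integral_eq_lintegral_ofReal hi2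
      (Eventually.of_forall fun _ => by positivity), hT]
    congr 1; ext ω
    rw [ENNReal.ofReal_pow (norm_nonneg _), ofReal_norm]
  have hb : 0 < (1 / a ^ 2 : ℝ) := by positivity
  set B : ℝ≥0∞ := ENNReal.ofReal (Real.pi ^ ((n : ℝ) / 2)) *
    (C * ENNReal.ofReal (a ^ n * min 1 ((r * a) ^ (-((n : ℝ) - 1))))) with hB
  have := isFiniteMeasure_gaussMeasure (V := Rn n) hb
  have hgauss : ∫⁻ ξ, ‖G ξ‖ₑ ^ 2 ∂(gaussMeasure (Rn n) (1 / a ^ 2)) ≤ B * T := by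
    have hconj : T = ∫⁻ ω, ‖(starRingEnd ℂ) (g ω)‖ₑ ^ 2 ∂(sphereMeasure n) := by
      rw [hT]; congr 1; ext ω; rw [← ofReal_norm, ← ofReal_norm, RCLike.norm_conj]
    rw [hconj]
    refine lintegral_enorm_sq_le_of_kernel (gaussMeasure (Rn n) (1 / a ^ 2)) (sphereMeasure n)
      (e := fun ξ ω => osc ξ (r • ω.1)) ?_ (fun w y => (norm_osc _ _).le) hgi
      (Eventually.of_forall fun ω₀ => ?_)
    · have h1 : Continuous (fun z : Rn n × unitSphere n => osc z.1 (r • z.2.1)) := by fun_prop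
      exact h1.measurable
    · simp only [osc_mul_conj, enorm_integral_osc_gaussMeasure hb]
      rw [lintegral_const_mul' _ _ ENNReal.ofReal_ne_top, finrank_euclideanSpace, Fintype.card_fin]
      have h2 := hC (Real.pi * (r * a)) (by positivity) ω₀
      have h3 : ∀ ω : unitSphere n, -(Real.pi ^ 2 / (1 / a ^ 2)) * ‖r • ω₀.1 - r • ω.1‖ ^ 2 =
          -(Real.pi * (r * a)) ^ 2 * ‖ω₀.1 - ω.1‖ ^ 2 := by
        intro ω
        rw [← smul_sub, norm_smul, Real.norm_of_nonneg hr.le]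
        field_simp
      simp only [h3]
      have h4 : (Real.pi / (1 / a ^ 2)) ^ ((n : ℝ) / 2) = Real.pi ^ ((n : ℝ) / 2) * a ^ n := by
        rw [div_div_eq_mul_div, div_one, Real.mul_rpow (by positivity) (by positivity),
          ← Real.rpow_natCast a 2, ← Real.rpow_mul ha.le, ← Real.rpow_natCast a n]
        congr 2; push_cast; ring
      rw [h4, ENNReal.ofReal_mul (by positivity), hB, ENNReal.ofReal_mul (by positivity), mul_assoc]
      refine mul_le_mul_right ?_ _
      rw [mul_left_comm (C : ℝ≥0∞)]
      refine mul_le_mul_right (h2.trans ?_) _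
      exact mul_le_mul_right (ENNReal.ofReal_le_ofReal (pi_mul_rpow_le hn (by positivity))) _
  have hball : ∫⁻ ξ in Metric.ball 0 (2 * a), ‖G ξ‖ₑ ^ 2 ≤ ENNReal.ofReal (Real.exp 4) * (B * T) := by
    refine le_trans ?_ (mul_le_mul_right hgauss _)
    rw [gaussMeasure, lintegral_withDensity_eq_lintegral_mul _ (by fun_prop)
      (hGm.measurable.enorm.pow_const 2), ← lintegral_const_mul' _ _ ENNReal.ofReal_ne_top]
    refine (setLIntegral_mono' Metric.isOpen_ball.measurableSet fun ξ hξ => ?_).trans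
      (setLIntegral_le_lintegral _ _)
    simp only [Pi.mul_apply]
    rw [← mul_assoc, ← ENNReal.ofReal_mul (by positivity), ← Real.exp_add]
    refine le_mul_of_one_le_left bot_le ?_
    rw [← ENNReal.ofReal_one]
    refine ENNReal.ofReal_le_ofReal (Real.one_le_exp ?_)
    have h5 : ‖ξ‖ < 2 * a := by simpa using hξ
    have h6 : ‖ξ‖ ^ 2 ≤ (2 * a) ^ 2 := by gcongr
    have : 1 / a ^ 2 * ‖ξ‖ ^ 2 ≤ 4 := by
      rw [one_div, inv_mul_le_iff₀ (by positivity)]; linarith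
    linarith
  have hT2 : T ^ 2 ≤ (∫⁻ ξ, ‖h ξ‖ₑ ^ 2) * (ENNReal.ofReal (Real.exp 4) * (B * T)) := by
    calc T ^ 2 ≤ (∫⁻ ξ in Metric.ball 0 (2 * a), ‖h ξ‖ₑ * ‖G ξ‖ₑ) ^ 2 := by
          gcongr
          rw [hdual, ← setIntegral_eq_integral_of_forall_compl_eq_zero (s := Metric.ball 0 (2 * a))]
          · refine (enorm_integral_le_lintegral_enorm _).trans (le_of_eq ?_)
            simp only [enorm_mul]
          · intro ξ hξ
            rw [hsupp ξ (by simpa using hξ), zero_mul]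
      _ ≤ (∫⁻ ξ in Metric.ball 0 (2 * a), ‖h ξ‖ₑ ^ 2) * ∫⁻ ξ in Metric.ball 0 (2 * a), ‖G ξ‖ₑ ^ 2 :=
          lintegral_mul_sq_le hh.aestronglyMeasurable.enorm.restrict hGm.measurable.enorm.aemeasurable
      _ ≤ _ := mul_le_mul' (setLIntegral_le_lintegral _ _) hball
  have hfin : T ≤ (∫⁻ ξ, ‖h ξ‖ₑ ^ 2) * (ENNReal.ofReal (Real.exp 4) * B) := by
    rcases eq_or_ne T 0 with h0 | h0
    · rw [h0]; exact bot_le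
    · refine (ENNReal.mul_le_mul_iff_left h0 hTfin).1 ?_
      rw [← sq]
      refine hT2.trans (le_of_eq ?_)
      ring
  refine hfin.trans (le_of_eq ?_)
  have hc : ((Real.exp 4 * Real.pi ^ ((n : ℝ) / 2)).toNNReal : ℝ≥0∞) =
      ENNReal.ofReal (Real.exp 4) * ENNReal.ofReal (Real.pi ^ ((n : ℝ) / 2)) := by
    rw [← ENNReal.ofReal_mul (Real.exp_pos 4).le]; rfl
  rw [hB, ENNReal.coe_mul, hc]
  ring

theorem mul_norm_sub_le_norm_smul_sub_smul {n : ℕ} (ω ω' : unitSphere n) {a ρ ρ' : ℝ} (ha : 0 < a) (h : a ≤ ρ)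
    (h' : a ≤ ρ') :
    a ^ 2 * ‖ω.1 - ω'.1‖ ^ 2 ≤ ‖ρ • ω.1 - ρ' • ω'.1‖ ^ 2 := by
  have h1 : ‖ω.1‖ = 1 := by simp
  have h2 : ‖ω'.1‖ = 1 := by simp
  rw [norm_sub_sq_real, norm_sub_sq_real, norm_smul, norm_smul, h1, h2, real_inner_smul_left,
    real_inner_smul_right, Real.norm_of_nonneg (by linarith), Real.norm_of_nonneg (by linarith)]
  set c : ℝ := inner ℝ ω.1 ω'.1
  have hc : c ≤ 1 := by
    have := real_inner_le_norm ω.1 ω'.1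
    rwa [h1, h2, one_mul] at this
  have h3 : a ^ 2 ≤ ρ * ρ' := by nlinarith
  nlinarith [sq_nonneg (ρ - ρ'), mul_le_mul_of_nonneg_right h3 (by linarith : 0 ≤ 1 - c)]

theorem lintegral_gaussian_kernel_le (δ : ℝ) (hδ : 0 < δ) (c : ℝ) :
    ∫⁻ ρ : ℝ, ENNReal.ofReal ((Real.pi / δ) ^ (1 / 2 : ℝ)) *
      ENNReal.ofReal (Real.exp (-(Real.pi ^ 2 / δ) * (c - ρ) ^ 2)) = 1 := by
  have h := lintegral_rexp_neg_mul_sq_norm (V := ℝ) (b := Real.pi ^ 2 / δ) (by positivity)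
  rw [← lintegral_sub_left_eq_self _ c] at h
  simp only [Module.finrank_self, Nat.cast_one, Real.norm_eq_abs, sq_abs] at h
  rw [lintegral_const_mul' _ _ ENNReal.ofReal_ne_top, h, ← ENNReal.ofReal_mul (by positivity),
    ← Real.mul_rpow (by positivity) (by positivity)]
  have : Real.pi / δ * (Real.pi / (Real.pi ^ 2 / δ)) = 1 := by field_simp
  rw [this]; simp

theorem exists_local_energy_gauss (n : ℕ) (hn : 0 < n) : ∃ C : ℝ≥0, ∀ a R ς δ : ℝ, 0 < a → 0 < R →
    0 < δ → |ς| = 1 → ∀ h : Rn n → ℂ, Measurable h → Integrable h →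
    (∀ ξ, ‖ξ‖ < a ∨ 2 * a ≤ ‖ξ‖ → h ξ = 0) →
    ∫⁻ t, ENNReal.ofReal (Real.exp (-δ * ‖t‖ ^ 2)) *
      ∫⁻ x, ENNReal.ofReal (Real.exp (-(1 / R ^ 2) * ‖x‖ ^ 2)) * ‖halfWave ς h t x‖ₑ ^ 2 ≤
      C * ENNReal.ofReal (R * ((R * a) ^ (n - 1) * min 1 ((R * a) ^ (-((n : ℝ) - 1))))) *
        ∫⁻ ξ, ‖h ξ‖ₑ ^ 2 := by
  obtain ⟨C, hC⟩ := exists_cap_bound n hn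
  refine ⟨(2 ^ (n - 1) * Real.pi ^ ((n : ℝ) / 2)).toNNReal * C,
    fun a R ς δ ha hR hδ hς h hhm hh hsupp => ?_⟩
  set A : Set (Rn n) := {ξ | a ≤ ‖ξ‖ ∧ ‖ξ‖ < 2 * a} with hA
  have hAm : MeasurableSet A :=
    (measurableSet_le measurable_const measurable_norm).inter
      (measurableSet_lt measurable_norm measurable_const)
  have hb : 0 < (1 / R ^ 2 : ℝ) := by positivity
  have := isFiniteMeasure_gaussMeasure (V := Rn n) hb
  have := isFiniteMeasure_gaussMeasure (V := ℝ) hδ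
  set κ := (gaussMeasure ℝ δ).prod (gaussMeasure (Rn n) (1 / R ^ 2)) with hκ
  set B : ℝ≥0∞ := ((2 ^ (n - 1) * Real.pi ^ ((n : ℝ) / 2)).toNNReal * C : ℝ≥0) *
    ENNReal.ofReal (R * ((R * a) ^ (n - 1) * min 1 ((R * a) ^ (-((n : ℝ) - 1))))) with hB
  have hvm := measurable_halfWave ς hhm
  have hzero : ∀ ξ, ξ ∉ A → h ξ = 0 := by
    intro ξ hξ
    refine hsupp ξ ?_
    by_contra hc
    push Not at hc
    exact hξ hc
  have hv : ∀ t x, halfWave ς h t x =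
      ∫ ξ in A, (osc x ξ * osc t (ς * ‖ξ‖)) * h ξ := by
    intro t x
    rw [setIntegral_eq_integral_of_forall_compl_eq_zero (fun ξ hξ => by rw [hzero ξ hξ, mul_zero])]
    unfold halfWave
    congr 1; ext ξ
    rw [osc_comm ξ x]; ring
  have key := lintegral_enorm_sq_le_of_kernel κ (volume.restrict A) (B := B)
    (e := fun (w : ℝ × Rn n) ξ => osc w.2 ξ * osc w.1 (ς * ‖ξ‖)) ?_ ?_ hh.restrict ?_
  · simp only [← hv] at key
    have h1 : ∫⁻ w, ‖halfWave ς h w.1 w.2‖ₑ ^ 2 ∂κ = ∫⁻ t, ENNReal.ofReal (Real.exp (-δ * ‖t‖ ^ 2)) *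
      ∫⁻ x, ENNReal.ofReal (Real.exp (-(1 / R ^ 2) * ‖x‖ ^ 2)) * ‖halfWave ς h t x‖ₑ ^ 2 := by
      have hm2 : Measurable (fun w : ℝ × Rn n => ‖halfWave ς h w.1 w.2‖ₑ ^ 2) :=
        hvm.enorm.pow_const 2
      rw [hκ, lintegral_prod _ hm2.aemeasurable, gaussMeasure,
        lintegral_withDensity_eq_lintegral_mul _ (by fun_prop) hm2.lintegral_prod_right']
      refine lintegral_congr fun t => ?_
      simp only [Pi.mul_apply, gaussMeasure]
      congr 1
      exact lintegral_withDensity_eq_lintegral_mul _ (by fun_prop)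
        ((hvm.comp measurable_prodMk_left).enorm.pow_const 2)
    rw [← h1]
    exact key.trans (mul_le_mul_right (setLIntegral_le_lintegral _ _) _)
  · have h1 : Continuous (Function.uncurry fun (w : ℝ × Rn n) ξ => osc w.2 ξ * osc w.1 (ς * ‖ξ‖)) := by
      unfold Function.uncurry; fun_prop
    exact h1.measurable
  · intro w y; rw [norm_mul, norm_osc, norm_osc, one_mul]
  · filter_upwards [ae_restrict_mem hAm] with ξ hξ
    have h1 : ∀ η : Rn n, ‖∫ w, osc w.2 ξ * osc w.1 (ς * ‖ξ‖) *
        (starRingEnd ℂ) (osc w.2 η * osc w.1 (ς * ‖η‖)) ∂κ‖ₑ =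
        (ENNReal.ofReal ((Real.pi / δ) ^ (1 / 2 : ℝ)) *
          ENNReal.ofReal (Real.exp (-(Real.pi ^ 2 / δ) * (‖ξ‖ - ‖η‖) ^ 2))) *
        (ENNReal.ofReal ((Real.pi / (1 / R ^ 2)) ^ ((n : ℝ) / 2)) *
        ENNReal.ofReal (Real.exp (-(Real.pi ^ 2 / (1 / R ^ 2)) * ‖ξ - η‖ ^ 2))) := by
      intro η
      have h2 : ∀ w : ℝ × Rn n, osc w.2 ξ * osc w.1 (ς * ‖ξ‖) *
          (starRingEnd ℂ) (osc w.2 η * osc w.1 (ς * ‖η‖)) =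
          osc w.1 (ς * (‖ξ‖ - ‖η‖)) * osc w.2 (ξ - η) := by
        intro w
        rw [mul_sub, ← osc_mul_conj, ← osc_mul_conj, map_mul]; ring
      simp only [h2]
      rw [hκ, integral_prod_mul (fun t : ℝ => osc t (ς * (‖ξ‖ - ‖η‖)))
        (fun x : Rn n => osc x (ξ - η)), enorm_mul, enorm_integral_osc_gaussMeasure hδ,
        enorm_integral_osc_gaussMeasure hb, finrank_euclideanSpace, Fintype.card_fin,
        Module.finrank_self, Nat.cast_one, norm_mul, Real.norm_eq_abs, Real.norm_eq_abs, hς, one_mul,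
        sq_abs]
    simp only [h1]
    have hξ0 : 0 < ‖ξ‖ := lt_of_lt_of_le ha hξ.1
    set ω₀ : unitSphere n := ⟨‖ξ‖⁻¹ • ξ, by simp [norm_smul, hξ0.ne']⟩ with hω₀
    have hξω : ‖ξ‖ • ω₀.1 = ξ := by simp [hω₀, smul_smul, hξ0.ne']
    set K1 : ℝ → ℝ≥0∞ := fun ρ => ENNReal.ofReal ((Real.pi / δ) ^ (1 / 2 : ℝ)) *
          ENNReal.ofReal (Real.exp (-(Real.pi ^ 2 / δ) * (‖ξ‖ - ρ) ^ 2)) with hK1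
    have hK1m : Measurable K1 := by fun_prop
    set K2 : Rn n → ℝ≥0∞ := fun η => ENNReal.ofReal ((Real.pi / (1 / R ^ 2)) ^ ((n : ℝ) / 2)) *
        ENNReal.ofReal (Real.exp (-(Real.pi ^ 2 / (1 / R ^ 2)) * ‖ξ - η‖ ^ 2)) with hK2
    have hK2m : Measurable K2 := by fun_prop
    set D : ℝ≥0∞ := ENNReal.ofReal ((Real.pi / (1 / R ^ 2)) ^ ((n : ℝ) / 2)) *
      (C * ENNReal.ofReal (min 1 ((R * a) ^ (-((n : ℝ) - 1))))) with hD
    have hcap : ∀ ρ, a ≤ ρ → ∫⁻ ω : unitSphere n, K2 (ρ • ω.1) ∂(sphereMeasure n) ≤ D := by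
      intro ρ hρ
      simp only [hK2]
      rw [lintegral_const_mul' _ _ ENNReal.ofReal_ne_top]
      refine mul_le_mul_right ?_ _
      refine le_trans (lintegral_mono fun ω => ?_) ((hC (Real.pi * (R * a)) (by positivity) ω₀).trans
        (mul_le_mul_right (ENNReal.ofReal_le_ofReal (pi_mul_rpow_le hn (by positivity))) _))
      refine ENNReal.ofReal_le_ofReal (Real.exp_le_exp.2 ?_)
      have h3 := mul_norm_sub_le_norm_smul_sub_smul ω₀ ω ha hξ.1 hρ
      rw [hξω] at h3
      have h4 : Real.pi ^ 2 / (1 / R ^ 2) = Real.pi ^ 2 * R ^ 2 := by field_simp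
      rw [h4]
      nlinarith [mul_le_mul_of_nonneg_left h3 (by positivity : 0 ≤ Real.pi ^ 2 * R ^ 2)]
    calc ∫⁻ η in A, K1 ‖η‖ * K2 η
        = ∫⁻ η, A.indicator (fun η => K1 ‖η‖ * K2 η) η := (lintegral_indicator hAm _).symm
      _ = ∫⁻ r : Ioi (0 : ℝ), ∫⁻ ω : unitSphere n, A.indicator (fun η => K1 ‖η‖ * K2 η) (r.1 • ω.1)
          ∂(sphereMeasure n) ∂(Measure.volumeIoiPow (n - 1)) :=
          lintegral_polar hn (((hK1m.comp measurable_norm).mul hK2m).indicator hAm)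
      _ ≤ ∫⁻ r : Ioi (0 : ℝ), (Ico a (2 * a)).indicator (fun ρ => K1 ρ * D) r.1
          ∂(Measure.volumeIoiPow (n - 1)) := by
          refine lintegral_mono fun r => ?_
          have hr : ∀ ω : unitSphere n, ‖r.1 • ω.1‖ = r.1 := by
            intro ω; rw [norm_smul, Real.norm_of_nonneg (le_of_lt r.2)]; simp
          by_cases hra : r.1 ∈ Ico a (2 * a)
          · have : ∀ ω : unitSphere n, A.indicator (fun η => K1 ‖η‖ * K2 η) (r.1 • ω.1) =
                K1 r.1 * K2 (r.1 • ω.1) := by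
              intro ω
              rw [indicator_of_mem (by simp only [hA, mem_ofPred_eq, hr]; exact hra), hr]
            simp only [this]
            rw [indicator_of_mem hra, lintegral_const_mul' _ _ (by simp only [hK1]; finiteness)]
            exact mul_le_mul_right (hcap _ hra.1) _
          · have : ∀ ω : unitSphere n, A.indicator (fun η => K1 ‖η‖ * K2 η) (r.1 • ω.1) = 0 := by
              intro ω
              rw [indicator_of_notMem (by simp only [hA, mem_ofPred_eq, hr]; exact hra)]
            simp only [this]
            simp
      _ = ∫⁻ r in Ioi (0 : ℝ), ENNReal.ofReal (r ^ (n - 1)) *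
            (Ico a (2 * a)).indicator (fun ρ => K1 ρ * D) r :=
          lintegral_volumeIoiPow _ ((hK1m.mul_const _).indicator measurableSet_Ico)
      _ ≤ ∫⁻ r, ENNReal.ofReal ((2 * a) ^ (n - 1)) * (K1 r * D) := by
          refine (setLIntegral_le_lintegral _ _).trans (lintegral_mono fun r => ?_)
          by_cases hra : r ∈ Ico a (2 * a)
          · simp only
            rw [indicator_of_mem hra]
            gcongr
            · linarith [hra.1]
            · exact hra.2.le
          · rw [indicator_of_notMem hra, mul_zero]; exact bot_le
      _ = ENNReal.ofReal ((2 * a) ^ (n - 1)) * D := by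
          rw [lintegral_const_mul' _ _ ENNReal.ofReal_ne_top, lintegral_mul_const _ hK1m,
            lintegral_gaussian_kernel_le δ hδ, one_mul]
      _ = B := by
          have h5 : (2 * a) ^ (n - 1) * (Real.pi / (1 / R ^ 2)) ^ ((n : ℝ) / 2) =
              (2 ^ (n - 1) * Real.pi ^ ((n : ℝ) / 2)) * (R * (R * a) ^ (n - 1)) := by
            rw [div_div_eq_mul_div, div_one, Real.mul_rpow (by positivity) (by positivity),
              ← Real.rpow_natCast R 2, ← Real.rpow_mul hR.le,
              show ((2 : ℕ) : ℝ) * ((n : ℝ) / 2) = n by push_cast; ring, Real.rpow_natCast]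
            obtain ⟨k, rfl⟩ : ∃ k, n = k + 1 := ⟨n - 1, by omega⟩
            rw [Nat.add_sub_cancel, mul_pow, mul_pow, pow_succ]
            ring
          have h6 : ((2 ^ (n - 1) * Real.pi ^ ((n : ℝ) / 2)).toNNReal : ℝ≥0∞) =
            ENNReal.ofReal (2 ^ (n - 1) * Real.pi ^ ((n : ℝ) / 2)) := rfl
          rw [hD, hB, ENNReal.coe_mul, h6, ← mul_assoc, ← ENNReal.ofReal_mul (by positivity), h5,
            ENNReal.ofReal_mul (by positivity), ← mul_assoc R, ENNReal.ofReal_mul (p := R * _)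
            (by positivity)]
          ring

theorem exists_local_energy (n : ℕ) (hn : 0 < n) : ∃ C : ℝ≥0, ∀ a R ς : ℝ, 0 < a → 0 < R →
    |ς| = 1 → ∀ h : Rn n → ℂ, Measurable h → Integrable h →
    (∀ ξ, ‖ξ‖ < a ∨ 2 * a ≤ ‖ξ‖ → h ξ = 0) →
    ∫⁻ t, ∫⁻ r : Ioi (0 : ℝ), (Iio (2 * R)).indicator (sphereSq (halfWave ς h t)) r.1
        ∂(Measure.volumeIoiPow (n - 1)) ≤
      C * ENNReal.ofReal (R * ((R * a) ^ (n - 1) * min 1 ((R * a) ^ (-((n : ℝ) - 1))))) *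
        ∫⁻ ξ, ‖h ξ‖ₑ ^ 2 := by
  obtain ⟨C, hC⟩ := exists_local_energy_gauss n hn
  refine ⟨(Real.exp 4).toNNReal * C, fun a R ς ha hR hς h hhm hh hsupp => ?_⟩
  set K : ℝ≥0∞ := C * ENNReal.ofReal (R * ((R * a) ^ (n - 1) * min 1 ((R * a) ^ (-((n : ℝ) - 1))))) *
        ∫⁻ ξ, ‖h ξ‖ₑ ^ 2 with hK
  have hvm := measurable_halfWave ς hhm
  have hvt : ∀ t, Measurable (halfWave ς h t) := fun t => hvm.of_uncurry_left
  have hbm : MeasurableSet (Metric.ball (0 : Rn n) (2 * R)) := Metric.isOpen_ball.measurableSet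
  set W : ℝ → ℝ≥0∞ := fun t => ∫⁻ r : Ioi (0 : ℝ), (Iio (2 * R)).indicator
    (sphereSq (halfWave ς h t)) r.1 ∂(Measure.volumeIoiPow (n - 1)) with hW
  have hWx : ∀ t, W t = ∫⁻ x in Metric.ball (0 : Rn n) (2 * R), ‖halfWave ς h t x‖ₑ ^ 2 := by
    intro t
    rw [← lintegral_indicator hbm, lintegral_polar hn (((hvt t).enorm.pow_const 2).indicator hbm)]
    refine lintegral_congr fun r => ?_
    have hr : ∀ ω : unitSphere n, ‖r.1 • ω.1‖ = r.1 := by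
      intro ω; rw [norm_smul, Real.norm_of_nonneg (le_of_lt r.2)]; simp
    by_cases hr2 : r.1 < 2 * R
    · rw [indicator_of_mem (by exact hr2)]
      refine lintegral_congr fun ω => ?_
      rw [indicator_of_mem (by simpa [hr] using hr2)]
    · rw [indicator_of_notMem (by exact hr2)]
      symm
      refine (lintegral_congr fun ω => ?_).trans lintegral_zero
      rw [indicator_of_notMem (by simpa [hr] using hr2)]
  have hWm : Measurable W := by
    have : W = fun t => ∫⁻ x in Metric.ball (0 : Rn n) (2 * R), ‖halfWave ς h t x‖ₑ ^ 2 := funext hWx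
    rw [this]
    have hm2 : Measurable (fun w : ℝ × Rn n => ‖halfWave ς h w.1 w.2‖ₑ ^ 2) := hvm.enorm.pow_const 2
    exact hm2.lintegral_prod_right'
  have hstep : ∀ δ : ℝ, 0 < δ → ∫⁻ t, ENNReal.ofReal (Real.exp (-δ * ‖t‖ ^ 2)) * W t ≤
      ENNReal.ofReal (Real.exp 4) * K := by
    intro δ hδ
    refine le_trans ?_ (mul_le_mul_right (hC a R ς δ ha hR hδ hς h hhm hh hsupp) _)
    rw [← lintegral_const_mul' _ _ ENNReal.ofReal_ne_top]
    refine lintegral_mono fun t => ?_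
    simp only
    rw [mul_left_comm]
    refine mul_le_mul_right ?_ _
    rw [hWx, ← lintegral_const_mul' _ _ ENNReal.ofReal_ne_top]
    refine (setLIntegral_mono' hbm fun x hx => ?_).trans (setLIntegral_le_lintegral _ _)
    rw [← mul_assoc, ← ENNReal.ofReal_mul (by positivity), ← Real.exp_add]
    refine le_mul_of_one_le_left bot_le ?_
    rw [← ENNReal.ofReal_one]
    refine ENNReal.ofReal_le_ofReal (Real.one_le_exp ?_)
    have h5 : ‖x‖ < 2 * R := by simpa using hx
    have h6 : ‖x‖ ^ 2 ≤ (2 * R) ^ 2 := by gcongr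
    have : 1 / R ^ 2 * ‖x‖ ^ 2 ≤ 4 := by
      rw [one_div, inv_mul_le_iff₀ (by positivity)]; linarith
    linarith
  have hlim : ∀ t, Tendsto (fun k : ℕ => ENNReal.ofReal (Real.exp (-(1 / ((k : ℝ) + 1)) * ‖t‖ ^ 2)) * W t)
      atTop (nhds (W t)) := by
    intro t
    have h1 : Tendsto (fun k : ℕ => Real.exp (-(1 / ((k : ℝ) + 1)) * ‖t‖ ^ 2)) atTop (nhds 1) := by
      have h2 : Tendsto (fun k : ℕ => -(1 / ((k : ℝ) + 1)) * ‖t‖ ^ 2) atTop (nhds (-0 * ‖t‖ ^ 2)) :=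
        (tendsto_one_div_add_atTop_nhds_zero_nat.neg).mul_const _
      have h3 := (Real.continuous_exp.tendsto _).comp h2
      simpa [Function.comp_def] using h3
    have h4 := ENNReal.Tendsto.mul_const (b := W t) (ENNReal.tendsto_ofReal h1) (Or.inl (by simp))
    simpa using h4
  calc ∫⁻ t, W t = ∫⁻ t, liminf (fun k : ℕ =>
        ENNReal.ofReal (Real.exp (-(1 / ((k : ℝ) + 1)) * ‖t‖ ^ 2)) * W t) atTop :=
        lintegral_congr fun t => (hlim t).liminf_eq.symm
    _ ≤ liminf (fun k : ℕ => ∫⁻ t, ENNReal.ofReal (Real.exp (-(1 / ((k : ℝ) + 1)) * ‖t‖ ^ 2)) * W t)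
        atTop := lintegral_liminf_le fun k => by fun_prop
    _ ≤ ENNReal.ofReal (Real.exp 4) * K :=
        liminf_le_of_le (by isBoundedDefault) fun b hb => by
          obtain ⟨k, hk⟩ := hb.exists
          exact hk.trans (hstep _ (by positivity))
    _ = _ := by
      have hc : ((Real.exp 4).toNNReal : ℝ≥0∞) = ENNReal.ofReal (Real.exp 4) := rfl
      rw [hK, ENNReal.coe_mul, hc]
      ring

/-- The homogeneous Sobolev energy `∫ |ξ|^{2s} |h|²` of a profile `h` on the Fourier side. -/
def energy {n : ℕ} (s : ℝ) (h : Rn n → ℂ) : ℝ≥0∞ :=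
  ∫⁻ ξ, ENNReal.ofReal (‖ξ‖ ^ (2 * s)) * ‖h ξ‖ₑ ^ 2

theorem lintegral_sq_le_energy {n : ℕ} {s a : ℝ} (hs : 0 ≤ s) (ha : 0 < a) {h : Rn n → ℂ}
    (hsupp : ∀ ξ, ‖ξ‖ < a ∨ 2 * a ≤ ‖ξ‖ → h ξ = 0) :
    ∫⁻ ξ, ‖h ξ‖ₑ ^ 2 ≤ ENNReal.ofReal (a ^ (-(2 * s))) * energy s h := by
  unfold energy
  rw [← lintegral_const_mul' _ _ ENNReal.ofReal_ne_top]
  refine lintegral_mono fun ξ => ?_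
  by_cases hξ : ‖ξ‖ < a
  · simp [hsupp ξ (Or.inl hξ)]
  · simp only
    rw [← mul_assoc, ← ENNReal.ofReal_mul (by positivity)]
    refine le_mul_of_one_le_left bot_le ?_
    rw [← ENNReal.ofReal_one]
    refine ENNReal.ofReal_le_ofReal ?_
    push Not at hξ
    calc (1 : ℝ) = a ^ (-(2 * s)) * a ^ (2 * s) := by rw [← Real.rpow_add ha]; simp
      _ ≤ _ := by gcongr

/-! ### Dyadic sums -/

theorem dyadic_decay {A B δ : ℝ} (hA : δ ≤ A) (hB : δ ≤ B - A) (l : ℤ) :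
    ((2 : ℝ) ^ l) ^ A * min 1 (((2 : ℝ) ^ l) ^ (-B)) ≤ (2 : ℝ) ^ (-δ * |(l : ℝ)|) := by
  rw [← Real.rpow_intCast, ← Real.rpow_mul (by norm_num), ← Real.rpow_mul (by norm_num)]
  rcases le_total 0 (l : ℝ) with h | h
  · rw [abs_of_nonneg h]
    calc (2 : ℝ) ^ ((l : ℝ) * A) * min 1 ((2 : ℝ) ^ ((l : ℝ) * -B))
        ≤ (2 : ℝ) ^ ((l : ℝ) * A) * (2 : ℝ) ^ ((l : ℝ) * -B) := by gcongr; exact min_le_right _ _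
      _ = (2 : ℝ) ^ ((l : ℝ) * A + (l : ℝ) * -B) := by rw [Real.rpow_add (by norm_num)]
      _ ≤ _ := Real.rpow_le_rpow_of_exponent_le (by norm_num) (by nlinarith)
  · rw [abs_of_nonpos h]
    calc (2 : ℝ) ^ ((l : ℝ) * A) * min 1 ((2 : ℝ) ^ ((l : ℝ) * -B))
        ≤ (2 : ℝ) ^ ((l : ℝ) * A) * 1 := by gcongr; exact min_le_left _ _
      _ = (2 : ℝ) ^ ((l : ℝ) * A) := mul_one _
      _ ≤ _ := Real.rpow_le_rpow_of_exponent_le (by norm_num) (by nlinarith)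

/-- The two-sided geometric weight `2 ^ (δ |l|)`. -/
def dyadicWeight (δ : ℝ) (l : ℤ) : ℝ≥0∞ := ENNReal.ofReal ((2 : ℝ) ^ (δ * |(l : ℝ)|))

theorem dyadicWeight_mul (δ δ' : ℝ) (l : ℤ) :
    dyadicWeight δ l * dyadicWeight δ' l = dyadicWeight (δ + δ') l := by
  unfold dyadicWeight
  rw [← ENNReal.ofReal_mul (by positivity), ← Real.rpow_add (by norm_num), add_mul]

theorem dyadicWeight_rpow (δ q : ℝ) (hq : 0 ≤ q) (l : ℤ) :
    dyadicWeight δ l ^ q = dyadicWeight (δ * q) l := by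
  unfold dyadicWeight
  rw [ENNReal.ofReal_rpow_of_nonneg (by positivity) hq, ← Real.rpow_mul (by norm_num)]
  congr 2; ring

theorem dyadicWeight_ne_top (δ : ℝ) (l : ℤ) : dyadicWeight δ l ≠ ∞ := ENNReal.ofReal_ne_top

theorem tsum_dyadicWeight_ne_top {δ : ℝ} (hδ : 0 < δ) : ∑' l : ℤ, dyadicWeight (-δ) l ≠ ∞ := by
  have hr0 : (0 : ℝ) ≤ (2 : ℝ) ^ (-δ) := by positivity
  have hr1 : (2 : ℝ) ^ (-δ) < 1 := Real.rpow_lt_one_of_one_lt_of_neg (by norm_num) (by linarith)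
  have hgeo := summable_geometric_of_lt_one hr0 hr1
  have hs : Summable fun l : ℤ => (2 : ℝ) ^ (-δ * |(l : ℝ)|) := by
    refine Summable.of_nat_of_neg ?_ ?_
    · refine hgeo.congr fun m => ?_
      rw [← Real.rpow_natCast, ← Real.rpow_mul (by norm_num)]
      simp
    · refine hgeo.congr fun m => ?_
      rw [← Real.rpow_natCast, ← Real.rpow_mul (by norm_num)]
      simp
  unfold dyadicWeight
  rw [← ENNReal.ofReal_tsum_of_nonneg (fun _ => by positivity) hs]
  exact ENNReal.ofReal_ne_top

theorem tsum_dyadicWeight_add (δ : ℝ) (k : ℤ) :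
    ∑' j : ℤ, dyadicWeight δ (k + j) = ∑' l : ℤ, dyadicWeight δ l :=
  (Equiv.addLeft k).tsum_eq (dyadicWeight δ)

theorem exists_tsum_rpow_le {q δ : ℝ} (hq : 1 ≤ q) (hδ : 0 < δ) : ∃ K : ℝ≥0, ∀ (c : ℤ → ℝ≥0∞)
    (k : ℤ), (∑' j, c j) ^ q ≤ K * ∑' j, dyadicWeight δ (k + j) * c j ^ q := by
  have hq0 : 0 < q := by linarith
  set S := ∑' l : ℤ, dyadicWeight (-(δ / q)) l with hS
  have hSfin : S ≠ ∞ := tsum_dyadicWeight_ne_top (by positivity)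
  refine ⟨(S ^ q).toNNReal, fun c k => ?_⟩
  rw [ENNReal.coe_toNNReal (ENNReal.rpow_ne_top_of_nonneg hq0.le hSfin)]
  set M := ∑' j, dyadicWeight δ (k + j) * c j ^ q with hM
  have h1 : ∀ j, c j ≤ dyadicWeight (-(δ / q)) (k + j) * M ^ q⁻¹ := by
    intro j
    have h2 : dyadicWeight (δ / q) (k + j) * c j ≤ M ^ q⁻¹ := by
      rw [ENNReal.le_rpow_inv_iff hq0, ENNReal.mul_rpow_of_nonneg _ _ hq0.le,
        dyadicWeight_rpow _ _ hq0.le, div_mul_cancel₀ _ hq0.ne']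
      exact ENNReal.le_tsum (f := fun j => dyadicWeight δ (k + j) * c j ^ q) j
    calc c j = dyadicWeight (-(δ / q)) (k + j) * (dyadicWeight (δ / q) (k + j) * c j) := by
          rw [← mul_assoc, dyadicWeight_mul]; simp [dyadicWeight]
      _ ≤ _ := by gcongr
  calc (∑' j, c j) ^ q ≤ (∑' j, dyadicWeight (-(δ / q)) (k + j) * M ^ q⁻¹) ^ q := by
        gcongr with j; exact h1 j
    _ = S ^ q * M := by
        rw [ENNReal.tsum_mul_right, tsum_dyadicWeight_add, ENNReal.mul_rpow_of_nonneg _ _ hq0.le,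
          ← ENNReal.rpow_mul, inv_mul_cancel₀ hq0.ne', ENNReal.rpow_one]

theorem tsum_rpow_le_rpow_tsum {q : ℝ} (hq : 1 ≤ q) (c : ℤ → ℝ≥0∞) :
    ∑' j, c j ^ q ≤ (∑' j, c j) ^ q := by
  have h1 : ∀ x : ℝ≥0∞, x ^ q = x * x ^ (q - 1) := by
    intro x
    conv_lhs => rw [show q = 1 + (q - 1) by ring, ENNReal.rpow_add_of_nonneg _ _ zero_le_one
      (by linarith), ENNReal.rpow_one]
  calc ∑' j, c j ^ q ≤ ∑' j, c j * (∑' i, c i) ^ (q - 1) := by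
        refine ENNReal.tsum_le_tsum fun j => ?_
        rw [h1]
        exact mul_le_mul_right (ENNReal.rpow_le_rpow (ENNReal.le_tsum j) (by linarith)) _
    _ = _ := by rw [ENNReal.tsum_mul_right, ← h1]

/-! ### A single frequency on a dyadic shell -/

theorem exists_shell_bound (n : ℕ) (hn : 0 < n) (P γ : ℝ) (hP : 2 ≤ P) (hγ : 0 ≤ γ) :
    ∃ C : ℝ≥0, ∀ a R ς : ℝ, 0 < a → 0 < R → |ς| = 1 → ∀ h : Rn n → ℂ, Measurable h →
    Integrable h → (∀ ξ, ‖ξ‖ < a ∨ 2 * a ≤ ‖ξ‖ → h ξ = 0) →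
    ∫⁻ t, ∫⁻ r : Ioi (0 : ℝ), (Ico R (2 * R)).indicator
        (fun ρ => ENNReal.ofReal (ρ ^ (P * (n / 2 - γ) - (n + 1))) *
          sphereSq (halfWave ς h t) ρ ^ (P / 2)) r.1 ∂(Measure.volumeIoiPow (n - 1)) ≤
      C * ENNReal.ofReal ((R * a) ^ (P * (n / 2 - γ) - 1) *
        min 1 ((R * a) ^ (-(((n : ℝ) - 1) * (P / 2))))) * energy γ h ^ (P / 2) := by
  obtain ⟨C₁, hC₁⟩ := exists_sphereSq_fourier_le n hn
  obtain ⟨C₂, hC₂⟩ := exists_local_energy n hn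
  set w : ℝ := P * (n / 2 - γ) - (n + 1) with hw
  refine ⟨(2 ^ |w| : ℝ).toNNReal * C₁ ^ (P / 2 - 1) * C₂, fun a R ς ha hR hς h hhm hh hsupp => ?_⟩
  have hn1 : (1 : ℝ) ≤ n := by exact_mod_cast hn
  set μ : ℝ := min 1 ((R * a) ^ (-((n : ℝ) - 1))) with hμ
  have hμ0 : 0 ≤ μ := by positivity
  set H : ℝ≥0∞ := ENNReal.ofReal (a ^ (-(2 * γ))) * energy γ h with hH
  have hHle : ∫⁻ ξ, ‖h ξ‖ₑ ^ 2 ≤ H := lintegral_sq_le_energy hγ ha hsupp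
  set Mx : ℝ≥0∞ := C₁ * ENNReal.ofReal (a ^ n * μ) * H with hMx
  have hsup : ∀ t ρ, R ≤ ρ → sphereSq (halfWave ς h t) ρ ≤ Mx := by
    intro t ρ hρ
    have hint : Integrable (fun ξ => osc t (ς * ‖ξ‖) * h ξ) := by
      refine hh.bdd_mul (c := 1) ?_ (Eventually.of_forall fun _ => (norm_osc _ _).le)
      have : Continuous fun ξ : Rn n => osc t (ς * ‖ξ‖) := by fun_prop
      exact this.aestronglyMeasurable
    have h1 := hC₁ a ρ ha (by linarith) (fun ξ => osc t (ς * ‖ξ‖) * h ξ) hint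
      (fun ξ hξ => by rw [hsupp ξ (Or.inr hξ), mul_zero])
    refine h1.trans ?_
    rw [hMx]
    refine mul_le_mul' (mul_le_mul_right (ENNReal.ofReal_le_ofReal ?_) _) ?_
    · rw [hμ]
      refine mul_le_mul_of_nonneg_left (min_le_min_left _ ?_) (by positivity)
      exact Real.rpow_le_rpow_of_nonpos (by positivity) (by gcongr) (by linarith)
    · refine le_trans (le_of_eq ?_) hHle
      refine lintegral_congr fun ξ => ?_
      rw [enorm_mul, ← ofReal_norm (osc _ _), norm_osc]; simp
  have hwr : ∀ ρ ∈ Ico R (2 * R), ρ ^ w ≤ 2 ^ |w| * R ^ w := by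
    intro ρ hρ
    have hρ1 : 1 ≤ ρ / R := by rw [one_le_div hR]; exact hρ.1
    have hρ2 : ρ / R ≤ 2 := by rw [div_le_iff₀ hR]; exact hρ.2.le
    have h2 : ρ ^ w = (ρ / R) ^ w * R ^ w := by
      rw [← Real.mul_rpow (by positivity) hR.le, div_mul_cancel₀ _ hR.ne']
    rw [h2]
    gcongr
    calc (ρ / R) ^ w ≤ (ρ / R) ^ |w| := Real.rpow_le_rpow_of_exponent_le hρ1 (le_abs_self _)
      _ ≤ 2 ^ |w| := Real.rpow_le_rpow (by positivity) hρ2 (abs_nonneg _)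
  have hP1 : 0 ≤ P / 2 - 1 := by linarith
  set D : ℝ≥0∞ := ENNReal.ofReal (2 ^ |w| * R ^ w) * Mx ^ (P / 2 - 1) with hD
  have hpt : ∀ t, ∀ r : Ioi (0 : ℝ), (Ico R (2 * R)).indicator
        (fun ρ => ENNReal.ofReal (ρ ^ w) * sphereSq (halfWave ς h t) ρ ^ (P / 2)) r.1 ≤
      D * (Iio (2 * R)).indicator (sphereSq (halfWave ς h t)) r.1 := by
    intro t r
    by_cases hr : r.1 ∈ Ico R (2 * R)
    · rw [indicator_of_mem hr, indicator_of_mem (by exact hr.2), hD, mul_assoc]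
      refine mul_le_mul' (ENNReal.ofReal_le_ofReal (hwr _ hr)) ?_
      rw [show P / 2 = (P / 2 - 1) + 1 by ring, ENNReal.rpow_add_of_nonneg _ _ hP1 zero_le_one,
        ENNReal.rpow_one, add_sub_cancel_right]
      gcongr
      exact hsup t _ hr.1
    · rw [indicator_of_notMem hr]; exact bot_le
  have hvm := measurable_halfWave ς hhm
  have hmeas : Measurable (fun p : ℝ × Ioi (0 : ℝ) =>
      (Iio (2 * R)).indicator (sphereSq (halfWave ς h p.1)) p.2.1) := by
    have h1 : Measurable (fun p : ℝ × Ioi (0 : ℝ) => sphereSq (halfWave ς h p.1) p.2.1) :=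
      Measurable.sphereSq hvm measurable_fst (measurable_subtype_coe.comp measurable_snd)
    have hset : MeasurableSet {p : ℝ × Ioi (0 : ℝ) | p.2.1 < 2 * R} :=
      measurableSet_lt (measurable_subtype_coe.comp measurable_snd) measurable_const
    have h2 : (fun p : ℝ × Ioi (0 : ℝ) =>
        (Iio (2 * R)).indicator (sphereSq (halfWave ς h p.1)) p.2.1) =
        {p : ℝ × Ioi (0 : ℝ) | p.2.1 < 2 * R}.indicator
          (fun p : ℝ × Ioi (0 : ℝ) => sphereSq (halfWave ς h p.1) p.2.1) := by
      ext p
      by_cases hp : p.2.1 < 2 * R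
      · rw [indicator_of_mem (by exact hp), indicator_of_mem (by exact hp)]
      · rw [indicator_of_notMem (by exact hp), indicator_of_notMem (by exact hp)]
    rw [h2]
    exact h1.indicator hset
  calc _ ≤ ∫⁻ t, ∫⁻ r : Ioi (0 : ℝ), D * (Iio (2 * R)).indicator (sphereSq (halfWave ς h t)) r.1
          ∂(Measure.volumeIoiPow (n - 1)) := lintegral_mono fun t => lintegral_mono fun r => hpt t r
    _ = D * ∫⁻ t, ∫⁻ r : Ioi (0 : ℝ), (Iio (2 * R)).indicator (sphereSq (halfWave ς h t)) r.1
          ∂(Measure.volumeIoiPow (n - 1)) := by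
        rw [← lintegral_const_mul _ hmeas.lintegral_prod_right']
        exact lintegral_congr fun t => lintegral_const_mul _ (hmeas.comp measurable_prodMk_left)
    _ ≤ D * (C₂ * ENNReal.ofReal (R * ((R * a) ^ (n - 1) * μ)) * H) := by
        refine mul_le_mul_right ((hC₂ a R ς ha hR hς h hhm hh hsupp).trans ?_) _
        exact mul_le_mul_right hHle _
    _ = _ := by
        have hμ2 : μ ^ (P / 2) = min 1 ((R * a) ^ (-(((n : ℝ) - 1) * (P / 2)))) := by
          have : (R * a) ^ (-(((n : ℝ) - 1) * (P / 2))) = ((R * a) ^ (-((n : ℝ) - 1))) ^ (P / 2) := by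
            rw [← Real.rpow_mul (by positivity)]; congr 1; ring
          rw [hμ, this]
          rcases le_total 1 ((R * a) ^ (-((n : ℝ) - 1))) with h1 | h1
          · rw [min_eq_left h1, Real.one_rpow, min_eq_left (Real.one_le_rpow h1 (by linarith))]
          · rw [min_eq_right h1, min_eq_right (Real.rpow_le_one (by positivity) h1 (by linarith))]
        have hH2 : H ^ (P / 2 - 1) * H = ENNReal.ofReal (a ^ (-(γ * P))) * energy γ h ^ (P / 2) := by
          have : H ^ (P / 2 - 1) * H = H ^ (P / 2) := by
            conv_rhs => rw [show P / 2 = (P / 2 - 1) + 1 by ring,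
              ENNReal.rpow_add_of_nonneg _ _ hP1 zero_le_one, ENNReal.rpow_one]
          rw [this, hH, ENNReal.mul_rpow_of_nonneg _ _ (by linarith),
            ENNReal.ofReal_rpow_of_nonneg (by positivity) (by linarith), ← Real.rpow_mul ha.le]
          congr 3; ring
        have hreal : (2 ^ |w| * R ^ w) * (a ^ n * μ) ^ (P / 2 - 1) * (R * ((R * a) ^ (n - 1) * μ)) *
            a ^ (-(γ * P)) = 2 ^ |w| * ((R * a) ^ (P * (n / 2 - γ) - 1) * μ ^ (P / 2)) := by
          have e1 : μ ^ (P / 2) = μ ^ (P / 2 - 1) * μ := by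
            have hμp : 0 < μ := by positivity
            conv_lhs => rw [show P / 2 = (P / 2 - 1) + 1 by ring, Real.rpow_add hμp, Real.rpow_one]
          have e2 : ((R * a) ^ (n - 1) : ℝ) = (R * a) ^ ((n : ℝ) - 1) := by
            rw [← Real.rpow_natCast, Nat.cast_sub hn, Nat.cast_one]
          have e3 : R ^ w * (R * R ^ ((n : ℝ) - 1)) = R ^ (P * (n / 2 - γ) - 1) := by
            nth_rewrite 2 [← Real.rpow_one R]
            rw [← Real.rpow_add hR, ← Real.rpow_add hR, hw]; congr 1; ring
          have e4 : (a ^ n) ^ (P / 2 - 1) * a ^ ((n : ℝ) - 1) * a ^ (-(γ * P)) =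
              a ^ (P * (n / 2 - γ) - 1) := by
            rw [← Real.rpow_natCast a n, ← Real.rpow_mul ha.le, ← Real.rpow_add ha, ← Real.rpow_add ha]
            congr 1; ring
          rw [Real.mul_rpow (by positivity) hμ0, e2, Real.mul_rpow hR.le ha.le,
            Real.mul_rpow hR.le ha.le, e1, ← e3, ← e4]
          ring
        rw [← hμ2, hD, hMx, ENNReal.mul_rpow_of_nonneg _ _ hP1, ENNReal.mul_rpow_of_nonneg _ _ hP1,
          ENNReal.ofReal_rpow_of_nonneg (by positivity) hP1]
        have hfin : ENNReal.ofReal (2 ^ |w| * R ^ w) * ENNReal.ofReal ((a ^ n * μ) ^ (P / 2 - 1)) *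
            ENNReal.ofReal (R * ((R * a) ^ (n - 1) * μ)) * ENNReal.ofReal (a ^ (-(γ * P))) =
            ENNReal.ofReal (2 ^ |w|) * ENNReal.ofReal ((R * a) ^ (P * (n / 2 - γ) - 1) * μ ^ (P / 2)) := by
          rw [← ENNReal.ofReal_mul (by positivity), ← ENNReal.ofReal_mul (by positivity),
            ← ENNReal.ofReal_mul (by positivity), ← ENNReal.ofReal_mul (by positivity), hreal]
        have hc : ((2 ^ |w| : ℝ).toNNReal : ℝ≥0∞) = ENNReal.ofReal (2 ^ |w|) := rfl
        rw [ENNReal.coe_mul, ENNReal.coe_mul, hc, ENNReal.coe_rpow_of_nonneg _ hP1]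
        calc _ = (C₁ : ℝ≥0∞) ^ (P / 2 - 1) * C₂ * (ENNReal.ofReal (2 ^ |w| * R ^ w) *
              ENNReal.ofReal ((a ^ n * μ) ^ (P / 2 - 1)) *
              ENNReal.ofReal (R * ((R * a) ^ (n - 1) * μ))) * (H ^ (P / 2 - 1) * H) := by ring
          _ = (C₁ : ℝ≥0∞) ^ (P / 2 - 1) * C₂ * (ENNReal.ofReal (2 ^ |w| * R ^ w) *
              ENNReal.ofReal ((a ^ n * μ) ^ (P / 2 - 1)) *
              ENNReal.ofReal (R * ((R * a) ^ (n - 1) * μ)) * ENNReal.ofReal (a ^ (-(γ * P)))) *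
              energy γ h ^ (P / 2) := by rw [hH2]; ring
          _ = _ := by rw [hfin]; ring

/-! ### Littlewood–Paley pieces -/

/-- The dyadic annulus `2^j ≤ |ξ| < 2^{j+1}`. -/
def annulus (n : ℕ) (j : ℤ) : Set (Rn n) := {ξ | (2 : ℝ) ^ j ≤ ‖ξ‖ ∧ ‖ξ‖ < (2 : ℝ) ^ (j + 1)}

theorem measurableSet_annulus (n : ℕ) (j : ℤ) : MeasurableSet (annulus n j) :=
  (measurableSet_le measurable_const measurable_norm).inter
    (measurableSet_lt measurable_norm measurable_const)

theorem Ico_zpow_unique {x : ℝ} {i j : ℤ} (hi : (2 : ℝ) ^ i ≤ x ∧ x < (2 : ℝ) ^ (i + 1))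
    (hj : (2 : ℝ) ^ j ≤ x ∧ x < (2 : ℝ) ^ (j + 1)) : i = j := by
  have h1 := (zpow_lt_zpow_iff_right₀ (a := (2 : ℝ)) (by norm_num)).1 (hi.1.trans_lt hj.2)
  have h2 := (zpow_lt_zpow_iff_right₀ (a := (2 : ℝ)) (by norm_num)).1 (hj.1.trans_lt hi.2)
  omega

theorem pairwise_disjoint_annulus (n : ℕ) :
    Pairwise (Function.onFun Disjoint (annulus n)) := by
  intro i j hij
  refine Set.disjoint_left.2 fun ξ hi hj => hij (Ico_zpow_unique hi hj)

theorem iUnion_annulus (n : ℕ) : ⋃ j, annulus n j = {0}ᶜ := by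
  ext ξ
  simp only [mem_iUnion, mem_compl_iff, mem_singleton_iff]
  constructor
  · rintro ⟨j, hj⟩ rfl
    have h1 : (2 : ℝ) ^ j ≤ ‖(0 : Rn n)‖ := hj.1
    rw [norm_zero] at h1
    exact absurd h1 (not_le.2 (by positivity))
  · intro hξ
    obtain ⟨j, hj⟩ := exists_mem_Ico_zpow (norm_pos_iff.2 hξ) (one_lt_two (α := ℝ))
    exact ⟨j, hj⟩

/-- The part of `h` at frequencies `2^j ≤ |ξ| < 2^{j+1}`. -/
def piece {n : ℕ} (h : Rn n → ℂ) (j : ℤ) : Rn n → ℂ := (annulus n j).indicator h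

theorem piece_eq_zero {n : ℕ} (h : Rn n → ℂ) (j : ℤ) (ξ : Rn n)
    (hξ : ‖ξ‖ < (2 : ℝ) ^ j ∨ 2 * (2 : ℝ) ^ j ≤ ‖ξ‖) : piece h j ξ = 0 := by
  refine indicator_of_notMem (fun hc => ?_) _
  have h1 : (2 : ℝ) ^ j ≤ ‖ξ‖ := hc.1
  have h2 : ‖ξ‖ < (2 : ℝ) ^ (j + 1) := hc.2
  rw [zpow_add_one₀ (by norm_num)] at h2
  rcases hξ with h | h <;> linarith

theorem tsum_energy_piece_le {n : ℕ} (s : ℝ) (h : Rn n → ℂ) :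
    ∑' j, energy s (piece h j) ≤ energy s h := by
  have h1 : ∀ j, energy s (piece h j) = ∫⁻ ξ in annulus n j,
      ENNReal.ofReal (‖ξ‖ ^ (2 * s)) * ‖h ξ‖ₑ ^ 2 := by
    intro j
    unfold energy
    rw [← lintegral_indicator (measurableSet_annulus n j)]
    refine lintegral_congr fun ξ => ?_
    by_cases hξ : ξ ∈ annulus n j
    · rw [indicator_of_mem hξ, piece, indicator_of_mem hξ]
    · rw [indicator_of_notMem hξ, piece, indicator_of_notMem hξ]; simp
  simp only [h1]
  rw [← lintegral_iUnion (measurableSet_annulus n) (pairwise_disjoint_annulus n)]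
  exact setLIntegral_le_lintegral _ _

theorem enorm_halfWave_le_tsum {n : ℕ} (hn : 0 < n) (ς : ℝ) {h : Rn n → ℂ} (hh : Integrable h)
    (t : ℝ) (x : Rn n) : ‖halfWave ς h t x‖ₑ ≤ ∑' j, ‖halfWave ς (piece h j) t x‖ₑ := by
  have : Nonempty (Fin n) := ⟨⟨0, hn⟩⟩
  set k : Rn n → ℂ := fun ξ => osc ξ x * (osc t (ς * ‖ξ‖) * h ξ) with hk
  have hki : Integrable k := by
    have h1 : Continuous fun ξ : Rn n => osc ξ x := by fun_prop
    have h2 : Continuous fun ξ : Rn n => osc t (ς * ‖ξ‖) := by fun_prop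
    exact (hh.bdd_mul (c := 1) h2.aestronglyMeasurable
      (Eventually.of_forall fun _ => (norm_osc _ _).le)).bdd_mul (c := 1) h1.aestronglyMeasurable
      (Eventually.of_forall fun _ => (norm_osc _ _).le)
  have h1 : ∫ ξ, k ξ = ∑' j, ∫ ξ in annulus n j, k ξ := by
    rw [← integral_iUnion (measurableSet_annulus n) (pairwise_disjoint_annulus n)
      hki.integrableOn, iUnion_annulus, restrict_compl_singleton]
  have h2 : ∀ j, ∫ ξ in annulus n j, k ξ = halfWave ς (piece h j) t x := by
    intro j
    rw [← integral_indicator (measurableSet_annulus n j)]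
    unfold halfWave piece
    congr 1; ext ξ
    by_cases hξ : ξ ∈ annulus n j
    · rw [indicator_of_mem hξ, indicator_of_mem hξ]
    · rw [indicator_of_notMem hξ, indicator_of_notMem hξ]; simp
  change ‖∫ ξ, k ξ‖ₑ ≤ _
  rw [h1]
  simp only [h2]
  exact enorm_tsum_le_tsum_enorm

theorem exists_sphereSq_le_tsum (n : ℕ) (hn : 0 < n) {δ : ℝ} (hδ : 0 < δ) : ∃ K : ℝ≥0,
    ∀ (ς : ℝ) (h : Rn n → ℂ), Measurable h → Integrable h → ∀ (t r : ℝ) (k : ℤ),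
    sphereSq (halfWave ς h t) r ≤
      K * ∑' j, dyadicWeight δ (k + j) * sphereSq (halfWave ς (piece h j) t) r := by
  obtain ⟨K, hK⟩ := exists_tsum_rpow_le (q := 2) (by norm_num) hδ
  refine ⟨K, fun ς h hhm hh t r k => ?_⟩
  have hm : ∀ j, Measurable (fun ω : unitSphere n => ‖halfWave ς (piece h j) t (r • ω.1)‖ₑ ^ 2) := by
    intro j
    have h1 : Measurable (halfWave ς (piece h j) t) :=
      (measurable_halfWave ς (hhm.indicator (measurableSet_annulus n j))).of_uncurry_left
    exact (h1.comp (measurable_subtype_coe.const_smul r)).enorm.pow_const 2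
  unfold sphereSq
  simp only [← lintegral_const_mul' _ _ (dyadicWeight_ne_top _ _)]
  rw [← lintegral_tsum fun j => ((hm j).const_mul _).aemeasurable,
    ← lintegral_const_mul' _ _ ENNReal.coe_ne_top]
  refine lintegral_mono fun ω => ?_
  have h1 := hK (fun j => ‖halfWave ς (piece h j) t (r • ω.1)‖ₑ) k
  simp only [ENNReal.rpow_two] at h1
  exact (pow_le_pow_left' (enorm_halfWave_le_tsum hn ς hh t _) 2).trans h1

/-! ### The trace estimate -/

theorem osc_zero_left {V : Type*} [NormedAddCommGroup V] [InnerProductSpace ℝ V] (x : V) :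
    osc 0 x = 1 := by simp [osc]

theorem halfWave_zero_time {n : ℕ} (ς : ℝ) (h : Rn n → ℂ) (x : Rn n) :
    halfWave ς h 0 x = ∫ ξ, osc ξ x * h ξ := by
  simp only [halfWave, osc_zero_left, one_mul]

theorem exists_trace_bound (n : ℕ) (hn : 0 < n) {s : ℝ} (hs : 1 / 2 < s) (hs' : s < n / 2) :
    ∃ C : ℝ≥0, ∀ h : Rn n → ℂ, Measurable h → Integrable h → ∀ r : ℝ, 0 < r →
    ENNReal.ofReal (r ^ (n - 2 * s)) * sphereSq (fun x => ∫ ξ, osc ξ x * h ξ) r ≤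
      C * energy s h := by
  obtain ⟨C₁, hC₁⟩ := exists_sphereSq_fourier_le n hn
  set A : ℝ := n - 2 * s with hA
  set δ : ℝ := min A (2 * s - 1) with hδ
  have hA0 : 0 < A := by linarith
  have hδ0 : 0 < δ := lt_min hA0 (by linarith)
  have hn1 : (1 : ℝ) ≤ n := by exact_mod_cast hn
  obtain ⟨K, hK⟩ := exists_sphereSq_le_tsum n hn hδ0
  refine ⟨K * (C₁ * (2 ^ A : ℝ).toNNReal), fun h hhm hh r hr => ?_⟩
  obtain ⟨k, hk⟩ := exists_mem_Ico_zpow hr (one_lt_two (α := ℝ))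
  have hpiece : ∀ j, ENNReal.ofReal (r ^ A) * (dyadicWeight δ (k + j) *
      sphereSq (halfWave 1 (piece h j) 0) r) ≤
      C₁ * (2 ^ A : ℝ).toNNReal * energy s (piece h j) := by
    intro j
    have ha : (0 : ℝ) < 2 ^ j := by positivity
    have h1 := hC₁ (2 ^ j) r ha hr (piece h j) (hh.indicator (measurableSet_annulus n j))
      (fun ξ hξ => piece_eq_zero h j ξ (Or.inr hξ))
    have h2 := lintegral_sq_le_energy (by linarith : 0 ≤ s) ha (piece_eq_zero h j)
    have h3 : sphereSq (halfWave 1 (piece h j) 0) r = sphereSq (fun x => ∫ ξ, osc ξ x * piece h j ξ) r := by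
      unfold sphereSq; simp only [halfWave_zero_time]
    rw [h3]
    have hreal : r ^ A * 2 ^ (δ * |((k + j : ℤ) : ℝ)|) * ((2 ^ j) ^ n *
        min 1 ((r * 2 ^ j) ^ (-((n : ℝ) - 1)))) * (2 ^ j) ^ (-(2 * s)) ≤ (2 : ℝ) ^ A := by
      have e1 : r ^ A ≤ 2 ^ A * (2 ^ k) ^ A := by
        rw [← Real.mul_rpow (by norm_num) (by positivity)]
        refine Real.rpow_le_rpow hr.le ?_ hA0.le
        have := hk.2
        rw [zpow_add_one₀ (by norm_num)] at this
        linarith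
      have e2 : min 1 ((r * 2 ^ j) ^ (-((n : ℝ) - 1))) ≤
          min 1 (((2 : ℝ) ^ (k + j)) ^ (-((n : ℝ) - 1))) := by
        refine min_le_min_left _ (Real.rpow_le_rpow_of_nonpos (by positivity) ?_ (by linarith))
        rw [zpow_add₀ (by norm_num)]
        gcongr
        exact hk.1
      have e3 := dyadic_decay (A := A) (B := (n : ℝ) - 1) (δ := δ) (min_le_left _ _)
        (by rw [hA]; refine (min_le_right _ _).trans (by linarith)) (k + j)
      have e4 : (((2 : ℝ) ^ j) ^ n) * (2 ^ j) ^ (-(2 * s)) = (2 ^ j) ^ A := by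
        rw [← Real.rpow_natCast ((2 : ℝ) ^ j) n, ← Real.rpow_add ha]; congr 1
      have e5 : ((2 : ℝ) ^ k) ^ A * (2 ^ j) ^ A = (2 ^ (k + j)) ^ A := by
        rw [← Real.mul_rpow (by positivity) (by positivity), zpow_add₀ (by norm_num)]
      have e6 : (2 : ℝ) ^ (-δ * |((k + j : ℤ) : ℝ)|) * 2 ^ (δ * |((k + j : ℤ) : ℝ)|) = 1 := by
        rw [← Real.rpow_add (by norm_num)]; simp
      calc _ ≤ (2 ^ A * (2 ^ k) ^ A) * 2 ^ (δ * |((k + j : ℤ) : ℝ)|) * ((2 ^ j) ^ n *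
            min 1 (((2 : ℝ) ^ (k + j)) ^ (-((n : ℝ) - 1)))) * (2 ^ j) ^ (-(2 * s)) := by gcongr
        _ = 2 ^ A * (((2 : ℝ) ^ (k + j)) ^ A * min 1 (((2 : ℝ) ^ (k + j)) ^ (-((n : ℝ) - 1)))) *
            2 ^ (δ * |((k + j : ℤ) : ℝ)|) := by rw [← e5, ← e4]; ring
        _ ≤ 2 ^ A * 2 ^ (-δ * |((k + j : ℤ) : ℝ)|) * 2 ^ (δ * |((k + j : ℤ) : ℝ)|) := by gcongr
        _ = 2 ^ A := by rw [mul_assoc, e6, mul_one]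
    have hc : ((2 ^ A : ℝ).toNNReal : ℝ≥0∞) = ENNReal.ofReal (2 ^ A) := rfl
    calc _ ≤ ENNReal.ofReal (r ^ A) * (dyadicWeight δ (k + j) * (C₁ * ENNReal.ofReal ((2 ^ j) ^ n *
          min 1 ((r * 2 ^ j) ^ (-((n : ℝ) - 1)))) *
          (ENNReal.ofReal ((2 ^ j) ^ (-(2 * s))) * energy s (piece h j)))) := by
          gcongr
          exact h1.trans (mul_le_mul_right h2 _)
      _ = C₁ * (ENNReal.ofReal (r ^ A) * dyadicWeight δ (k + j) * ENNReal.ofReal ((2 ^ j) ^ n *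
          min 1 ((r * 2 ^ j) ^ (-((n : ℝ) - 1)))) * ENNReal.ofReal ((2 ^ j) ^ (-(2 * s)))) *
          energy s (piece h j) := by ring
      _ ≤ _ := by
          rw [hc]
          unfold dyadicWeight
          rw [← ENNReal.ofReal_mul (by positivity), ← ENNReal.ofReal_mul (by positivity),
            ← ENNReal.ofReal_mul (by positivity)]
          gcongr
  have h4 := hK 1 h hhm hh 0 r k
  have h3 : sphereSq (halfWave 1 h 0) r = sphereSq (fun x => ∫ ξ, osc ξ x * h ξ) r := by
    unfold sphereSq; simp only [halfWave_zero_time]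
  rw [h3] at h4
  calc _ ≤ ENNReal.ofReal (r ^ A) * (K * ∑' j, dyadicWeight δ (k + j) *
        sphereSq (halfWave 1 (piece h j) 0) r) := mul_le_mul_right h4 _
    _ = K * ∑' j, ENNReal.ofReal (r ^ A) * (dyadicWeight δ (k + j) *
        sphereSq (halfWave 1 (piece h j) 0) r) := by rw [ENNReal.tsum_mul_left]; ring
    _ ≤ K * ∑' j, C₁ * (2 ^ A : ℝ).toNNReal * energy s (piece h j) := by
        exact mul_le_mul_right (ENNReal.tsum_le_tsum hpiece) _
    _ ≤ K * (C₁ * (2 ^ A : ℝ).toNNReal * energy s h) := by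
        rw [ENNReal.tsum_mul_left]; gcongr; exact tsum_energy_piece_le s h
    _ = _ := by push_cast; ring

/-! ### The homogeneous estimate -/

/-- The `P`-th power of the weighted mixed norm, over all times `t`, with weight `r ^ w`. -/
def mixedEnergy {n : ℕ} (P w : ℝ) (v : ℝ → Rn n → ℂ) : ℝ≥0∞ :=
  ∫⁻ t, ∫⁻ r : Ioi (0 : ℝ), ENNReal.ofReal (r.1 ^ w) * sphereSq (v t) r.1 ^ (P / 2)
    ∂(Measure.volumeIoiPow (n - 1))

theorem exists_halfWave_bound (n : ℕ) (hn : 0 < n) {P γ : ℝ} (hP : 2 ≤ P) (hγ : 0 ≤ γ)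
    (hγ₁ : 1 / 2 - 1 / P < γ) (hγ₂ : γ < n / 2 - 1 / P) :
    ∃ C : ℝ≥0, ∀ ς : ℝ, |ς| = 1 → ∀ h : Rn n → ℂ, Measurable h → Integrable h →
    mixedEnergy P (P * (n / 2 - γ) - (n + 1)) (halfWave ς h) ≤ C * energy γ h ^ (P / 2) := by
  have hP0 : 0 < P := by linarith
  set w : ℝ := P * (n / 2 - γ) - (n + 1) with hw
  set A : ℝ := P * (n / 2 - γ) - 1 with hA
  set B : ℝ := ((n : ℝ) - 1) * (P / 2) with hB
  set δ : ℝ := min A (B - A) with hδ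
  have hA0 : 0 < A := by
    have : P * (1 / P) < P * (n / 2 - γ) := by
      apply mul_lt_mul_of_pos_left _ hP0; linarith
    rw [mul_one_div_cancel hP0.ne'] at this; linarith
  have hBA : 0 < B - A := by
    have : P * (1 / 2 - γ) < P * (1 / P) := by
      apply mul_lt_mul_of_pos_left _ hP0; linarith
    rw [mul_one_div_cancel hP0.ne'] at this
    rw [hA, hB]; nlinarith
  have hδ0 : 0 < δ := lt_min hA0 hBA
  obtain ⟨C, hC⟩ := exists_shell_bound n hn P γ hP hγ
  obtain ⟨K, hK⟩ := exists_sphereSq_le_tsum n hn (δ := δ / (2 * P)) (by positivity)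
  obtain ⟨L, hL⟩ := exists_tsum_rpow_le (q := P / 2) (δ := δ / 4) (by linarith) (by positivity)
  set S := ∑' l : ℤ, dyadicWeight (-(δ / 2)) l with hS
  have hSfin : S ≠ ∞ := tsum_dyadicWeight_ne_top (by positivity)
  have hP2 : 0 ≤ P / 2 := by positivity
  refine ⟨K ^ (P / 2) * L * C * S.toNNReal, fun ς hς h hhm hh => ?_⟩
  set M : ℝ≥0∞ := (K : ℝ≥0∞) ^ (P / 2) * L with hM
  have hMfin : M ≠ ∞ := by rw [hM]; exact ENNReal.mul_ne_top (by simp [hP2]) ENNReal.coe_ne_top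
  have hpm : ∀ j, Measurable (piece h j) := fun j => hhm.indicator (measurableSet_annulus n j)
  -- the contribution of a frequency on a shell
  set Z : ℤ → ℤ → ℝ → Ioi (0 : ℝ) → ℝ≥0∞ := fun k j t r =>
    (Ico ((2 : ℝ) ^ k) (2 * 2 ^ k)).indicator (fun ρ => ENNReal.ofReal (ρ ^ w) *
      sphereSq (halfWave ς (piece h j) t) ρ ^ (P / 2)) r.1 with hZ
  have hZm : ∀ k j, Measurable (fun p : ℝ × Ioi (0 : ℝ) => Z k j p.1 p.2) := by
    intro k j
    have h1 : Measurable (fun p : ℝ × Ioi (0 : ℝ) => ENNReal.ofReal (p.2.1 ^ w) *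
        sphereSq (halfWave ς (piece h j) p.1) p.2.1 ^ (P / 2)) := by
      have h3 : Measurable (fun p : ℝ × Ioi (0 : ℝ) => p.2.1) :=
        measurable_subtype_coe.comp measurable_snd
      exact (h3.pow_const w).ennreal_ofReal.mul
        ((Measurable.sphereSq (measurable_halfWave ς (hpm j)) measurable_fst h3).pow_const _)
    have h2 : (fun p : ℝ × Ioi (0 : ℝ) => Z k j p.1 p.2) =
        {p : ℝ × Ioi (0 : ℝ) | p.2.1 ∈ Ico ((2 : ℝ) ^ k) (2 * 2 ^ k)}.indicator
          (fun p : ℝ × Ioi (0 : ℝ) => ENNReal.ofReal (p.2.1 ^ w) *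
        sphereSq (halfWave ς (piece h j) p.1) p.2.1 ^ (P / 2)) := by
      ext p
      by_cases hp : p.2.1 ∈ Ico ((2 : ℝ) ^ k) (2 * 2 ^ k)
      · simp only [hZ]; rw [indicator_of_mem hp, indicator_of_mem (by exact hp)]
      · simp only [hZ]; rw [indicator_of_notMem hp, indicator_of_notMem (by exact hp)]
    rw [h2]
    exact h1.indicator ((measurable_subtype_coe.comp measurable_snd) measurableSet_Ico)
  have hZbound : ∀ k j, ∫⁻ t, ∫⁻ r, Z k j t r ∂(Measure.volumeIoiPow (n - 1)) ≤
      C * dyadicWeight (-δ) (k + j) * energy γ (piece h j) ^ (P / 2) := by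
    intro k j
    refine (hC (2 ^ j) (2 ^ k) ς (by positivity) (by positivity) hς (piece h j) (hpm j)
      (hh.indicator (measurableSet_annulus n j)) (piece_eq_zero h j)).trans ?_
    gcongr
    unfold dyadicWeight
    rw [← zpow_add₀ (by norm_num)]
    exact ENNReal.ofReal_le_ofReal (dyadic_decay (min_le_left _ _) (min_le_right _ _) _)
  have hpt : ∀ t, ∀ r : Ioi (0 : ℝ), ENNReal.ofReal (r.1 ^ w) * sphereSq (halfWave ς h t) r.1 ^ (P / 2)
      ≤ ∑' k, ∑' j, M * dyadicWeight (δ / 2) (k + j) * Z k j t r := by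
    intro t r
    obtain ⟨k, hk⟩ := exists_mem_Ico_zpow r.2.out (one_lt_two (α := ℝ))
    rw [zpow_add_one₀ (by norm_num), mul_comm _ (2 : ℝ)] at hk
    refine le_trans ?_ (ENNReal.le_tsum k)
    have h1 : sphereSq (halfWave ς h t) r.1 ^ (P / 2) ≤ M * ∑' j, dyadicWeight (δ / 2) (k + j) *
        sphereSq (halfWave ς (piece h j) t) r.1 ^ (P / 2) := by
      calc _ ≤ ((K : ℝ≥0∞) * ∑' j, dyadicWeight (δ / (2 * P)) (k + j) *
            sphereSq (halfWave ς (piece h j) t) r.1) ^ (P / 2) :=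
            ENNReal.rpow_le_rpow (hK ς h hhm hh t r.1 k) hP2
        _ = (K : ℝ≥0∞) ^ (P / 2) * (∑' j, dyadicWeight (δ / (2 * P)) (k + j) *
            sphereSq (halfWave ς (piece h j) t) r.1) ^ (P / 2) := ENNReal.mul_rpow_of_nonneg _ _ hP2
        _ ≤ (K : ℝ≥0∞) ^ (P / 2) * (L * ∑' j, dyadicWeight (δ / 4) (k + j) *
            (dyadicWeight (δ / (2 * P)) (k + j) *
            sphereSq (halfWave ς (piece h j) t) r.1) ^ (P / 2)) := mul_le_mul_right (hL _ k) _
        _ = _ := by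
            rw [hM, mul_assoc]
            congr 2
            refine tsum_congr fun j => ?_
            rw [ENNReal.mul_rpow_of_nonneg _ _ hP2, dyadicWeight_rpow _ _ hP2, ← mul_assoc,
              dyadicWeight_mul]
            congr 2
            field_simp; ring
    calc _ ≤ ENNReal.ofReal (r.1 ^ w) * (M * ∑' j, dyadicWeight (δ / 2) (k + j) *
        sphereSq (halfWave ς (piece h j) t) r.1 ^ (P / 2)) := mul_le_mul_right h1 _
      _ = ∑' j, M * dyadicWeight (δ / 2) (k + j) * Z k j t r := by
          rw [← mul_assoc, ← ENNReal.tsum_mul_left]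
          refine tsum_congr fun j => ?_
          simp only [hZ]
          rw [indicator_of_mem hk]; ring
  clear_value Z
  have hZt : ∀ k j t, Measurable (Z k j t) := fun k j t =>
    Measurable.of_uncurry_left (f := Z k j) (hZm k j)
  have hZi : ∀ k j, Measurable (fun t => ∫⁻ r, Z k j t r ∂(Measure.volumeIoiPow (n - 1))) :=
    fun k j => (hZm k j).lintegral_prod_right'
  calc mixedEnergy P w (halfWave ς h)
      ≤ ∫⁻ t, ∫⁻ r : Ioi (0 : ℝ), ∑' k, ∑' j, M * dyadicWeight (δ / 2) (k + j) * Z k j t r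
        ∂(Measure.volumeIoiPow (n - 1)) := lintegral_mono fun t => lintegral_mono fun r => hpt t r
    _ = ∑' k, ∑' j, M * dyadicWeight (δ / 2) (k + j) *
        ∫⁻ t, ∫⁻ r, Z k j t r ∂(Measure.volumeIoiPow (n - 1)) := by
        have e1 : ∀ t, ∫⁻ r : Ioi (0 : ℝ), ∑' k, ∑' j, M * dyadicWeight (δ / 2) (k + j) * Z k j t r
            ∂(Measure.volumeIoiPow (n - 1)) = ∑' k, ∑' j, M * dyadicWeight (δ / 2) (k + j) *
              ∫⁻ r : Ioi (0 : ℝ), Z k j t r ∂(Measure.volumeIoiPow (n - 1)) := by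
          intro t
          have hmt : ∀ k j, Measurable fun r => M * dyadicWeight (δ / 2) (k + j) * Z k j t r :=
            fun k j => (hZt k j t).const_mul _
          rw [lintegral_tsum fun k => (Measurable.tsum (hmt k)).aemeasurable]
          refine tsum_congr fun k => ?_
          rw [lintegral_tsum fun j => (hmt k j).aemeasurable]
          refine tsum_congr fun j => ?_
          exact lintegral_const_mul _ (hZt k j t)
        simp only [e1]
        have hmt : ∀ k j, Measurable fun t => M * dyadicWeight (δ / 2) (k + j) *
            ∫⁻ r : Ioi (0 : ℝ), Z k j t r ∂(Measure.volumeIoiPow (n - 1)) :=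
          fun k j => (hZi k j).const_mul _
        rw [lintegral_tsum fun k => (Measurable.tsum (hmt k)).aemeasurable]
        refine tsum_congr fun k => ?_
        rw [lintegral_tsum fun j => (hmt k j).aemeasurable]
        refine tsum_congr fun j => ?_
        exact lintegral_const_mul _ (hZi k j)
    _ ≤ ∑' k, ∑' j, M * C * (dyadicWeight (-(δ / 2)) (k + j) * energy γ (piece h j) ^ (P / 2)) := by
        refine ENNReal.tsum_le_tsum fun k => ENNReal.tsum_le_tsum fun j => ?_
        refine (mul_le_mul_right (hZbound k j) _).trans (le_of_eq ?_)
        have : dyadicWeight (-(δ / 2)) (k + j) = dyadicWeight (δ / 2) (k + j) * dyadicWeight (-δ) (k + j) := by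
          rw [dyadicWeight_mul]; congr 1; ring
        rw [this]; ring
    _ = M * C * (S * ∑' j, energy γ (piece h j) ^ (P / 2)) := by
        rw [ENNReal.tsum_comm, ← ENNReal.tsum_mul_left, ← ENNReal.tsum_mul_left]
        refine tsum_congr fun j => ?_
        rw [ENNReal.tsum_mul_left, ENNReal.tsum_mul_right]
        have hSj : ∑' k, dyadicWeight (-(δ / 2)) (k + j) = S := by
          rw [hS, ← tsum_dyadicWeight_add _ j]
          exact tsum_congr fun k => by rw [add_comm]
        rw [hSj]
    _ ≤ M * C * (S * energy γ h ^ (P / 2)) := by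
        gcongr
        refine (tsum_rpow_le_rpow_tsum (by linarith) _).trans ?_
        exact ENNReal.rpow_le_rpow (tsum_energy_piece_le γ h) hP2
    _ = _ := by
        rw [ENNReal.coe_mul, ENNReal.coe_mul, ENNReal.coe_mul, ENNReal.coe_toNNReal hSfin,
          ENNReal.coe_rpow_of_nonneg _ hP2, hM]
        ring

/-! ### Minkowski's integral inequality -/

theorem lintegral_rpow_lintegral_le {S X : Type*} [MeasurableSpace S] [MeasurableSpace X]
    {ν : Measure S} {μ : Measure X} [SFinite ν] [SFinite μ] {g : S → X → ℝ≥0∞}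
    (hg : Measurable (Function.uncurry g)) {p : ℝ} (hp : 1 ≤ p) :
    ∫⁻ x, (∫⁻ s, g s x ∂ν) ^ p ∂μ ≤ (∫⁻ s, (∫⁻ x, g s x ^ p ∂μ) ^ (1 / p) ∂ν) ^ p := by
  rcases hp.eq_or_lt with rfl | hp1
  · simp only [ENNReal.rpow_one, div_one]
    exact (lintegral_lintegral_swap (f := fun x s => g s x)
      (hg.comp measurable_swap).aemeasurable).le
  have hp0 : 0 < p := by linarith
  set N : S → ℝ≥0∞ := fun s => (∫⁻ x, g s x ^ p ∂μ) ^ (1 / p) with hN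
  have hgp : Measurable (fun z : S × X => g z.1 z.2 ^ p) := hg.pow_const p
  have hNm : Measurable N := (hgp.lintegral_prod_right').pow_const _
  have hNp : ∀ s, N s ^ p = ∫⁻ x, g s x ^ p ∂μ := by
    intro s; simp only [hN]
    rw [← ENNReal.rpow_mul, one_div_mul_cancel hp0.ne', ENNReal.rpow_one]
  set A := ∫⁻ s, N s ∂ν with hA
  rcases eq_or_ne A ∞ with hAinf | hAfin
  · rw [hAinf, ENNReal.top_rpow_of_pos hp0]; exact le_top
  have hNfin : ∀ᵐ s ∂ν, N s < ∞ := ae_lt_top hNm hAfin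
  set S0 : Set S := {s | N s ≠ 0} with hS0
  have hS0m : MeasurableSet S0 := hNm (measurableSet_singleton 0).compl
  -- the part where `N` vanishes does not contribute
  have hzero : ∀ᵐ x ∂μ, ∀ᵐ s ∂ν, s ∉ S0 → g s x = 0 := by
    have h1 : ∀ᵐ s ∂ν, ∀ᵐ x ∂μ, s ∉ S0 → g s x = 0 := by
      refine Eventually.of_forall fun s => ?_
      by_cases hs : s ∈ S0
      · exact Eventually.of_forall fun x hx => absurd hs hx
      · have h2 : N s = 0 := by simpa [hS0] using hs
        have h3 : ∫⁻ x, g s x ^ p ∂μ = 0 := by rw [← hNp, h2, ENNReal.zero_rpow_of_pos hp0]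
        have h4 := (lintegral_eq_zero_iff (hgp.comp measurable_prodMk_left)).1 h3
        filter_upwards [h4] with x hx _
        exact (ENNReal.rpow_eq_zero_iff_of_pos hp0).1 hx
    have hset : MeasurableSet {z : S × X | z.1 ∉ S0 → g z.1 z.2 = 0} := by
      have : {z : S × X | z.1 ∉ S0 → g z.1 z.2 = 0} =
          (Prod.fst ⁻¹' S0) ∪ {z : S × X | Function.uncurry g z = 0} := by
        ext z; simp only [mem_ofPred_eq, mem_union, mem_preimage, Function.uncurry]; tauto
      rw [this]
      exact (measurable_fst hS0m).union (hg (measurableSet_singleton 0))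
    exact (Measure.ae_ae_comm hset).1 h1
  set q := Real.conjExponent p with hq
  have hpq : p.HolderConjugate q := Real.HolderConjugate.conjExponent hp1
  have hq0 : 0 < q := hpq.symm.pos
  have hmain : ∀ᵐ x ∂μ, (∫⁻ s, g s x ∂ν) ^ p ≤
      (∫⁻ s in S0, g s x ^ p * N s ^ (1 - p) ∂ν) * A ^ (p - 1) := by
    filter_upwards [hzero] with x hx
    have hgx : Measurable (fun s => g s x) := hg.comp measurable_prodMk_right
    have h1 : ∫⁻ s, g s x ∂ν = ∫⁻ s in S0, (g s x * N s ^ (-(1 / q))) * N s ^ (1 / q) ∂ν := by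
      rw [← lintegral_indicator hS0m]
      refine lintegral_congr_ae ?_
      filter_upwards [hx, hNfin] with s hs hf
      by_cases h : s ∈ S0
      · rw [indicator_of_mem h, mul_assoc, ← ENNReal.rpow_add _ _ h hf.ne]; simp
      · rw [indicator_of_notMem h, hs h]
    have h2 := ENNReal.lintegral_mul_le_Lp_mul_Lq (ν.restrict S0) hpq
      (f := fun s => g s x * N s ^ (-(1 / q))) (g := fun s => N s ^ (1 / q))
      ((hgx.mul (hNm.pow_const _)).aemeasurable) (hNm.pow_const _).aemeasurable
    have hqq : ∀ s, (N s ^ (1 / q)) ^ q = N s := by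
      intro s; rw [← ENNReal.rpow_mul, one_div_mul_cancel hq0.ne', ENNReal.rpow_one]
    have hpq1 : 1 / q * p = p - 1 := by
      have := hpq.sub_one_mul_conj
      field_simp
      linarith
    have hpp : ∀ s, (g s x * N s ^ (-(1 / q))) ^ p = g s x ^ p * N s ^ (1 - p) := by
      intro s
      rw [ENNReal.mul_rpow_of_nonneg _ _ hp0.le, ← ENNReal.rpow_mul]
      congr 2
      rw [neg_mul, hpq1]; ring
    simp only [Pi.mul_apply, hqq, hpp] at h2
    rw [h1]
    calc _ ≤ ((∫⁻ s in S0, g s x ^ p * N s ^ (1 - p) ∂ν) ^ (1 / p) *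
          (∫⁻ s in S0, N s ∂ν) ^ (1 / q)) ^ p := ENNReal.rpow_le_rpow h2 hp0.le
      _ = (∫⁻ s in S0, g s x ^ p * N s ^ (1 - p) ∂ν) * (∫⁻ s in S0, N s ∂ν) ^ (p - 1) := by
          rw [ENNReal.mul_rpow_of_nonneg _ _ hp0.le, ← ENNReal.rpow_mul, ← ENNReal.rpow_mul,
            one_div_mul_cancel hp0.ne', ENNReal.rpow_one, hpq1]
      _ ≤ _ := mul_le_mul_right (ENNReal.rpow_le_rpow (setLIntegral_le_lintegral _ _)
            (by linarith)) _
  have hm3 : Measurable (fun z : X × S => g z.2 z.1 ^ p * N z.2 ^ (1 - p)) :=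
    (hgp.comp measurable_swap).mul ((hNm.comp measurable_snd).pow_const _)
  calc ∫⁻ x, (∫⁻ s, g s x ∂ν) ^ p ∂μ
      ≤ ∫⁻ x, (∫⁻ s in S0, g s x ^ p * N s ^ (1 - p) ∂ν) * A ^ (p - 1) ∂μ := lintegral_mono_ae hmain
    _ = (∫⁻ s in S0, ∫⁻ x, g s x ^ p * N s ^ (1 - p) ∂μ ∂ν) * A ^ (p - 1) := by
        rw [lintegral_mul_const' _ _ (ENNReal.rpow_ne_top_of_nonneg (by linarith) hAfin),
          lintegral_lintegral_swap hm3.aemeasurable]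
    _ ≤ A * A ^ (p - 1) := by
        refine mul_le_mul_left (le_trans ?_ (setLIntegral_le_lintegral S0 N)) _
        refine lintegral_mono_ae ?_
        filter_upwards [ae_restrict_mem hS0m, ae_restrict_of_ae hNfin] with s hs hf
        have hgs : Measurable (fun x => g s x ^ p) := hgp.comp measurable_prodMk_left
        rw [lintegral_mul_const _ hgs, ← hNp,
          ← ENNReal.rpow_add _ _ hs hf.ne]
        simp
    _ = A ^ p := by
        conv_rhs => rw [show p = 1 + (p - 1) by ring, ENNReal.rpow_add_of_nonneg _ _ zero_le_one
          (by linarith), ENNReal.rpow_one]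

/-! ### The dual of the trace estimate -/

/-- The weighted norm `∫ r^{s - n/2} ‖F(r·)‖_{L²(S)} r^{n-1} dr`. -/
def dualNorm {n : ℕ} (s : ℝ) (F : Rn n → ℂ) : ℝ≥0∞ :=
  ∫⁻ r : Ioi (0 : ℝ), ENNReal.ofReal (r.1 ^ (s - n / 2)) * sphereSq F r.1 ^ (1 / 2 : ℝ)
    ∂(Measure.volumeIoiPow (n - 1))

theorem measurable_fourierIntegral {n : ℕ} {h : Rn n → ℂ} (hh : Measurable h) :
    Measurable (fun x => ∫ ξ, osc ξ x * h ξ) := by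
  have h1 := (measurable_halfWave 1 hh).of_uncurry_left (x := 0)
  have h2 : halfWave 1 h 0 = fun x => ∫ ξ, osc ξ x * h ξ := funext (halfWave_zero_time 1 h)
  rwa [h2] at h1

theorem exists_pairing_bound (n : ℕ) (hn : 0 < n) {s : ℝ} (hs : 1 / 2 < s) (hs' : s < n / 2) :
    ∃ C : ℝ≥0, ∀ F h : Rn n → ℂ, Measurable F → Measurable h → Integrable h →
    ∫⁻ x, ‖F x‖ₑ * ‖∫ ξ, osc ξ x * h ξ‖ₑ ≤ C * dualNorm s F * energy s h ^ (1 / 2 : ℝ) := by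
  obtain ⟨C, hC⟩ := exists_trace_bound n hn hs hs'
  refine ⟨C ^ (1 / 2 : ℝ), fun F h hF hhm hh => ?_⟩
  have hFm := measurable_fourierIntegral hhm
  have hm : Measurable (fun x => ‖F x‖ₑ * ‖∫ ξ, osc ξ x * h ξ‖ₑ) := hF.enorm.mul hFm.enorm
  rw [lintegral_polar hn hm]
  set E : ℝ≥0∞ := (C : ℝ≥0∞) ^ (1 / 2 : ℝ) * energy s h ^ (1 / 2 : ℝ) with hE
  have hFs : Measurable (fun r : Ioi (0 : ℝ) => sphereSq F r.1) :=
    Measurable.sphereSq (f := fun _ : Unit => F) (hF.comp measurable_snd)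
      (a := fun _ : Ioi (0 : ℝ) => ()) measurable_const measurable_subtype_coe
  have hmx : Measurable (fun r : Ioi (0 : ℝ) => ENNReal.ofReal (r.1 ^ (s - n / 2)) *
      sphereSq F r.1 ^ (1 / 2 : ℝ)) :=
    (measurable_subtype_coe.pow_const (s - n / 2)).ennreal_ofReal.mul (hFs.pow_const _)
  calc _ ≤ ∫⁻ r : Ioi (0 : ℝ), (ENNReal.ofReal (r.1 ^ (s - n / 2)) * sphereSq F r.1 ^ (1 / 2 : ℝ)) * E
        ∂(Measure.volumeIoiPow (n - 1)) := by
        refine lintegral_mono fun r => ?_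
        have hr : 0 < r.1 := r.2
        have hcs := ENNReal.lintegral_mul_le_Lp_mul_Lq (sphereMeasure n) Real.HolderConjugate.two_two
          (f := fun ω => ‖F (r.1 • ω.1)‖ₑ) (g := fun ω => ‖∫ ξ, osc ξ (r.1 • ω.1) * h ξ‖ₑ)
          (hF.comp (measurable_subtype_coe.const_smul r.1)).enorm.aemeasurable
          (hFm.comp (measurable_subtype_coe.const_smul r.1)).enorm.aemeasurable
        simp only [ENNReal.rpow_two] at hcs
        have htr := hC h hhm hh r.1 hr
        have h2 : sphereSq (fun x => ∫ ξ, osc ξ x * h ξ) r.1 ^ (1 / 2 : ℝ) ≤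
            ENNReal.ofReal (r.1 ^ (s - n / 2)) * E := by
          have e1 : sphereSq (fun x => ∫ ξ, osc ξ x * h ξ) r.1 ≤
              ENNReal.ofReal (r.1 ^ (2 * s - n)) * (C * energy s h) := by
            calc _ = ENNReal.ofReal (r.1 ^ (2 * s - n)) * (ENNReal.ofReal (r.1 ^ (n - 2 * s)) *
                  sphereSq (fun x => ∫ ξ, osc ξ x * h ξ) r.1) := by
                  rw [← mul_assoc, ← ENNReal.ofReal_mul (by positivity), ← Real.rpow_add hr]
                  simp
              _ ≤ _ := mul_le_mul_right htr _
          refine (ENNReal.rpow_le_rpow e1 (by norm_num)).trans (le_of_eq ?_)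
          rw [ENNReal.mul_rpow_of_nonneg _ _ (by norm_num), ENNReal.mul_rpow_of_nonneg _ _ (by norm_num),
            ENNReal.ofReal_rpow_of_nonneg (by positivity) (by norm_num), ← Real.rpow_mul hr.le, hE]
          congr 3; ring
        calc _ ≤ sphereSq F r.1 ^ (1 / 2 : ℝ) *
              sphereSq (fun x => ∫ ξ, osc ξ x * h ξ) r.1 ^ (1 / 2 : ℝ) := hcs
          _ ≤ sphereSq F r.1 ^ (1 / 2 : ℝ) * (ENNReal.ofReal (r.1 ^ (s - n / 2)) * E) :=
              mul_le_mul_right h2 _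
          _ = _ := by ring
    _ = dualNorm s F * E := lintegral_mul_const _ hmx
    _ = _ := by rw [hE, ENNReal.coe_rpow_of_nonneg _ (by norm_num)]; ring

theorem exists_dual_trace_bound (n : ℕ) (hn : 0 < n) {s : ℝ} (hs : 1 / 2 < s) (hs' : s < n / 2) :
    ∃ C : ℝ≥0, ∀ F : Rn n → ℂ, Measurable F → Integrable F →
    energy (-s) (fun ξ => ∫ x, osc x ξ * F x) ≤ C * dualNorm s F ^ 2 := by
  obtain ⟨C, hC⟩ := exists_pairing_bound n hn hs hs'
  refine ⟨C ^ 2, fun F hF hFi => ?_⟩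
  set G : Rn n → ℂ := fun ξ => ∫ x, osc x ξ * F x with hG
  have hGm : Measurable G := measurable_fourierIntegral hF
  set A : ℕ → Set (Rn n) := fun N => {ξ | 1 / ((N : ℝ) + 1) ≤ ‖ξ‖ ∧ ‖ξ‖ ≤ (N : ℝ) + 1} with hA
  have hAm : ∀ N, MeasurableSet (A N) := fun N =>
    (measurableSet_le measurable_const measurable_norm).inter
      (measurableSet_le measurable_norm measurable_const)
  have hAmono : Monotone A := by
    intro N M hNM ξ hξ
    have hc : (N : ℝ) ≤ M := by exact_mod_cast hNM
    refine ⟨le_trans ?_ hξ.1, hξ.2.trans (by linarith)⟩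
    exact one_div_le_one_div_of_le (by positivity) (by linarith)
  set e : Rn n → ℝ≥0∞ := fun ξ => ENNReal.ofReal (‖ξ‖ ^ (2 * -s)) * ‖G ξ‖ₑ ^ 2 with he
  have hbound : ∀ N, ∫⁻ ξ in A N, e ξ ≤ (C ^ 2 : ℝ≥0) * dualNorm s F ^ 2 := by
    intro N
    set h : Rn n → ℂ := (A N).indicator
      (fun ξ => ((‖ξ‖ ^ (-(2 * s)) : ℝ) : ℂ) * (starRingEnd ℂ) (G ξ)) with hh
    have hpos : ∀ ξ ∈ A N, 0 < ‖ξ‖ := fun ξ hξ => lt_of_lt_of_le (by positivity) hξ.1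
    have hhm : Measurable h := by
      refine Measurable.indicator ?_ (hAm N)
      exact (Complex.measurable_ofReal.comp (measurable_norm.pow_const _)).mul
        (Complex.continuous_conj.measurable.comp hGm)
    have hhb : ∀ ξ, ‖h ξ‖ ≤ (1 / ((N : ℝ) + 1)) ^ (-(2 * s)) * ∫ x, ‖F x‖ := by
      intro ξ
      by_cases hξ : ξ ∈ A N
      · rw [hh, indicator_of_mem hξ, norm_mul, RCLike.norm_conj, Complex.norm_real,
          Real.norm_of_nonneg (by positivity)]
        refine mul_le_mul (Real.rpow_le_rpow_of_nonpos (by positivity) hξ.1 (by linarith))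
          (norm_fourierIntegral_le _) (norm_nonneg _) (by positivity)
      · rw [hh, indicator_of_notMem hξ, norm_zero]; positivity
    have hAfin : volume (A N) < ∞ := by
      refine (measure_mono (t := Metric.closedBall 0 ((N : ℝ) + 1)) fun ξ hξ => ?_).trans_lt
        measure_closedBall_lt_top
      simpa using hξ.2
    have hhi : Integrable h := by
      rw [hh, integrable_indicator_iff (hAm N)]
      refine Measure.integrableOn_of_bounded (M := (1 / ((N : ℝ) + 1)) ^ (-(2 * s)) * ∫ x, ‖F x‖)
        hAfin.ne ?_ ?_
      · exact ((Complex.measurable_ofReal.comp (measurable_norm.pow_const _)).mul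
          (Complex.continuous_conj.measurable.comp hGm)).aestronglyMeasurable
      · filter_upwards [ae_restrict_mem (hAm N)] with ξ hξ
        have := hhb ξ
        rwa [hh, indicator_of_mem hξ] at this
    set E := ∫⁻ ξ in A N, e ξ with hE
    have hEe : energy s h = E := by
      unfold energy
      rw [hE, ← lintegral_indicator (hAm N)]
      refine lintegral_congr fun ξ => ?_
      by_cases hξ : ξ ∈ A N
      · rw [hh, indicator_of_mem hξ, indicator_of_mem hξ, he, enorm_mul, mul_pow, ← mul_assoc]
        congr 1
        · rw [← ofReal_norm, Complex.norm_real, Real.norm_of_nonneg (by positivity),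
            ← ENNReal.ofReal_pow (by positivity), ← ENNReal.ofReal_mul (by positivity), sq,
            ← Real.rpow_add (hpos ξ hξ), ← Real.rpow_add (hpos ξ hξ)]
          congr 2; ring
        · rw [← ofReal_norm, RCLike.norm_conj, ofReal_norm]
      · rw [hh, indicator_of_notMem hξ, indicator_of_notMem hξ]; simp
    have hprod : ∀ ξ, ‖G ξ * h ξ‖ₑ = (A N).indicator e ξ := by
      intro ξ
      by_cases hξ : ξ ∈ A N
      · rw [hh, indicator_of_mem hξ, indicator_of_mem hξ, he, enorm_mul, enorm_mul,
          ← ofReal_norm ((starRingEnd ℂ) (G ξ)), RCLike.norm_conj, ofReal_norm,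
          ← ofReal_norm (((‖ξ‖ ^ (-(2 * s)) : ℝ) : ℂ)), Complex.norm_real,
          Real.norm_of_nonneg (by positivity)]
        simp only
        rw [show 2 * -s = -(2 * s) by ring]; ring
      · rw [hh, indicator_of_notMem hξ, indicator_of_notMem hξ]; simp
    have hprod2 : ∀ ξ, G ξ * h ξ = ((‖G ξ * h ξ‖ : ℝ) : ℂ) := by
      intro ξ
      by_cases hξ : ξ ∈ A N
      · rw [hh, indicator_of_mem hξ, mul_left_comm, Complex.mul_conj, ← Complex.ofReal_mul,
          Complex.norm_real, Real.norm_of_nonneg]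
        exact mul_nonneg (by positivity) (Complex.normSq_nonneg _)
      · rw [hh, indicator_of_notMem hξ]; simp
    have hGi : Integrable (fun ξ => G ξ * h ξ) :=
      hhi.bdd_mul (c := ∫ x, ‖F x‖) hGm.aestronglyMeasurable
        (Eventually.of_forall fun ξ => norm_fourierIntegral_le ξ)
    have hEdual : E = ‖∫ ξ, G ξ * h ξ‖ₑ := by
      rw [integral_congr_ae (Eventually.of_forall hprod2), integral_complex_ofReal, ← ofReal_norm,
        Complex.norm_real, Real.norm_of_nonneg (integral_nonneg fun _ => norm_nonneg _),
        ofReal_integral_norm_eq_lintegral_enorm hGi, hE, ← lintegral_indicator (hAm N)]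
      exact lintegral_congr fun ξ => (hprod ξ).symm
    have hfub : ∫ ξ, G ξ * h ξ = ∫ x, F x * ∫ ξ, osc ξ x * h ξ := by
      have hi : Integrable (Function.uncurry fun (ξ x : Rn n) => osc x ξ * (h ξ * F x))
          (volume.prod volume) := by
        refine (hhi.mul_prod hFi).bdd_mul (c := 1) ?_ (Eventually.of_forall fun z => (norm_osc _ _).le)
        have h1 : Continuous (fun z : Rn n × Rn n => osc z.2 z.1) := by fun_prop
        exact h1.aestronglyMeasurable
      calc ∫ ξ, G ξ * h ξ = ∫ ξ, ∫ x, osc x ξ * (h ξ * F x) := by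
            congr 1; ext ξ
            simp only [hG]
            rw [← integral_mul_const]
            congr 1; ext x; ring
        _ = ∫ x, ∫ ξ, osc x ξ * (h ξ * F x) := integral_integral_swap hi
        _ = _ := by
            congr 1; ext x
            rw [← integral_const_mul]
            congr 1; ext ξ
            rw [osc_comm x ξ]; ring
    have hfin : E ≤ C * dualNorm s F * E ^ (1 / 2 : ℝ) := by
      calc E = ‖∫ x, F x * ∫ ξ, osc ξ x * h ξ‖ₑ := by rw [hEdual, hfub]
        _ ≤ ∫⁻ x, ‖F x‖ₑ * ‖∫ ξ, osc ξ x * h ξ‖ₑ := by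
            refine (enorm_integral_le_lintegral_enorm _).trans (le_of_eq ?_)
            simp only [enorm_mul]
        _ ≤ _ := by rw [← hEe]; exact hC F h hF hhm hhi
    have hEfin : E ≠ ∞ := by rw [hEdual]; exact enorm_ne_top
    rcases eq_or_ne E 0 with h0 | h0
    · rw [h0]; exact bot_le
    · have hhalf : E ^ (1 / 2 : ℝ) * E ^ (1 / 2 : ℝ) = E := by
        rw [← ENNReal.rpow_add _ _ h0 hEfin]; norm_num
      have h0' : E ^ (1 / 2 : ℝ) ≠ 0 := by simp [h0, hEfin]
      have hf' : E ^ (1 / 2 : ℝ) ≠ ∞ := ENNReal.rpow_ne_top_of_nonneg (by norm_num) hEfin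
      have h3 : E ^ (1 / 2 : ℝ) ≤ C * dualNorm s F := by
        rw [← ENNReal.mul_le_mul_iff_left h0' hf', hhalf]; exact hfin
      calc E = (E ^ (1 / 2 : ℝ)) ^ 2 := by rw [sq, hhalf]
        _ ≤ (C * dualNorm s F) ^ 2 := pow_le_pow_left' h3 2
        _ = _ := by rw [mul_pow]; push_cast; rfl
  have hunion : ⋃ N, A N = {0}ᶜ := by
    ext ξ
    simp only [mem_iUnion, mem_compl_iff, mem_singleton_iff]
    constructor
    · rintro ⟨N, hN⟩ rfl
      have h1 : 1 / ((N : ℝ) + 1) ≤ ‖(0 : Rn n)‖ := hN.1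
      rw [norm_zero] at h1
      exact absurd h1 (not_le.2 (by positivity))
    · intro hξ
      have hp := norm_pos_iff.2 hξ
      obtain ⟨N₁, h1⟩ := exists_nat_one_div_lt hp
      obtain ⟨N₂, h2⟩ := exists_nat_ge ‖ξ‖
      have m1 : (N₁ : ℝ) ≤ (max N₁ N₂ : ℕ) := by exact_mod_cast le_max_left _ _
      have m2 : (N₂ : ℝ) ≤ (max N₁ N₂ : ℕ) := by exact_mod_cast le_max_right _ _
      refine ⟨max N₁ N₂, le_trans ?_ h1.le, by linarith⟩
      exact one_div_le_one_div_of_le (by positivity) (by linarith)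
  have : Nonempty (Fin n) := ⟨⟨0, hn⟩⟩
  calc energy (-s) G = ∫⁻ ξ in ⋃ N, A N, e ξ := by
        rw [hunion, restrict_compl_singleton]; rfl
    _ = ⨆ N, ∫⁻ ξ in A N, e ξ := setLIntegral_iUnion_of_directed _ hAmono.directed_le
    _ ≤ _ := iSup_le hbound

/-! ### Completeness of the Schwartz space and the uniform boundedness principle -/

section Complete

variable {E F : Type*} [NormedAddCommGroup E] [NormedSpace ℝ E] [NormedAddCommGroup F]
  [NormedSpace ℝ F]

theorem SchwartzMap.tendsto_iff_seminorm {ι : Type*} {l : Filter ι} {f : ι → 𝓢(E, F)}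
    {g : 𝓢(E, F)} :
    Tendsto f l (nhds g) ↔ ∀ k n : ℕ, ∀ ε > 0, ∀ᶠ i in l, SchwartzMap.seminorm ℝ k n (f i - g) < ε := by
  rw [(schwartz_withSeminorms ℝ E F).tendsto_nhds]
  exact ⟨fun h k n => h (k, n), fun h i => h i.1 i.2⟩

theorem SchwartzMap.iteratedFDeriv_sub_apply (f g : 𝓢(E, F)) (n : ℕ) (x : E) :
    iteratedFDeriv ℝ n (f - g) x = iteratedFDeriv ℝ n f x - iteratedFDeriv ℝ n g x := by
  exact _root_.iteratedFDeriv_sub_apply ((f.smooth n).contDiffAt) ((g.smooth n).contDiffAt)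

theorem SchwartzMap.exists_tendsto_of_cauchySeq [CompleteSpace F] {f : ℕ → 𝓢(E, F)}
    (hf : CauchySeq f) : ∃ g, Tendsto f atTop (nhds g) := by
  have hc : ∀ k n : ℕ, ∀ ε > 0, ∃ N, ∀ m ≥ N, ∀ m' ≥ N, ∀ x,
      ‖x‖ ^ k * ‖iteratedFDeriv ℝ n (f m) x - iteratedFDeriv ℝ n (f m') x‖ ≤ ε := by
    intro k n ε hε
    have h1 : Tendsto (fun p : ℕ × ℕ => f p.2 - f p.1) atTop (nhds 0) := by
      have h0 := hf.tendsto_uniformity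
      rw [uniformity_eq_comap_nhds_zero, tendsto_comap_iff] at h0
      exact h0
    have h2 := SchwartzMap.tendsto_iff_seminorm.1 h1 k n ε hε
    obtain ⟨N, hN⟩ := eventually_atTop_prod_self.1 h2
    refine ⟨N, fun m hm m' hm' x => ?_⟩
    have h3 := hN m' m hm' hm
    rw [sub_zero] at h3
    rw [← SchwartzMap.iteratedFDeriv_sub_apply]
    exact (SchwartzMap.le_seminorm ℝ k n _ x).trans h3.le
  have hp : ∀ (x : E) (n : ℕ), ∃ y, Tendsto (fun m => iteratedFDeriv ℝ n (f m) x) atTop (nhds y) := by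
    intro x n
    refine cauchySeq_tendsto_of_complete (Metric.cauchySeq_iff'.2 fun ε hε => ?_)
    obtain ⟨N, hN⟩ := hc 0 n (ε / 2) (by positivity)
    refine ⟨N, fun m hm => ?_⟩
    have := hN m hm N le_rfl x
    rw [pow_zero, one_mul] at this
    rw [dist_eq_norm]; linarith
  choose p hp using hp
  have hlim : ∀ k n : ℕ, ∀ ε > 0, ∃ N, ∀ m ≥ N, ∀ x,
      ‖x‖ ^ k * ‖iteratedFDeriv ℝ n (f m) x - p x n‖ ≤ ε := by
    intro k n ε hε
    obtain ⟨N, hN⟩ := hc k n ε hε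
    refine ⟨N, fun m hm x => ?_⟩
    refine le_of_tendsto (((tendsto_const_nhds.sub (hp x n)).norm).const_mul _) ?_
    filter_upwards [eventually_ge_atTop N] with m' hm'
    exact hN m hm m' hm' x
  have hunif : ∀ n, TendstoUniformly (fun m x => iteratedFDeriv ℝ n (f m) x) (fun x => p x n)
      atTop := by
    intro n
    rw [Metric.tendstoUniformly_iff]
    intro ε hε
    obtain ⟨N, hN⟩ := hlim 0 n (ε / 2) (by positivity)
    filter_upwards [eventually_ge_atTop N] with m hm x
    have := hN m hm x
    rw [pow_zero, one_mul] at this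
    rw [dist_comm, dist_eq_norm]; linarith
  set g : E → F := fun x => (p x 0).curry0 with hg
  have htay : HasFTaylorSeriesUpTo (⊤ : ℕ∞) g p := by
    refine ⟨fun x => rfl, fun m _ x => ?_, fun m _ => ?_⟩
    · refine hasFDerivAt_of_tendstoUniformly (l := (atTop : Filter ℕ))
        (f := fun i x => iteratedFDeriv ℝ m (f i) x)
        (f' := fun i x => (iteratedFDeriv ℝ (m + 1) (f i) x).curryLeft)
        (g' := fun x => (p x m.succ).curryLeft) ?_ ?_ (fun x => hp x m) x
      · have h1 := (continuousMultilinearCurryLeftEquiv ℝ (fun _ : Fin (m + 1) => E)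
          F).isometry.uniformContinuous
        exact h1.comp_tendstoUniformly (hunif (m + 1))
      · intro i y
        have h2 := (((f i).smooth ⊤).ftaylorSeries).fderiv m
          (by exact_mod_cast WithTop.coe_lt_top m) y
        exact h2
    · exact (hunif m).continuous (Eventually.of_forall fun i =>
        ((f i).smooth ⊤).continuous_iteratedFDeriv (by exact_mod_cast le_top)).frequently
  have hgs : ContDiff ℝ (⊤ : ℕ∞) g := htay.contDiff
  have hpd : ∀ n x, iteratedFDeriv ℝ n g x = p x n := fun n x =>
    (htay.eq_iteratedFDeriv (by exact_mod_cast le_top) x).symm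
  refine ⟨⟨g, hgs, fun k n => ?_⟩, ?_⟩
  · obtain ⟨N, hN⟩ := hlim k n 1 one_pos
    refine ⟨SchwartzMap.seminorm ℝ k n (f N) + 1, fun x => ?_⟩
    rw [hpd]
    have h1 := hN N le_rfl x
    have h2 := SchwartzMap.le_seminorm ℝ k n (f N) x
    have h3 : ‖p x n‖ ≤ ‖iteratedFDeriv ℝ n (f N) x‖ + ‖iteratedFDeriv ℝ n (f N) x - p x n‖ := by
      have := norm_sub_le (iteratedFDeriv ℝ n (f N) x) (iteratedFDeriv ℝ n (f N) x - p x n)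
      rwa [sub_sub_cancel] at this
    calc _ ≤ ‖x‖ ^ k * (‖iteratedFDeriv ℝ n (f N) x‖ + ‖iteratedFDeriv ℝ n (f N) x - p x n‖) := by
          gcongr
      _ ≤ _ := by rw [mul_add]; exact add_le_add h2 h1
  · refine SchwartzMap.tendsto_iff_seminorm.2 fun k n ε hε => ?_
    obtain ⟨N, hN⟩ := hlim k n (ε / 2) (by positivity)
    filter_upwards [eventually_ge_atTop N] with m hm
    refine lt_of_le_of_lt (SchwartzMap.seminorm_le_bound ℝ k n _ (M := ε / 2) (by positivity)
      fun x => ?_) (by linarith)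
    rw [SchwartzMap.iteratedFDeriv_sub_apply]
    have := hN m hm x
    rw [← hpd] at this
    exact this

instance SchwartzMap.instCompleteSpace [CompleteSpace F] : CompleteSpace 𝓢(E, F) := by
  have : (uniformity 𝓢(E, F)).IsCountablyGenerated :=
    IsUniformAddGroup.uniformity_countably_generated
  exact UniformSpace.complete_of_cauchySeq_tendsto fun f hf =>
    SchwartzMap.exists_tendsto_of_cauchySeq hf

instance SchwartzMap.instBaireSpace [CompleteSpace F] : BaireSpace 𝓢(E, F) := by
  have : (uniformity 𝓢(E, F)).IsCountablyGenerated :=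
    IsUniformAddGroup.uniformity_countably_generated
  let := UniformSpace.pseudoMetricSpace 𝓢(E, F)
  infer_instance

end Complete

/-- A pointwise bounded family of tempered distributions is bounded by a single Schwartz
seminorm. -/
theorem exists_seminorm_bound {E ι : Type*} [NormedAddCommGroup E] [NormedSpace ℝ E]
    (T : ι → 𝓢'(E, ℂ)) (hT : ∀ ψ : 𝓢(E, ℂ), ∃ B : ℝ, ∀ i, ‖T i ψ‖ ≤ B) :
    ∃ (C : ℝ≥0) (s : Finset (ℕ × ℕ)), ∀ i ψ,
      ‖T i ψ‖ ≤ C * (s.sup (schwartzSeminormFamily ℂ E ℂ)) ψ := by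
  set q : ι → Seminorm ℂ 𝓢(E, ℂ) := fun i =>
    (normSeminorm ℂ ℂ).comp ((T i : 𝓢(E, ℂ) →L[ℂ] ℂ) : 𝓢(E, ℂ) →ₗ[ℂ] ℂ) with hq
  have hqa : ∀ i ψ, q i ψ = ‖T i ψ‖ := fun i ψ => rfl
  have hbdd : BddAbove (range q) := by
    rw [Seminorm.bddAbove_range_iff]
    intro ψ
    obtain ⟨B, hB⟩ := hT ψ
    exact ⟨B, by rintro _ ⟨i, rfl⟩; exact hB i⟩
  have hcont : ∀ i, Continuous (q i) := fun i => (T i).continuous.norm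
  have h1 := Seminorm.continuous_iSup q hcont hbdd
  have h1' : Continuous (iSup q : Seminorm ℂ 𝓢(E, ℂ)) := by
    rwa [← Seminorm.coe_iSup_eq hbdd] at h1
  obtain ⟨s, C, -, hC⟩ := Seminorm.bound_of_continuous (schwartz_withSeminorms ℂ E ℂ) _ h1'
  refine ⟨C, s, fun i ψ => ?_⟩
  have h2 : q i ψ ≤ (iSup q : Seminorm ℂ 𝓢(E, ℂ)) ψ := by
    rw [Seminorm.coe_iSup_eq hbdd, iSup_apply]
    refine le_ciSup (f := fun i => q i ψ) ?_ i
    obtain ⟨B, hB⟩ := hT ψ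
    exact ⟨B, by rintro _ ⟨i, rfl⟩; exact hB i⟩
  exact h2.trans (hC ψ)

/-! ### Seminorm estimates for products, and compactly supported approximations -/

section Leibniz

variable {E : Type*} [NormedAddCommGroup E] [NormedSpace ℝ E]

theorem SchwartzMap.pow_mul_norm_iteratedFDeriv_le {g : E → ℂ} (hg : ContDiff ℝ (⊤ : ℕ∞) g)
    {φ ψ : 𝓢(E, ℂ)} (h : ∀ x, ψ x = g x * φ x) (k n : ℕ) (x : E) :
    ‖x‖ ^ k * ‖iteratedFDeriv ℝ n ψ x‖ ≤ ∑ i ∈ Finset.range (n + 1),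
      (n.choose i : ℝ) * ‖iteratedFDeriv ℝ i g x‖ * (‖x‖ ^ k * ‖iteratedFDeriv ℝ (n - i) φ x‖) := by
  have h1 : (ψ : E → ℂ) = fun x => g x * φ x := funext h
  have h2 := norm_iteratedFDeriv_mul_le (𝕜 := ℝ) hg (φ.smooth ⊤) x (n := n)
    (by exact_mod_cast le_top)
  rw [h1]
  calc _ ≤ ‖x‖ ^ k * ∑ i ∈ Finset.range (n + 1), (n.choose i : ℝ) * ‖iteratedFDeriv ℝ i g x‖ *
        ‖iteratedFDeriv ℝ (n - i) φ x‖ := by gcongr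
    _ = _ := by
        rw [Finset.mul_sum]
        exact Finset.sum_congr rfl fun i _ => by ring

theorem sum_choose_mul (n : ℕ) (c : ℝ) :
    ∑ i ∈ Finset.range (n + 1), (n.choose i : ℝ) * c = 2 ^ n * c := by
  rw [← Finset.sum_mul]
  congr 1
  exact_mod_cast Nat.sum_range_choose n

theorem SchwartzMap.exists_seminorm_le_geometric {g : E → ℂ} (hg : ContDiff ℝ (⊤ : ℕ∞) g)
    (hB : ∀ i : ℕ, ∃ B : ℝ, ∀ x, ‖iteratedFDeriv ℝ i g x‖ ≤ B) {φ : ℕ → 𝓢(E, ℂ)}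
    (h : ∀ M x, φ (M + 1) x = g x * φ M x) (k n : ℕ) :
    ∃ A K : ℝ, 0 ≤ A ∧ 0 ≤ K ∧ ∀ M, SchwartzMap.seminorm ℂ k n (φ M) ≤ A * K ^ M := by
  choose B hB using hB
  have hB0 : ∀ i, 0 ≤ B i := fun i => (norm_nonneg _).trans (hB i 0)
  set b := ∑ i ∈ Finset.range (n + 1), B i with hb
  have hb0 : 0 ≤ b := Finset.sum_nonneg fun i _ => hB0 i
  set A := ∑ j ∈ Finset.range (n + 1), SchwartzMap.seminorm ℂ k j (φ 0) with hA
  have hA0 : 0 ≤ A := Finset.sum_nonneg fun i _ => apply_nonneg _ _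
  refine ⟨A, 2 ^ n * b, hA0, by positivity, fun M => ?_⟩
  suffices H : ∀ j ≤ n, SchwartzMap.seminorm ℂ k j (φ M) ≤ A * (2 ^ n * b) ^ M from H n le_rfl
  induction M with
  | zero =>
    intro j hj
    rw [pow_zero, mul_one]
    exact Finset.single_le_sum (f := fun j => SchwartzMap.seminorm ℂ k j (φ 0))
      (fun i _ => apply_nonneg _ _) (Finset.mem_range.2 (Nat.lt_succ_of_le hj))
  | succ M ih =>
    intro j hj
    refine SchwartzMap.seminorm_le_bound ℂ k j _ (by positivity) fun x => ?_
    refine (SchwartzMap.pow_mul_norm_iteratedFDeriv_le hg (h M) k j x).trans ?_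
    calc _ ≤ ∑ i ∈ Finset.range (j + 1), (j.choose i : ℝ) * (b * (A * (2 ^ n * b) ^ M)) := by
          refine Finset.sum_le_sum fun i hi => ?_
          have hij : i ≤ j := Nat.lt_succ_iff.1 (Finset.mem_range.1 hi)
          rw [mul_assoc]
          refine mul_le_mul_of_nonneg_left ?_ (by positivity)
          refine mul_le_mul ?_ ?_ (by positivity) hb0
          · exact (hB i x).trans (Finset.single_le_sum (fun i _ => hB0 i)
              (Finset.mem_range.2 (by omega)))
          · exact (SchwartzMap.le_seminorm ℂ k (j - i) (φ M) x).trans (ih _ (by omega))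
      _ = 2 ^ j * (b * (A * (2 ^ n * b) ^ M)) := sum_choose_mul _ _
      _ ≤ 2 ^ n * (b * (A * (2 ^ n * b) ^ M)) := by
          have : (2 : ℝ) ^ j ≤ 2 ^ n := pow_le_pow_right₀ (by norm_num) hj
          gcongr
      _ = _ := by ring

theorem SchwartzMap.exists_sup_seminorm_le_geometric {g : E → ℂ} (hg : ContDiff ℝ (⊤ : ℕ∞) g)
    (hB : ∀ i : ℕ, ∃ B : ℝ, ∀ x, ‖iteratedFDeriv ℝ i g x‖ ≤ B) {φ : ℕ → 𝓢(E, ℂ)}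
    (h : ∀ M x, φ (M + 1) x = g x * φ M x) (s : Finset (ℕ × ℕ)) :
    ∃ A K : ℝ, 0 ≤ A ∧ 0 ≤ K ∧
      ∀ M, (s.sup (schwartzSeminormFamily ℂ E ℂ)) (φ M) ≤ A * K ^ M := by
  choose A K hA hK hAK using SchwartzMap.exists_seminorm_le_geometric hg hB h
  refine ⟨∑ i ∈ s, A i.1 i.2, ∑ i ∈ s, K i.1 i.2, Finset.sum_nonneg fun i _ => hA _ _,
    Finset.sum_nonneg fun i _ => hK _ _, fun M => ?_⟩
  have hA0 : 0 ≤ ∑ i ∈ s, A i.1 i.2 := Finset.sum_nonneg fun i _ => hA _ _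
  have hK0 : 0 ≤ ∑ i ∈ s, K i.1 i.2 := Finset.sum_nonneg fun i _ => hK _ _
  refine Seminorm.finset_sup_apply_le (by positivity) fun i hi => ?_
  refine (hAK i.1 i.2 M).trans (mul_le_mul ?_ (pow_le_pow_left₀ (hK _ _) ?_ M)
    (pow_nonneg (hK _ _) _) hA0)
  · exact Finset.single_le_sum (f := fun i : ℕ × ℕ => A i.1 i.2) (fun i _ => hA _ _) hi
  · exact Finset.single_le_sum (f := fun i : ℕ × ℕ => K i.1 i.2) (fun i _ => hK _ _) hi

theorem exists_norm_iteratedFDeriv_le {g : E → ℂ} (hs : HasCompactSupport g)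
    (hg : ContDiff ℝ (⊤ : ℕ∞) g) (i : ℕ) : ∃ B : ℝ, ∀ x, ‖iteratedFDeriv ℝ i g x‖ ≤ B := by
  refine (HasCompactSupport.iteratedFDeriv (𝕜 := ℝ) hs i).exists_bound_of_continuous ?_
  exact hg.continuous_iteratedFDeriv (by exact_mod_cast le_top)

end Leibniz

/-- A Schwartz function is the limit of compactly supported ones, dominated by it. -/
theorem SchwartzMap.exists_hasCompactSupport_tendsto {n : ℕ} (φ : 𝓢(Rn n, ℂ)) :
    ∃ Φ : ℕ → 𝓢(Rn n, ℂ), (∀ N, HasCompactSupport (Φ N)) ∧ (∀ N x, ‖Φ N x‖ ≤ ‖φ x‖) ∧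
      Tendsto Φ atTop (nhds φ) := by
  set χ : ContDiffBump (0 : Rn n) := ⟨1, 2, one_pos, by norm_num⟩ with hχ
  set c : ℕ → ℝ := fun N => ((N : ℝ) + 1)⁻¹ with hc
  have hc0 : ∀ N, 0 < c N := fun N => by positivity
  have hc1 : ∀ N, c N ≤ 1 := fun N => inv_le_one_of_one_le₀ (by
    have : (0 : ℝ) ≤ N := Nat.cast_nonneg N
    linarith)
  set g : Rn n → ℂ := fun x => ((χ x : ℝ) : ℂ) with hg
  have hgs : ContDiff ℝ (⊤ : ℕ∞) g := Complex.ofRealCLM.contDiff.comp χ.contDiff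
  have hgc : HasCompactSupport g := χ.hasCompactSupport.comp_left Complex.ofReal_zero
  set G : ℕ → Rn n → ℂ := fun N x => g (c N • x) with hG
  have hGs : ∀ N, ContDiff ℝ (⊤ : ℕ∞) (G N) := fun N => hgs.comp (contDiff_const_smul (c N))
  have hGc : ∀ N, HasCompactSupport (G N) := fun N =>
    hgc.comp_homeomorph (Homeomorph.smulOfNeZero (c N) (hc0 N).ne')
  have hΦc : ∀ N, HasCompactSupport (fun x => G N x * φ x) := fun N => (hGc N).mul_right
  set Φ : ℕ → 𝓢(Rn n, ℂ) := fun N => (hΦc N).toSchwartzMap ((hGs N).mul (φ.smooth ⊤)) with hΦ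
  have hΦa : ∀ N x, Φ N x = G N x * φ x := fun N x => rfl
  refine ⟨Φ, fun N => hΦc N, fun N x => ?_, ?_⟩
  · rw [hΦa, norm_mul]
    refine mul_le_of_le_one_left (norm_nonneg _) ?_
    rw [Complex.norm_real, Real.norm_of_nonneg χ.nonneg]
    exact χ.le_one
  refine SchwartzMap.tendsto_iff_seminorm.2 fun k m ε hε => ?_
  choose B hB using exists_norm_iteratedFDeriv_le hgc hgs
  have hB0 : ∀ i, 0 ≤ B i := fun i => (norm_nonneg _).trans (hB i 0)
  set b := 1 + ∑ i ∈ Finset.range (m + 1), B i with hb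
  have hb0 : 0 ≤ b := add_nonneg zero_le_one (Finset.sum_nonneg fun i _ => hB0 i)
  set A := ∑ j ∈ Finset.range (m + 1), SchwartzMap.seminorm ℝ (k + 1) j φ with hA
  have hA0 : 0 ≤ A := Finset.sum_nonneg fun i _ => apply_nonneg _ _
  have hDG : ∀ N i x, i ≤ m → ‖iteratedFDeriv ℝ i (fun x => G N x - 1) x‖ ≤ b := by
    intro N i x hi
    have h1 : ‖iteratedFDeriv ℝ i (G N) x‖ ≤ B i := by
      have h0 := iteratedFDeriv_comp_const_smul (𝕜 := ℝ) (i := i) (c N)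
        (hgs.of_le (by exact_mod_cast le_top))
      have h0' : iteratedFDeriv ℝ i (G N) x = c N ^ i • iteratedFDeriv ℝ i g (c N • x) :=
        congrFun h0 x
      rw [h0', norm_smul, Real.norm_of_nonneg (pow_nonneg (hc0 N).le _)]
      exact (mul_le_of_le_one_left (norm_nonneg _) (pow_le_one₀ (hc0 N).le (hc1 N))).trans (hB i _)
    have h2 : ‖iteratedFDeriv ℝ i (fun _ : Rn n => (1 : ℂ)) x‖ ≤ 1 := by
      rcases Nat.eq_zero_or_pos i with rfl | hi0
      · simp
      · rw [iteratedFDeriv_const_of_ne hi0.ne']; simp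
    have h3 : iteratedFDeriv ℝ i (fun x => G N x - 1) x =
        iteratedFDeriv ℝ i (G N) x - iteratedFDeriv ℝ i (fun _ : Rn n => (1 : ℂ)) x :=
      _root_.iteratedFDeriv_sub_apply ((hGs N).contDiffAt.of_le (by exact_mod_cast le_top))
        contDiffAt_const
    rw [h3]
    refine (norm_sub_le _ _).trans ?_
    have h4 : B i ≤ ∑ i ∈ Finset.range (m + 1), B i :=
      Finset.single_le_sum (fun i _ => hB0 i) (Finset.mem_range.2 (by omega))
    linarith
  have hzero : ∀ (N : ℕ) (x : Rn n), ‖x‖ < (N : ℝ) + 1 → iteratedFDeriv ℝ m (Φ N - φ) x = 0 := by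
    intro N x hx
    have h1 : ((Φ N - φ : 𝓢(Rn n, ℂ)) : Rn n → ℂ) =ᶠ[nhds x] fun _ => 0 := by
      filter_upwards [(isOpen_lt continuous_norm continuous_const).mem_nhds hx] with y hy
      have h2 : χ (c N • y) = 1 := by
        refine χ.one_of_mem_closedBall ?_
        rw [mem_closedBall_zero_iff, norm_smul, Real.norm_of_nonneg (hc0 N).le]
        have : c N * ‖y‖ ≤ c N * ((N : ℝ) + 1) := by gcongr
        exact this.trans (inv_mul_cancel₀ (by positivity)).le
      rw [_root_.sub_apply, hΦa]
      simp only [hG, hg, h2]; simp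
    have h3 := (h1.iteratedFDeriv ℝ m).eq_of_nhds
    rw [h3]
    simp
  obtain ⟨N₀, hN₀⟩ := exists_nat_gt (2 ^ m * (b * A) / ε)
  filter_upwards [eventually_ge_atTop N₀] with N hN
  have hN' : (0 : ℝ) < (N : ℝ) + 1 := by positivity
  refine lt_of_le_of_lt (SchwartzMap.seminorm_le_bound ℝ k m _ (M := 2 ^ m * (b * A) / ((N : ℝ) + 1))
    (by positivity) fun x => ?_) ?_
  · rcases lt_or_ge ‖x‖ ((N : ℝ) + 1) with hx | hx
    · rw [hzero N x hx]; simp; positivity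
    · refine (SchwartzMap.pow_mul_norm_iteratedFDeriv_le (g := fun x => G N x - 1)
        ((hGs N).sub contDiff_const) (φ := φ) (fun x => ?_) k m x).trans ?_
      · rw [_root_.sub_apply, hΦa]; ring
      have hx0 : 0 < ‖x‖ := hN'.trans_le hx
      calc _ ≤ ∑ i ∈ Finset.range (m + 1), (m.choose i : ℝ) * (b * A / ((N : ℝ) + 1)) := by
            refine Finset.sum_le_sum fun i hi => ?_
            have him : i ≤ m := Nat.lt_succ_iff.1 (Finset.mem_range.1 hi)
            rw [mul_assoc, mul_div_assoc]
            refine mul_le_mul_of_nonneg_left ?_ (by positivity)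
            refine mul_le_mul (hDG N i x him) ?_ (by positivity) hb0
            rw [le_div_iff₀ hN']
            calc _ ≤ ‖x‖ ^ k * ‖iteratedFDeriv ℝ (m - i) φ x‖ * ‖x‖ := by gcongr
              _ = ‖x‖ ^ (k + 1) * ‖iteratedFDeriv ℝ (m - i) φ x‖ := by ring
              _ ≤ _ := SchwartzMap.le_seminorm ℝ (k + 1) (m - i) φ x
              _ ≤ A := Finset.single_le_sum (f := fun j => SchwartzMap.seminorm ℝ (k + 1) j φ)
                  (fun i _ => apply_nonneg _ _) (Finset.mem_range.2 (by omega))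
        _ = 2 ^ m * (b * A / ((N : ℝ) + 1)) := sum_choose_mul _ _
        _ = _ := by ring
  · rw [div_lt_iff₀ hN']
    rw [div_lt_iff₀ hε] at hN₀
    have : (N₀ : ℝ) ≤ N := by exact_mod_cast hN
    nlinarith

/-! ### Taylor expansion for a second order system in integrated form -/

/-- The kernel `τ ^ j / j!` of iterated integration. -/
def taylorKernel (j : ℕ) (τ : ℝ) : ℂ := ((τ ^ j / (Nat.factorial j : ℝ) : ℝ) : ℂ)

@[fun_prop]
theorem continuous_taylorKernel (j : ℕ) : Continuous (taylorKernel j) := by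
  unfold taylorKernel; fun_prop

theorem integral_taylorKernel (j : ℕ) (r t : ℝ) :
    ∫ s in r..t, taylorKernel j (t - s) = taylorKernel (j + 1) (t - r) := by
  unfold taylorKernel
  rw [intervalIntegral.integral_ofReal, intervalIntegral.integral_comp_sub_left
    (fun x => x ^ j / (Nat.factorial j : ℝ)), intervalIntegral.integral_div, integral_pow]
  have h1 : (Nat.factorial j : ℝ) ≠ 0 := by positivity
  have h2 : ((j : ℝ) + 1) ≠ 0 := by positivity
  rw [Nat.factorial_succ]
  push_cast
  simp only [sub_self, ne_eq, Nat.add_eq_zero_iff, one_ne_zero, and_false, not_false_eq_true, zero_pow,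
    sub_zero]
  field_simp

theorem integral_mul_primitive {t : ℝ} (ht : 0 ≤ t) {a w : ℝ → ℂ} (ha : Continuous a)
    (hw : IntervalIntegrable w volume 0 t) :
    ∫ s in (0 : ℝ)..t, a s * ∫ r in (0 : ℝ)..s, w r =
      ∫ r in (0 : ℝ)..t, (∫ s in r..t, a s) * w r := by
  have hw' : IntegrableOn w (Ioc 0 t) := (intervalIntegrable_iff_integrableOn_Ioc_of_le ht).1 hw
  obtain ⟨B, hB⟩ := (isCompact_Icc (a := (0 : ℝ)) (b := t)).exists_bound_of_continuousOn
    ha.continuousOn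
  have ha' : IntegrableOn a (Ioc 0 t) := ha.continuousOn.integrableOn_Icc.mono_set Ioc_subset_Icc_self
  set k : ℝ → ℝ → ℂ := fun s r => {z : ℝ × ℝ | z.2 ≤ z.1}.indicator (fun z => a z.1 * w z.2) (s, r)
    with hk
  have hms : MeasurableSet {z : ℝ × ℝ | z.2 ≤ z.1} := measurableSet_le measurable_snd measurable_fst
  have hint : Integrable (Function.uncurry k)
      ((volume.restrict (Ioc 0 t)).prod (volume.restrict (Ioc 0 t))) :=
    (ha'.mul_prod hw').indicator hms
  rw [intervalIntegral.integral_of_le ht, intervalIntegral.integral_of_le ht]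
  calc _ = ∫ s in Ioc 0 t, ∫ r in Ioc 0 t, k s r := by
        refine setIntegral_congr_fun measurableSet_Ioc fun s hs => ?_
        rw [intervalIntegral.integral_of_le hs.1.le, ← integral_const_mul]
        rw [← integral_indicator measurableSet_Ioc, ← integral_indicator measurableSet_Ioc]
        congr 1; ext r
        simp only [hk, indicator, mem_Ioc, mem_ofPred_eq]
        by_cases h1 : 0 < r <;> by_cases h2 : r ≤ s <;> by_cases h3 : r ≤ t <;> simp [h1, h2, h3]
        exact absurd (h2.trans hs.2) h3
    _ = ∫ r in Ioc 0 t, ∫ s in Ioc 0 t, k s r := integral_integral_swap hint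
    _ = _ := by
        refine setIntegral_congr_fun measurableSet_Ioc fun r hr => ?_
        rw [intervalIntegral.integral_of_le hr.2, ← integral_mul_const,
          ← integral_Icc_eq_integral_Ioc (x := r) (y := t)]
        rw [← integral_indicator measurableSet_Icc, ← integral_indicator measurableSet_Ioc]
        congr 1; ext s
        simp only [hk, indicator, mem_Ioc, mem_Icc, mem_ofPred_eq]
        by_cases h1 : 0 < s <;> by_cases h2 : r ≤ s <;> by_cases h3 : s ≤ t <;> simp [h1, h2, h3]
        exact absurd (hr.1.trans_le h2) h1

theorem integral_taylorKernel_mul {t : ℝ} (ht : 0 ≤ t) {c : ℂ} {h w : ℝ → ℂ}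
    (hw : IntervalIntegrable w volume 0 t) (hh : ∀ s ∈ Icc 0 t, h s = c + ∫ r in (0 : ℝ)..s, w r)
    (j : ℕ) :
    ∫ s in (0 : ℝ)..t, taylorKernel j (t - s) * h s =
      taylorKernel (j + 1) t * c + ∫ s in (0 : ℝ)..t, taylorKernel (j + 1) (t - s) * w s := by
  have hcont : Continuous (fun s => taylorKernel j (t - s)) := by fun_prop
  have hpc : ContinuousOn (fun s => ∫ r in (0 : ℝ)..s, w r) (uIcc 0 t) :=
    intervalIntegral.continuousOn_primitive_interval (by
      rw [uIcc_of_le ht]; exact (intervalIntegrable_iff_integrableOn_Icc_of_le ht).1 hw)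
  calc _ = ∫ s in (0 : ℝ)..t, (taylorKernel j (t - s) * c + taylorKernel j (t - s) *
        ∫ r in (0 : ℝ)..s, w r) := by
        refine intervalIntegral.integral_congr fun s hs => ?_
        rw [uIcc_of_le ht] at hs
        simp only [hh s hs, mul_add]
    _ = (∫ s in (0 : ℝ)..t, taylorKernel j (t - s)) * c + ∫ s in (0 : ℝ)..t, taylorKernel j (t - s) *
        ∫ r in (0 : ℝ)..s, w r := by
        rw [intervalIntegral.integral_add, intervalIntegral.integral_mul_const]
        · exact (hcont.mul continuous_const).intervalIntegrable _ _
        · exact (hcont.continuousOn.mul hpc).intervalIntegrable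
    _ = _ := by
        rw [integral_mul_primitive ht hcont hw, integral_taylorKernel, sub_zero]
        simp only [integral_taylorKernel]

theorem taylor_wave_system {t : ℝ} (ht : 0 ≤ t) {a b : ℕ → ℂ} {u v F : ℕ → ℝ → ℂ}
    (hu : ∀ M, IntervalIntegrable (u M) volume 0 t) (hv : ∀ M, IntervalIntegrable (v M) volume 0 t)
    (hF : ∀ M, IntervalIntegrable (F M) volume 0 t)
    (hu' : ∀ M, ∀ s ∈ Icc 0 t, u M s = a M + ∫ r in (0 : ℝ)..s, v M r)
    (hv' : ∀ M, ∀ s ∈ Icc 0 t, v M s = b M + ∫ r in (0 : ℝ)..s, (F M r - u (M + 1) r)) (N : ℕ) :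
    u 0 t = ∑ M ∈ Finset.range N, (-1) ^ M * (taylorKernel (2 * M) t * a M +
        taylorKernel (2 * M + 1) t * b M + ∫ s in (0 : ℝ)..t, taylorKernel (2 * M + 1) (t - s) * F M s) +
      (-1) ^ N * (taylorKernel (2 * N) t * a N + ∫ s in (0 : ℝ)..t, taylorKernel (2 * N) (t - s) * v N s)
    := by
  induction N with
  | zero =>
    rw [Finset.sum_range_zero, hu' 0 t ⟨ht, le_rfl⟩]
    simp [taylorKernel]
  | succ N ih =>
    have hk : Continuous (fun s => taylorKernel (2 * N + 1) (t - s)) := by fun_prop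
    rw [Finset.sum_range_succ, ih, integral_taylorKernel_mul ht ((hF N).sub (hu (N + 1))) (hv' N)]
    have h1 : ∫ s in (0 : ℝ)..t, taylorKernel (2 * N + 1) (t - s) * (F N s - u (N + 1) s) =
        (∫ s in (0 : ℝ)..t, taylorKernel (2 * N + 1) (t - s) * F N s) -
          ∫ s in (0 : ℝ)..t, taylorKernel (2 * N + 1) (t - s) * u (N + 1) s := by
      rw [← intervalIntegral.integral_sub ((hF N).continuousOn_mul hk.continuousOn)
        ((hu (N + 1)).continuousOn_mul hk.continuousOn)]
      simp only [mul_sub]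
    rw [h1, integral_taylorKernel_mul ht (hv (N + 1)) (hu' (N + 1)),
      show 2 * (N + 1) = 2 * N + 1 + 1 by ring]
    ring

theorem tendsto_taylor_wave_system {t : ℝ} (ht : 0 ≤ t) {a b : ℕ → ℂ} {u v F : ℕ → ℝ → ℂ}
    (hu : ∀ M, IntervalIntegrable (u M) volume 0 t) (hv : ∀ M, IntervalIntegrable (v M) volume 0 t)
    (hF : ∀ M, IntervalIntegrable (F M) volume 0 t)
    (hu' : ∀ M, ∀ s ∈ Icc 0 t, u M s = a M + ∫ r in (0 : ℝ)..s, v M r)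
    (hv' : ∀ M, ∀ s ∈ Icc 0 t, v M s = b M + ∫ r in (0 : ℝ)..s, (F M r - u (M + 1) r))
    {A K : ℝ} (hK : 0 ≤ K) (ha : ∀ M, ‖a M‖ ≤ A * K ^ M)
    (hvb : ∀ M, ∀ s ∈ Icc 0 t, ‖v M s‖ ≤ A * K ^ M) :
    Tendsto (fun N => ∑ M ∈ Finset.range N, (-1) ^ M * (taylorKernel (2 * M) t * a M +
        taylorKernel (2 * M + 1) t * b M +
        ∫ s in (0 : ℝ)..t, taylorKernel (2 * M + 1) (t - s) * F M s)) atTop (nhds (u 0 t)) := by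
  have hkn : ∀ j, ∀ s ∈ Icc 0 t, ‖taylorKernel j (t - s)‖ ≤ t ^ j / (Nat.factorial j : ℝ) := by
    intro j s hs
    have h1 : 0 ≤ t - s := by linarith [hs.2]
    rw [taylorKernel, Complex.norm_real, Real.norm_of_nonneg (by positivity)]
    have h2 : t - s ≤ t := by linarith [hs.1]
    gcongr
  have hA : 0 ≤ A := by
    have := (norm_nonneg _).trans (ha 0)
    simpa using this
  rw [tendsto_iff_norm_sub_tendsto_zero]
  have hlim : Tendsto (fun N : ℕ => (A + A * t) * (((t * (K + 1)) ^ (2 * N)) / (Nat.factorial (2 * N) : ℝ)))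
      atTop (nhds 0) := by
    have h0 := FloorSemiring.tendsto_pow_div_factorial_atTop (t * (K + 1))
    have h2 : Tendsto (fun N : ℕ => 2 * N) atTop atTop :=
      tendsto_id.const_mul_atTop' (by norm_num)
    simpa using (h0.comp h2).const_mul (A + A * t)
  refine squeeze_zero (fun _ => norm_nonneg _) (fun N => ?_) hlim
  rw [norm_sub_rev, taylor_wave_system ht hu hv hF hu' hv' N, add_sub_cancel_left, norm_mul, norm_pow,
    norm_neg, norm_one, one_pow, one_mul]
  have hKK : K ^ N ≤ (K + 1) ^ (2 * N) := by
    rw [pow_mul]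
    exact pow_le_pow_left₀ hK (by nlinarith) N
  have hint : ‖∫ s in (0 : ℝ)..t, taylorKernel (2 * N) (t - s) * v N s‖ ≤
      t ^ (2 * N) / (Nat.factorial (2 * N) : ℝ) * (A * K ^ N) * |t - 0| := by
    refine intervalIntegral.norm_integral_le_of_norm_le_const fun s hs => ?_
    rw [uIoc_of_le ht] at hs
    rw [norm_mul]
    exact mul_le_mul (hkn _ s ⟨hs.1.le, hs.2⟩) (hvb N s ⟨hs.1.le, hs.2⟩) (norm_nonneg _) (by positivity)
  have h0 := hkn (2 * N) 0 ⟨le_rfl, ht⟩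
  rw [sub_zero] at h0
  rw [sub_zero, abs_of_nonneg ht] at hint
  calc _ ≤ ‖taylorKernel (2 * N) t‖ * ‖a N‖ +
        t ^ (2 * N) / (Nat.factorial (2 * N) : ℝ) * (A * K ^ N) * t := by
        rw [← norm_mul]; exact (norm_add_le _ _).trans (add_le_add le_rfl hint)
    _ ≤ t ^ (2 * N) / (Nat.factorial (2 * N) : ℝ) * (A * K ^ N) +
        t ^ (2 * N) / (Nat.factorial (2 * N) : ℝ) * (A * K ^ N) * t := by
        gcongr; exact ha N
    _ = (A + A * t) * (t ^ (2 * N) * K ^ N / (Nat.factorial (2 * N) : ℝ)) := by ring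
    _ ≤ _ := by
        rw [mul_pow]; gcongr

/-! ### Truncated cosine and sine series -/

/-- `sin(τ y) / y`, extended continuously to `y = 0`. -/
def sineKernel (τ y : ℝ) : ℝ := τ * Real.sinc (τ * y)

/-- The Taylor polynomial of `cos (τ y)` as a function of `y`. -/
def cosPoly (N : ℕ) (τ y : ℝ) : ℝ :=
  ∑ M ∈ Finset.range N, (-1) ^ M * (τ ^ (2 * M) / (Nat.factorial (2 * M) : ℝ) * y ^ (2 * M))

/-- The Taylor polynomial of `sin (τ y) / y` as a function of `y`. -/
def sinePoly (N : ℕ) (τ y : ℝ) : ℝ :=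
  ∑ M ∈ Finset.range N, (-1) ^ M * (τ ^ (2 * M + 1) / (Nat.factorial (2 * M + 1) : ℝ) * y ^ (2 * M))

theorem continuous_sineKernel : Continuous (fun z : ℝ × ℝ => sineKernel z.1 z.2) := by
  unfold sineKernel
  exact continuous_fst.mul (Real.continuous_sinc.comp (continuous_fst.mul continuous_snd))

theorem abs_sineKernel_le (τ y : ℝ) : |sineKernel τ y| ≤ |τ| := by
  rw [sineKernel, abs_mul]
  exact mul_le_of_le_one_right (abs_nonneg _) (Real.abs_sinc_le_one _)

theorem sineKernel_of_ne_zero (τ : ℝ) {y : ℝ} (hy : y ≠ 0) : sineKernel τ y = Real.sin (τ * y) / y := by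
  rcases eq_or_ne τ 0 with rfl | hτ
  · simp [sineKernel]
  · rw [sineKernel, Real.sinc_of_ne_zero (mul_ne_zero hτ hy)]
    field_simp

theorem hasSum_sineKernel (τ y : ℝ) : HasSum (fun M : ℕ => (-1) ^ M *
    (τ ^ (2 * M + 1) / (Nat.factorial (2 * M + 1) : ℝ) * y ^ (2 * M))) (sineKernel τ y) := by
  rcases eq_or_ne y 0 with rfl | hy
  · have h1 : sineKernel τ 0 = τ := by simp [sineKernel]
    rw [h1]
    convert hasSum_single (0 : ℕ) (fun M hM => ?_) using 1
    · simp
    · simp [hM]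
  · rw [sineKernel_of_ne_zero τ hy]
    have h := (Real.hasSum_sin (τ * y)).div_const y
    have h1 : (fun M : ℕ => (-1) ^ M * (τ ^ (2 * M + 1) / (Nat.factorial (2 * M + 1) : ℝ) *
        y ^ (2 * M))) = fun M : ℕ =>
        (-1) ^ M * (τ * y) ^ (2 * M + 1) / (Nat.factorial (2 * M + 1) : ℝ) / y := by
      funext M
      rw [mul_pow, pow_succ y]
      field_simp
    rwa [h1]

theorem hasSum_cos_mul (τ y : ℝ) : HasSum (fun M : ℕ => (-1) ^ M *
    (τ ^ (2 * M) / (Nat.factorial (2 * M) : ℝ) * y ^ (2 * M))) (Real.cos (τ * y)) := by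
  convert Real.hasSum_cos (τ * y) using 2 with M
  rw [mul_pow]; ring

/-- The tail of the series of `cosh X`. -/
def coshTail (X : ℝ) (N : ℕ) : ℝ := ∑' M : ℕ, X ^ (2 * (M + N)) / (Nat.factorial (2 * (M + N)) : ℝ)

theorem summable_cosh (X : ℝ) : Summable (fun M : ℕ => X ^ (2 * M) / (Nat.factorial (2 * M) : ℝ)) :=
  (Real.hasSum_cosh X).summable

theorem tendsto_coshTail (X : ℝ) : Tendsto (coshTail X) atTop (nhds 0) :=
  tendsto_sum_nat_add (fun M : ℕ => X ^ (2 * M) / (Nat.factorial (2 * M) : ℝ))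

theorem coshTail_nonneg (X : ℝ) (N : ℕ) : 0 ≤ coshTail X N :=
  tsum_nonneg fun M => by
    rw [pow_mul]; positivity

theorem abs_sum_range_sub_le {f g : ℕ → ℝ} {a : ℝ} (hf : HasSum f a) (hg : Summable g)
    (hfg : ∀ M, |f M| ≤ g M) (N : ℕ) : |∑ M ∈ Finset.range N, f M - a| ≤ ∑' M, g (M + N) := by
  have h1 := hf.summable.sum_add_tsum_nat_add N
  rw [hf.tsum_eq] at h1
  rw [← h1, sub_add_cancel_left, abs_neg, ← Real.norm_eq_abs]
  exact tsum_of_norm_bounded ((summable_nat_add_iff N).2 hg).hasSum fun M => hfg (M + N)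

theorem abs_cosPoly_sub_le (N : ℕ) {τ y X : ℝ} (h : |τ * y| ≤ X) :
    |cosPoly N τ y - Real.cos (τ * y)| ≤ coshTail X N := by
  refine abs_sum_range_sub_le (hasSum_cos_mul τ y) (summable_cosh X) (fun M => ?_) N
  rw [abs_mul, abs_pow, abs_neg, abs_one, one_pow, one_mul, div_mul_eq_mul_div, ← mul_pow, abs_div,
    abs_pow, abs_of_pos (a := (Nat.factorial (2 * M) : ℝ)) (by positivity)]
  gcongr

theorem abs_sinePoly_sub_le (N : ℕ) {τ y X : ℝ} (h : |τ * y| ≤ X) :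
    |sinePoly N τ y - sineKernel τ y| ≤ |τ| * coshTail X N := by
  rw [coshTail, ← tsum_mul_left]
  refine abs_sum_range_sub_le (g := fun M => |τ| * (X ^ (2 * M) / (Nat.factorial (2 * M) : ℝ)))
    (hasSum_sineKernel τ y) ((summable_cosh X).mul_left _) (fun M => ?_) N
  have h1 : |(-1 : ℝ) ^ M * (τ ^ (2 * M + 1) / (Nat.factorial (2 * M + 1) : ℝ) * y ^ (2 * M))| =
      |τ| * (|τ * y| ^ (2 * M) / (Nat.factorial (2 * M + 1) : ℝ)) := by
    rw [abs_mul, abs_pow, abs_neg, abs_one, one_pow, one_mul, abs_mul, abs_div, abs_pow, abs_pow,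
      abs_mul, abs_of_pos (a := (Nat.factorial (2 * M + 1) : ℝ)) (by positivity)]
    ring
  rw [h1]
  have h2 : (Nat.factorial (2 * M) : ℝ) ≤ Nat.factorial (2 * M + 1) := by
    exact_mod_cast Nat.factorial_le (Nat.le_succ _)
  have hX : 0 ≤ X := (abs_nonneg _).trans h
  gcongr

/-! ### The Laplacian on the Fourier side -/

/-- Multiplication by `|2πξ|²` on Schwartz functions. -/
def freqMul {n : ℕ} : 𝓢(Rn n, ℂ) →L[ℂ] 𝓢(Rn n, ℂ) :=
  SchwartzMap.smulLeftCLM ℂ (fun ξ : Rn n => (2 * Real.pi : ℂ) ^ 2 * ((‖ξ‖ ^ 2 : ℝ) : ℂ))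

theorem freqMul_apply {n : ℕ} (φ : 𝓢(Rn n, ℂ)) (ξ : Rn n) :
    freqMul φ ξ = (((2 * Real.pi * ‖ξ‖) ^ 2 : ℝ) : ℂ) * φ ξ := by
  have h : (fun ξ : Rn n => (2 * Real.pi : ℂ) ^ 2 * ((‖ξ‖ ^ 2 : ℝ) : ℂ)).HasTemperateGrowth := by
    fun_prop
  rw [freqMul, SchwartzMap.smulLeftCLM_apply_apply h, smul_eq_mul]
  push_cast; ring

theorem iterate_freqMul_apply {n : ℕ} (φ : 𝓢(Rn n, ℂ)) (M : ℕ) (ξ : Rn n) :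
    (freqMul^[M] φ) ξ = (((2 * Real.pi * ‖ξ‖) ^ (2 * M) : ℝ) : ℂ) * φ ξ := by
  induction M with
  | zero => simp
  | succ M ih =>
    rw [Function.iterate_succ_apply', freqMul_apply, ih, ← mul_assoc, ← Complex.ofReal_mul, ← pow_add]
    congr 3; ring

theorem laplacian_fourier {n : ℕ} (φ : 𝓢(Rn n, ℂ)) : Δ (𝓕 φ) = -𝓕 (freqMul φ) := by
  set b := EuclideanSpace.basisFun (Fin n) ℝ with hb
  have hg : ∀ m : Rn n, (fun x : Rn n => inner ℝ x m).HasTemperateGrowth := by fun_prop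
  rw [SchwartzMap.laplacian_eq_sum b, ← FourierTransform.fourier_neg]
  simp_rw [SchwartzMap.lineDerivOp_fourier_eq]
  rw [← FourierTransform.fourier_sum]
  congr 1
  ext ξ
  rw [_root_.sum_apply, _root_.neg_apply, freqMul_apply]
  have h1 : ∀ i, (-(2 * (Real.pi : ℂ) * Complex.I) • SchwartzMap.smulLeftCLM ℂ (fun x : Rn n => inner ℝ x (b i))
      (-(2 * (Real.pi : ℂ) * Complex.I) • SchwartzMap.smulLeftCLM ℂ (fun x : Rn n => inner ℝ x (b i)) φ)) ξ =
      (((inner ℝ ξ (b i)) ^ 2 : ℝ) : ℂ) * (-((2 * (Real.pi : ℂ)) ^ 2) * φ ξ) := by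
    intro i
    rw [_root_.smul_apply, SchwartzMap.smulLeftCLM_apply_apply (hg _), _root_.smul_apply,
      SchwartzMap.smulLeftCLM_apply_apply (hg _)]
    simp only [smul_eq_mul, Complex.real_smul]
    push_cast
    ring_nf
    rw [Complex.I_sq]; ring
  rw [Finset.sum_congr rfl fun i _ => h1 i, ← Finset.sum_mul, ← Complex.ofReal_sum,
    b.sum_sq_inner_left]
  push_cast; ring

/-! ### Consequences of the equation tested against Schwartz functions -/

/-- The equation satisfied by the families `U = u(t, ·)` and `V = ∂ₜu(t, ·)`. -/
def IsWavePair {n : ℕ} (U V : ℝ → 𝓢'(Rn n, ℂ)) (F : ℝ → Rn n → ℂ) : Prop :=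
  ∀ ψ : 𝓢(Rn n, ℂ),
    ((∀ᵐ t ∂(volume.restrict (Ioi (0 : ℝ))), Integrable (fun x => ψ x * F t x)) ∧
    ∀ t : ℝ, 0 ≤ t → IntervalIntegrable (fun s => ∫ x, ψ x * F s x) volume 0 t) ∧
    ∀ t : ℝ, 0 ≤ t → HasDerivWithinAt (fun s => U s ψ) (V t ψ) (Ici 0) t ∧
      V t ψ = V 0 ψ + ∫ s in (0 : ℝ)..t, ((Δ (U s)) ψ + ∫ x, ψ x * F s x)

namespace IsWavePair

variable {n : ℕ} {U V : ℝ → 𝓢'(Rn n, ℂ)} {F : ℝ → Rn n → ℂ}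

theorem continuousOn_fst (h : IsWavePair U V F) (ψ : 𝓢(Rn n, ℂ)) :
    ContinuousOn (fun s => U s ψ) (Ici 0) :=
  fun t ht => ((h ψ).2 t ht).1.continuousWithinAt

theorem intervalIntegrable_fst (h : IsWavePair U V F) (ψ : 𝓢(Rn n, ℂ)) {t : ℝ} (ht : 0 ≤ t) :
    IntervalIntegrable (fun s => U s ψ) volume 0 t :=
  ((h.continuousOn_fst ψ).mono (by rw [uIcc_of_le ht]; exact Icc_subset_Ici_self)).intervalIntegrable

theorem intervalIntegrable_rhs (h : IsWavePair U V F) (ψ : 𝓢(Rn n, ℂ)) {t : ℝ} (ht : 0 ≤ t) :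
    IntervalIntegrable (fun s => (Δ (U s)) ψ + ∫ x, ψ x * F s x) volume 0 t := by
  simp only [TemperedDistribution.laplacian_apply_apply]
  exact (h.intervalIntegrable_fst (Δ ψ) ht).add ((h ψ).1.2 t ht)

theorem continuousOn_snd (h : IsWavePair U V F) (ψ : 𝓢(Rn n, ℂ)) {t : ℝ} (ht : 0 ≤ t) :
    ContinuousOn (fun s => V s ψ) (Icc 0 t) := by
  have h1 : ContinuousOn (fun t => V 0 ψ + ∫ s in (0 : ℝ)..t, ((Δ (U s)) ψ + ∫ x, ψ x * F s x))
      (Icc 0 t) := by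
    refine continuousOn_const.add ?_
    have := intervalIntegral.continuousOn_primitive_interval (a := 0) (b := t) (μ := volume)
      (f := fun s => (Δ (U s)) ψ + ∫ x, ψ x * F s x) (by
        rw [uIcc_of_le ht]
        exact (intervalIntegrable_iff_integrableOn_Icc_of_le ht).1 (h.intervalIntegrable_rhs ψ ht))
    rwa [uIcc_of_le ht] at this
  exact h1.congr fun s hs => ((h ψ).2 s hs.1).2

theorem intervalIntegrable_snd (h : IsWavePair U V F) (ψ : 𝓢(Rn n, ℂ)) {t : ℝ} (ht : 0 ≤ t) :
    IntervalIntegrable (fun s => V s ψ) volume 0 t :=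
  ((h.continuousOn_snd ψ ht).mono (by rw [uIcc_of_le ht])).intervalIntegrable

theorem fst_eq (h : IsWavePair U V F) (ψ : 𝓢(Rn n, ℂ)) {t : ℝ} (ht : 0 ≤ t) :
    U t ψ = U 0 ψ + ∫ s in (0 : ℝ)..t, V s ψ := by
  rw [intervalIntegral.integral_eq_sub_of_hasDerivAt_of_le ht
    ((h.continuousOn_fst ψ).mono Icc_subset_Ici_self) (fun s hs => ?_) (h.intervalIntegrable_snd ψ ht)]
  · ring
  · exact ((h ψ).2 s hs.1.le).1.hasDerivAt (Ici_mem_nhds hs.1)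

theorem snd_fourier_eq (h : IsWavePair U V F) (φ : 𝓢(Rn n, ℂ)) {t : ℝ} (ht : 0 ≤ t) :
    V t (𝓕 φ) = V 0 (𝓕 φ) + ∫ s in (0 : ℝ)..t, ((∫ x, (𝓕 φ) x * F s x) - U s (𝓕 (freqMul φ))) := by
  rw [((h (𝓕 φ)).2 t ht).2]
  congr 2
  ext s
  rw [TemperedDistribution.laplacian_apply_apply, laplacian_fourier, map_neg]
  ring

/-- Uniform geometric bounds for iterated Laplacians on band limited functions. -/
theorem exists_geometric_bound (h : IsWavePair U V F) {φ : 𝓢(Rn n, ℂ)} (hφ : HasCompactSupport φ)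
    {t : ℝ} (ht : 0 ≤ t) : ∃ A K : ℝ, 0 ≤ K ∧ (∀ M, ‖U 0 (𝓕 (freqMul^[M] φ))‖ ≤ A * K ^ M) ∧
      ∀ M, ∀ s ∈ Icc 0 t, ‖V s (𝓕 (freqMul^[M] φ))‖ ≤ A * K ^ M := by
  -- a compactly supported multiplier which agrees with `|2πξ|²` on the support of `φ`
  obtain ⟨R, hR0, hR⟩ : ∃ R : ℝ, 0 < R ∧ ∀ ξ, φ ξ ≠ 0 → ‖ξ‖ ≤ R := by
    obtain ⟨R, hR⟩ := hφ.isCompact.isBounded.exists_norm_le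
    exact ⟨max R 1, lt_max_of_lt_right one_pos, fun ξ hξ =>
      (hR ξ (subset_tsupport _ hξ)).trans (le_max_left _ _)⟩
  set χ : ContDiffBump (0 : Rn n) := ⟨R, R + 1, hR0, by linarith⟩ with hχ
  set g : Rn n → ℂ := fun ξ => ((χ ξ * (2 * Real.pi) ^ 2 * ‖ξ‖ ^ 2 : ℝ) : ℂ) with hg
  have hgs : ContDiff ℝ (⊤ : ℕ∞) g := Complex.ofRealCLM.contDiff.comp
    ((χ.contDiff.mul contDiff_const).mul (contDiff_norm_sq ℝ))
  have hgc : HasCompactSupport g := by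
    have h1 : HasCompactSupport (fun ξ : Rn n => χ ξ * (2 * Real.pi) ^ 2 * ‖ξ‖ ^ 2) :=
      (χ.hasCompactSupport.mul_right).mul_right
    exact h1.comp_left Complex.ofReal_zero
  have hstep : ∀ M ξ, (freqMul^[M + 1] φ) ξ = g ξ * (freqMul^[M] φ) ξ := by
    intro M ξ
    rw [Function.iterate_succ_apply', freqMul_apply]
    by_cases h0 : φ ξ = 0
    · rw [iterate_freqMul_apply, h0]; simp
    · have h1 : χ ξ = 1 := χ.one_of_mem_closedBall (by simpa using hR ξ h0)
      simp only [hg, h1]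
      congr 2; ring
  obtain ⟨C₁, s₁, h1⟩ := exists_seminorm_bound (fun _ : Unit => 𝓕 (U 0))
    fun ψ => ⟨‖(𝓕 (U 0)) ψ‖, fun _ => le_rfl⟩
  obtain ⟨C₂, s₂, h2⟩ := exists_seminorm_bound (fun s : Icc (0 : ℝ) t => 𝓕 (V s)) fun ψ => by
    obtain ⟨B, hB⟩ := isCompact_Icc.exists_bound_of_continuousOn (h.continuousOn_snd (𝓕 ψ) ht)
    exact ⟨B, fun s => hB s.1 s.2⟩
  obtain ⟨A₁, K₁, hA₁, hK₁, hb₁⟩ := SchwartzMap.exists_sup_seminorm_le_geometric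
    (φ := fun M => freqMul^[M] φ) hgs
    (exists_norm_iteratedFDeriv_le hgc hgs) hstep s₁
  obtain ⟨A₂, K₂, hA₂, hK₂, hb₂⟩ := SchwartzMap.exists_sup_seminorm_le_geometric
    (φ := fun M => freqMul^[M] φ) hgs
    (exists_norm_iteratedFDeriv_le hgc hgs) hstep s₂
  refine ⟨C₁ * A₁ + C₂ * A₂, K₁ + K₂, by positivity, fun M => ?_, fun M s hs => ?_⟩
  · calc _ ≤ C₁ * (s₁.sup (schwartzSeminormFamily ℂ (Rn n) ℂ)) (freqMul^[M] φ) :=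
          h1 () (freqMul^[M] φ)
      _ ≤ C₁ * (A₁ * K₁ ^ M) := by gcongr; exact hb₁ M
      _ = (C₁ * A₁ + 0) * K₁ ^ M := by ring
      _ ≤ _ := by
          gcongr
          · positivity
          · linarith
  · calc _ ≤ C₂ * (s₂.sup (schwartzSeminormFamily ℂ (Rn n) ℂ)) (freqMul^[M] φ) :=
          h2 ⟨s, hs⟩ (freqMul^[M] φ)
      _ ≤ C₂ * (A₂ * K₂ ^ M) := by gcongr; exact hb₂ M
      _ = (0 + C₂ * A₂) * K₂ ^ M := by ring
      _ ≤ _ := by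
          gcongr
          · positivity
          · linarith

end IsWavePair

/-! ### The pairing of a function with the Fourier transform of another one -/

/-- `∫ ĥ(x) G(x) dx`. -/
def fourierPairing {n : ℕ} (h G : Rn n → ℂ) : ℂ := ∫ x, (∫ ξ, osc ξ x * h ξ) * G x

theorem exists_fourierPairing_bound (n : ℕ) (hn : 0 < n) {s : ℝ} (hs : 1 / 2 < s) (hs' : s < n / 2) :
    ∃ C : ℝ≥0, ∀ h G : Rn n → ℂ, Measurable G → Measurable h → Integrable h →
      ‖fourierPairing h G‖ₑ ≤ C * dualNorm s G * energy s h ^ (1 / 2 : ℝ) ∧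
      (dualNorm s G < ∞ → energy s h < ∞ →
        Integrable (fun x => (∫ ξ, osc ξ x * h ξ) * G x)) := by
  obtain ⟨C, hC⟩ := exists_pairing_bound n hn hs hs'
  refine ⟨C, fun h G hG hhm hh => ?_⟩
  have h1 : ∫⁻ x, ‖(∫ ξ, osc ξ x * h ξ) * G x‖ₑ ≤ C * dualNorm s G * energy s h ^ (1 / 2 : ℝ) := by
    simp only [enorm_mul, mul_comm ‖∫ ξ, osc ξ _ * h ξ‖ₑ]
    exact hC G h hG hhm hh
  refine ⟨(enorm_integral_le_lintegral_enorm _).trans h1, fun hd he => ⟨?_, ?_⟩⟩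
  · exact ((measurable_fourierIntegral hhm).mul hG).aestronglyMeasurable
  · refine h1.trans_lt (ENNReal.mul_lt_top (ENNReal.mul_lt_top ENNReal.coe_lt_top hd) ?_)
    exact ENNReal.rpow_lt_top_of_nonneg (by norm_num) he.ne

theorem integrable_osc_mul {n : ℕ} {h : Rn n → ℂ} (hh : Integrable h) (x : Rn n) :
    Integrable (fun ξ => osc ξ x * h ξ) := by
  refine hh.bdd_mul (c := 1) ?_ (Eventually.of_forall fun z => (norm_osc _ _).le)
  have h1 : Continuous (fun z : Rn n => osc z x) := by fun_prop
  exact h1.aestronglyMeasurable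

theorem fourierPairing_sub {n : ℕ} {h₁ h₂ G : Rn n → ℂ} (h₁i : Integrable h₁) (h₂i : Integrable h₂)
    (h₁G : Integrable (fun x => (∫ ξ, osc ξ x * h₁ ξ) * G x))
    (h₂G : Integrable (fun x => (∫ ξ, osc ξ x * h₂ ξ) * G x)) :
    fourierPairing (fun ξ => h₁ ξ - h₂ ξ) G = fourierPairing h₁ G - fourierPairing h₂ G := by
  unfold fourierPairing
  rw [← integral_sub h₁G h₂G]
  congr 1; ext x
  simp only [mul_sub]
  rw [integral_sub (integrable_osc_mul h₁i x) (integrable_osc_mul h₂i x), sub_mul]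

theorem energy_mul_le {n : ℕ} {s B : ℝ} {m : Rn n → ℝ} {h : Rn n → ℂ}
    (hm : ∀ ξ, h ξ ≠ 0 → |m ξ| ≤ B) :
    energy s (fun ξ => (m ξ : ℂ) * h ξ) ≤ ENNReal.ofReal B ^ 2 * energy s h := by
  unfold energy
  rw [← lintegral_const_mul' _ _ (ENNReal.pow_ne_top ENNReal.ofReal_ne_top)]
  refine lintegral_mono fun ξ => ?_
  by_cases h0 : h ξ = 0
  · simp [h0]
  · rw [enorm_mul, mul_pow, mul_left_comm]
    refine mul_le_mul_left (pow_le_pow_left' ?_ 2) _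
    rw [← ofReal_norm, Complex.norm_real, Real.norm_eq_abs]
    exact ENNReal.ofReal_le_ofReal (hm ξ h0)

theorem tendsto_integral_mul_of_le {X : Type*} [MeasurableSpace X] {μ : Measure X} {w : X → ℂ}
    (hw : Integrable w μ) {p : ℕ → X → ℝ} {q : X → ℝ} (hp : ∀ N, Measurable (p N)) {B : ℝ}
    (hq : ∀ x, |q x| ≤ B) {ε : ℕ → ℝ} (hε : Tendsto ε atTop (nhds 0))
    (h : ∀ N x, w x ≠ 0 → |p N x - q x| ≤ ε N) :
    Tendsto (fun N => ∫ x, (p N x : ℂ) * w x ∂μ) atTop (nhds (∫ x, (q x : ℂ) * w x ∂μ)) := by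
  refine tendsto_integral_filter_of_dominated_convergence (fun x => (B + 1) * ‖w x‖) ?_ ?_
    (hw.norm.const_mul _) ?_
  · exact Eventually.of_forall fun N =>
      (Complex.measurable_ofReal.comp (hp N)).aestronglyMeasurable.mul hw.aestronglyMeasurable
  · filter_upwards [hε.eventually (eventually_le_nhds one_pos)] with N hN
    refine Eventually.of_forall fun x => ?_
    rw [norm_mul, Complex.norm_real, Real.norm_eq_abs]
    by_cases h0 : w x = 0
    · simp [h0]
    · refine mul_le_mul_of_nonneg_right ?_ (norm_nonneg _)
      have h1 := h N x h0
      have h2 := hq x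
      have h3 : |p N x| ≤ |p N x - q x| + |q x| := by
        simpa using abs_add_le (p N x - q x) (q x)
      linarith
  · refine Eventually.of_forall fun x => ?_
    by_cases h0 : w x = 0
    · simp [h0]
    · have h1 : Tendsto (fun N => p N x) atTop (nhds (q x)) := by
        rw [tendsto_iff_norm_sub_tendsto_zero]
        exact squeeze_zero (fun _ => norm_nonneg _) (fun N => h N x h0) hε
      exact ((Complex.continuous_ofReal.tendsto _).comp h1).mul_const _

/-! ### Duhamel's formula -/

theorem continuous_sinePoly (N : ℕ) : Continuous (fun z : ℝ × ℝ => sinePoly N z.1 z.2) := by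
  unfold sinePoly; fun_prop

theorem continuous_cosPoly (N : ℕ) : Continuous (fun z : ℝ × ℝ => cosPoly N z.1 z.2) := by
  unfold cosPoly; fun_prop

theorem Continuous.sineKernel {X : Type*} [TopologicalSpace X] {f g : X → ℝ} (hf : Continuous f)
    (hg : Continuous g) : Continuous (fun x => sineKernel (f x) (g x)) :=
  continuous_sineKernel.comp (hf.prodMk hg)

/-- The Fourier multiplier `sin(2πτ|ξ|) / (2π|ξ|)` applied to `φ`. -/
def sineMul {n : ℕ} (τ : ℝ) (φ : Rn n → ℂ) (ξ : Rn n) : ℂ :=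
  (sineKernel τ (2 * Real.pi * ‖ξ‖) : ℂ) * φ ξ

theorem measurable_sineMul {n : ℕ} {φ : Rn n → ℂ} (hφ : Measurable φ) (τ : ℝ) :
    Measurable (sineMul τ φ) := by
  have h : Continuous (fun ξ : Rn n => sineKernel τ (2 * Real.pi * ‖ξ‖)) :=
    Continuous.sineKernel continuous_const (by fun_prop)
  exact (Complex.measurable_ofReal.comp h.measurable).mul hφ

theorem integrable_ofReal_mul {n : ℕ} {m : Rn n → ℝ} (hm : Measurable m) {w : Rn n → ℂ}
    (hw : Integrable w) {B : ℝ} (hB : ∀ ξ, w ξ ≠ 0 → |m ξ| ≤ B) :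
    Integrable (fun ξ => (m ξ : ℂ) * w ξ) := by
  refine (hw.norm.const_mul B).mono' ((Complex.measurable_ofReal.comp hm).aestronglyMeasurable.mul
    hw.aestronglyMeasurable) (Eventually.of_forall fun ξ => ?_)
  by_cases h0 : w ξ = 0
  · simp [h0]
  · rw [norm_mul, Complex.norm_real, Real.norm_eq_abs]
    exact mul_le_mul_of_nonneg_right (hB ξ h0) (norm_nonneg _)

theorem integrable_sineMul {n : ℕ} {φ : Rn n → ℂ} (hφ : Integrable φ) (τ : ℝ) :
    Integrable (sineMul τ φ) := by
  have h : Continuous (fun ξ : Rn n => sineKernel τ (2 * Real.pi * ‖ξ‖)) :=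
    Continuous.sineKernel continuous_const (by fun_prop)
  exact integrable_ofReal_mul h.measurable hφ (B := |τ|) fun ξ _ => abs_sineKernel_le _ _

theorem energy_sineMul_le {n : ℕ} (s τ : ℝ) (φ : Rn n → ℂ) :
    energy s (sineMul τ φ) ≤ ENNReal.ofReal |τ| ^ 2 * energy s φ :=
  energy_mul_le fun _ _ => abs_sineKernel_le _ _

theorem sum_mul_taylor_eq_sinePoly {n : ℕ} (N : ℕ) (τ : ℝ) (φ : 𝓢(Rn n, ℂ)) (ξ : Rn n) :
    ∑ M ∈ Finset.range N, (-1) ^ M * (taylorKernel (2 * M + 1) τ * (freqMul^[M] φ) ξ) =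
      (sinePoly N τ (2 * Real.pi * ‖ξ‖) : ℂ) * φ ξ := by
  simp only [iterate_freqMul_apply, taylorKernel, sinePoly]
  push_cast
  rw [Finset.sum_mul]
  exact Finset.sum_congr rfl fun M _ => by ring

theorem sum_mul_taylor_eq_cosPoly {n : ℕ} (N : ℕ) (τ : ℝ) (φ : 𝓢(Rn n, ℂ)) (ξ : Rn n) :
    ∑ M ∈ Finset.range N, (-1) ^ M * (taylorKernel (2 * M) τ * (freqMul^[M] φ) ξ) =
      (cosPoly N τ (2 * Real.pi * ‖ξ‖) : ℂ) * φ ξ := by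
  simp only [iterate_freqMul_apply, taylorKernel, cosPoly]
  push_cast
  rw [Finset.sum_mul]
  exact Finset.sum_congr rfl fun M _ => by ring

theorem exists_freq_bound {n : ℕ} {φ : 𝓢(Rn n, ℂ)} (hφ : HasCompactSupport φ) :
    ∃ Y : ℝ, 0 ≤ Y ∧ ∀ ξ, φ ξ ≠ 0 → |2 * Real.pi * ‖ξ‖| ≤ Y := by
  obtain ⟨R, hR⟩ := hφ.isCompact.isBounded.exists_norm_le
  refine ⟨max (2 * Real.pi * R) 0, le_max_right _ _, fun ξ hξ => ?_⟩
  rw [abs_of_nonneg (by positivity)]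
  refine le_max_of_le_left ?_
  have := hR ξ (subset_tsupport _ hξ)
  gcongr

theorem IsWavePair.sum_forcing_eq {n : ℕ} {U V : ℝ → 𝓢'(Rn n, ℂ)} {F : ℝ → Rn n → ℂ}
    (h : IsWavePair U V F) (φ : 𝓢(Rn n, ℂ)) (t : ℝ) :
    ∀ᵐ s ∂(volume.restrict (Ioi (0 : ℝ))), ∀ N, ∑ M ∈ Finset.range N, (-1) ^ M *
      (taylorKernel (2 * M + 1) (t - s) * ∫ x, (𝓕 (freqMul^[M] φ)) x * F s x) =
      fourierPairing (fun ξ => (sinePoly N (t - s) (2 * Real.pi * ‖ξ‖) : ℂ) * φ ξ) (F s) := by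
  filter_upwards [ae_all_iff.2 fun M => (h (𝓕 (freqMul^[M] φ))).1.1] with s hs N
  set k : ℕ → ℂ := fun M => taylorKernel (2 * M + 1) (t - s) with hk
  have e1 : ∀ x, ∫ ξ, osc ξ x * ((sinePoly N (t - s) (2 * Real.pi * ‖ξ‖) : ℂ) * φ ξ) =
      ∑ M ∈ Finset.range N, (-1) ^ M * (k M * (𝓕 (freqMul^[M] φ)) x) := by
    intro x
    have e2 : ∀ M, Integrable (fun ξ => osc ξ x * ((-1) ^ M * (k M * (freqMul^[M] φ) ξ))) := fun M =>
      integrable_osc_mul (((freqMul^[M] φ).integrable.const_mul _).const_mul _) x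
    have e3 : (fun ξ => osc ξ x * ((sinePoly N (t - s) (2 * Real.pi * ‖ξ‖) : ℂ) * φ ξ)) =
        fun ξ => ∑ M ∈ Finset.range N, osc ξ x * ((-1) ^ M * (k M * (freqMul^[M] φ) ξ)) := by
      funext ξ
      rw [← sum_mul_taylor_eq_sinePoly, Finset.mul_sum]
    rw [e3, integral_finsetSum _ fun M _ => e2 M]
    refine Finset.sum_congr rfl fun M _ => ?_
    rw [SchwartzMap.fourier_coe, fourier_eq_osc, ← integral_const_mul, ← integral_const_mul]
    congr 1; ext ξ; ring
  have e4 : ∀ M, Integrable (fun x => (-1) ^ M * (k M * ((𝓕 (freqMul^[M] φ)) x * F s x))) := fun M =>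
    ((hs M).const_mul _).const_mul _
  unfold fourierPairing
  simp only [e1]
  have e5 : (fun x => (∑ M ∈ Finset.range N, (-1) ^ M * (k M * (𝓕 (freqMul^[M] φ)) x)) * F s x) =
      fun x => ∑ M ∈ Finset.range N, (-1) ^ M * (k M * ((𝓕 (freqMul^[M] φ)) x * F s x)) := by
    funext x
    rw [Finset.sum_mul]
    exact Finset.sum_congr rfl fun M _ => by ring
  rw [e5, integral_finsetSum _ fun M _ => e4 M]
  refine Finset.sum_congr rfl fun M _ => ?_
  rw [integral_const_mul, integral_const_mul]

/-- A multiplier which is bounded on the support of `φ` acts boundedly in the forcing pairing. -/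
theorem exists_fourierPairing_mul_bound (n : ℕ) (hn : 0 < n) {σ : ℝ} (hσ : 1 / 2 < σ)
    (hσ' : σ < n / 2) : ∃ C : ℝ≥0, ∀ G φ : Rn n → ℂ, Measurable G → Measurable φ → Integrable φ →
    energy σ φ < ∞ → ∀ m : Rn n → ℝ, Measurable m → ∀ B : ℝ, (∀ ξ, φ ξ ≠ 0 → |m ξ| ≤ B) →
    ‖fourierPairing (fun ξ => (m ξ : ℂ) * φ ξ) G‖ₑ ≤
        C * dualNorm σ G * (ENNReal.ofReal B * energy σ φ ^ (1 / 2 : ℝ)) ∧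
      (dualNorm σ G < ∞ → Integrable (fun x => (∫ ξ, osc ξ x * ((m ξ : ℂ) * φ ξ)) * G x)) := by
  obtain ⟨C, hC⟩ := exists_fourierPairing_bound n hn hσ hσ'
  refine ⟨C, fun G φ hG hφm hφi hE m hm B hmB => ?_⟩
  have h1 := hC (fun ξ => (m ξ : ℂ) * φ ξ) G hG
    ((Complex.measurable_ofReal.comp hm).mul hφm) (integrable_ofReal_mul hm hφi hmB)
  have h2 := energy_mul_le (s := σ) hmB
  refine ⟨h1.1.trans (mul_le_mul_right ?_ _), fun hd => h1.2 hd (h2.trans_lt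
    (ENNReal.mul_lt_top (ENNReal.pow_lt_top ENNReal.ofReal_lt_top) hE))⟩
  refine (ENNReal.rpow_le_rpow h2 (by norm_num)).trans (le_of_eq ?_)
  rw [ENNReal.mul_rpow_of_nonneg _ _ (by norm_num), ← ENNReal.rpow_natCast, ← ENNReal.rpow_mul]
  norm_num

/-- Convergence of the Taylor expansion of the forcing term. -/
theorem IsWavePair.tendsto_forcing {n : ℕ} (hn : 0 < n) {σ : ℝ} (hσ : 1 / 2 < σ) (hσ' : σ < n / 2)
    {U V : ℝ → 𝓢'(Rn n, ℂ)} {F : ℝ → Rn n → ℂ} (h : IsWavePair U V F) (hF : ∀ s, Measurable (F s))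
    (hFd : ∫⁻ t in Ioi (0 : ℝ), dualNorm σ (F t) < ∞)
    (hFdm : Measurable (fun t => dualNorm σ (F t)))
    {φ : 𝓢(Rn n, ℂ)} (hφ : HasCompactSupport φ) (hE : energy σ φ < ∞) {t : ℝ} (ht : 0 ≤ t) :
    Tendsto (fun N => ∑ M ∈ Finset.range N, (-1) ^ M * ∫ s in (0 : ℝ)..t,
      taylorKernel (2 * M + 1) (t - s) * ∫ x, (𝓕 (freqMul^[M] φ)) x * F s x) atTop
      (nhds (∫ s in (0 : ℝ)..t, fourierPairing (sineMul (t - s) φ) (F s))) := by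
  obtain ⟨C, hC⟩ := exists_fourierPairing_mul_bound n hn hσ hσ'
  obtain ⟨Y, hY0, hY⟩ := exists_freq_bound hφ
  have hφi : Integrable (φ : Rn n → ℂ) := φ.integrable
  have hφm : Measurable (φ : Rn n → ℂ) := φ.continuous.measurable
  have hkc : ∀ M, Continuous (fun s => taylorKernel (2 * M + 1) (t - s)) := fun M => by fun_prop
  have hii : ∀ M, IntervalIntegrable (fun s => (-1) ^ M * (taylorKernel (2 * M + 1) (t - s) *
      ∫ x, (𝓕 (freqMul^[M] φ)) x * F s x)) volume 0 t := fun M =>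
    (((h (𝓕 (freqMul^[M] φ))).1.2 t ht).continuousOn_mul (hkc M).continuousOn).const_mul _
  set G : ℕ → ℝ → ℂ := fun N s => ∑ M ∈ Finset.range N, (-1) ^ M * (taylorKernel (2 * M + 1) (t - s) *
      ∫ x, (𝓕 (freqMul^[M] φ)) x * F s x) with hG
  have hsum : ∀ N, ∑ M ∈ Finset.range N, (-1) ^ M * ∫ s in (0 : ℝ)..t,
      taylorKernel (2 * M + 1) (t - s) * ∫ x, (𝓕 (freqMul^[M] φ)) x * F s x =
      ∫ s in (0 : ℝ)..t, G N s := by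
    intro N
    rw [hG, intervalIntegral.integral_finsetSum fun M _ => hii M]
    exact Finset.sum_congr rfl fun M _ => (intervalIntegral.integral_const_mul _ _).symm
  simp only [hsum]
  have hGm : ∀ N, AEStronglyMeasurable (G N) (volume.restrict (uIoc 0 t)) := by
    intro N
    rw [uIoc_of_le ht]
    exact Finset.aestronglyMeasurable_fun_sum _ fun M _ => (hii M).1.aestronglyMeasurable
  have hsub : Ioc (0 : ℝ) t ⊆ Ioi 0 := fun s hs => hs.1
  have hpoly : ∀ᵐ s ∂(volume.restrict (Ioi (0 : ℝ))), ∀ N,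
      G N s = fourierPairing (fun ξ => (sinePoly N (t - s) (2 * Real.pi * ‖ξ‖) : ℂ) * φ ξ) (F s) :=
    h.sum_forcing_eq φ t
  clear_value G
  have hpm : ∀ N s, Measurable (fun ξ : Rn n => sinePoly N (t - s) (2 * Real.pi * ‖ξ‖)) := fun N s =>
    ((continuous_sinePoly N).comp (continuous_const.prodMk (by fun_prop :
      Continuous (fun ξ : Rn n => 2 * Real.pi * ‖ξ‖)))).measurable
  have hsm : ∀ s, Measurable (fun ξ : Rn n => sineKernel (t - s) (2 * Real.pi * ‖ξ‖)) := fun s =>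
    (Continuous.sineKernel continuous_const (by fun_prop)).measurable
  have herr : ∀ N, ∀ s ∈ Ioc 0 t, ∀ ξ, φ ξ ≠ 0 → |sinePoly N (t - s) (2 * Real.pi * ‖ξ‖) -
      sineKernel (t - s) (2 * Real.pi * ‖ξ‖)| ≤ t * coshTail (t * Y) N := by
    intro N s hs ξ hξ
    have h0 : 0 ≤ t - s := by linarith [hs.2]
    have h1 : t - s ≤ t := by linarith [hs.1]
    refine (abs_sinePoly_sub_le N (X := t * Y) ?_).trans ?_
    · rw [abs_mul, abs_of_nonneg h0]
      exact mul_le_mul h1 (hY ξ hξ) (abs_nonneg _) ht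
    · rw [abs_of_nonneg h0]
      exact mul_le_mul_of_nonneg_right h1 (coshTail_nonneg _ _)
  have hker : ∀ s ∈ Ioc 0 t, ∀ y, |sineKernel (t - s) y| ≤ t := by
    intro s hs y
    refine (abs_sineKernel_le _ _).trans ?_
    rw [abs_of_nonneg (by linarith [hs.2])]; linarith [hs.1]
  set W : ℝ≥0∞ := energy σ φ ^ (1 / 2 : ℝ) with hW
  have hWfin : W < ∞ := ENNReal.rpow_lt_top_of_nonneg (by norm_num) hE.ne
  have hpair : ∀ s, ∀ m : Rn n → ℝ, Measurable m → ∀ B : ℝ, (∀ ξ, φ ξ ≠ 0 → |m ξ| ≤ B) →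
      ‖fourierPairing (fun ξ => (m ξ : ℂ) * φ ξ) (F s)‖ₑ ≤
        C * dualNorm σ (F s) * (ENNReal.ofReal B * W) ∧
      (dualNorm σ (F s) < ∞ → Integrable (fun x => (∫ ξ, osc ξ x * ((m ξ : ℂ) * φ ξ)) * F s x)) :=
    fun s => hC (F s) φ (hF s) hφm hφi hE
  have hfin : ∀ᵐ s ∂(volume.restrict (Ioc (0 : ℝ) t)), dualNorm σ (F s) < ∞ :=
    ae_restrict_of_ae_restrict_of_subset hsub (ae_lt_top hFdm hFd.ne)
  have hpoly' := ae_restrict_of_ae_restrict_of_subset hsub hpoly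
  have hdiff : ∀ᵐ s ∂(volume.restrict (Ioc (0 : ℝ) t)), ∀ N,
      ‖G N s - fourierPairing (sineMul (t - s) φ) (F s)‖ₑ ≤
        C * dualNorm σ (F s) * (ENNReal.ofReal (t * coshTail (t * Y) N) * W) := by
    filter_upwards [hfin, hpoly', ae_restrict_mem measurableSet_Ioc] with s hs hp hst N
    have hb : ∀ ξ, φ ξ ≠ 0 → |sinePoly N (t - s) (2 * Real.pi * ‖ξ‖)| ≤ t * coshTail (t * Y) N + t := by
      intro ξ hξ
      have h1 := herr N s hst ξ hξ
      have h2 := hker s hst (2 * Real.pi * ‖ξ‖)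
      have h3 := abs_add_le (sinePoly N (t - s) (2 * Real.pi * ‖ξ‖) -
        sineKernel (t - s) (2 * Real.pi * ‖ξ‖)) (sineKernel (t - s) (2 * Real.pi * ‖ξ‖))
      rw [sub_add_cancel] at h3
      linarith
    have hB0 : 0 ≤ t * coshTail (t * Y) N := mul_nonneg ht (coshTail_nonneg _ _)
    have e1 := (hpair s _ (hpm N s) _ hb).2 hs
    have e2 := (hpair s _ (hsm s) t fun ξ _ => hker s hst _).2 hs
    rw [hp N]
    have e3 := fourierPairing_sub (integrable_ofReal_mul (hpm N s) hφi hb)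
      (integrable_ofReal_mul (hsm s) hφi fun ξ _ => hker s hst _) e1 e2
    have e4 : (sineMul (t - s) φ) = fun ξ => (sineKernel (t - s) (2 * Real.pi * ‖ξ‖) : ℂ) * φ ξ := rfl
    rw [e4, ← e3]
    have e5 : (fun ξ => (sinePoly N (t - s) (2 * Real.pi * ‖ξ‖) : ℂ) * φ ξ -
        (sineKernel (t - s) (2 * Real.pi * ‖ξ‖) : ℂ) * φ ξ) = fun ξ =>
        ((sinePoly N (t - s) (2 * Real.pi * ‖ξ‖) - sineKernel (t - s) (2 * Real.pi * ‖ξ‖) : ℝ) : ℂ) *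
          φ ξ := by
      ext ξ; push_cast; ring
    rw [e5]
    exact (hpair s _ ((hpm N s).sub (hsm s)) _ (herr N s hst)).1
  have hlim0 : Tendsto (fun N => t * coshTail (t * Y) N) atTop (nhds 0) := by
    simpa using (tendsto_coshTail (t * Y)).const_mul t
  set D : ℝ → ℝ≥0∞ := fun s => C * dualNorm σ (F s) * (ENNReal.ofReal (1 + t) * W) with hD
  have hDm : Measurable D := (hFdm.const_mul _).mul_const _
  have hDint : ∫⁻ s in Ioc 0 t, D s < ∞ := by
    have hW1 : ENNReal.ofReal (1 + t) * W ≠ ∞ := (ENNReal.mul_lt_top ENNReal.ofReal_lt_top hWfin).ne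
    rw [hD, lintegral_mul_const' _ _ hW1, lintegral_const_mul' _ _ ENNReal.coe_ne_top]
    refine ENNReal.mul_lt_top (ENNReal.mul_lt_top ENNReal.coe_lt_top ?_) hW1.lt_top
    exact (lintegral_mono_set hsub).trans_lt hFd
  refine intervalIntegral.tendsto_integral_filter_of_dominated_convergence (fun s => (D s).toReal)
    (Eventually.of_forall hGm) ?_ ?_ ?_
  · filter_upwards [hlim0.eventually (eventually_le_nhds one_pos)] with N hN
    rw [← ae_restrict_iff' measurableSet_uIoc, uIoc_of_le ht]
    filter_upwards [hpoly', hfin, ae_restrict_mem measurableSet_Ioc, hdiff] with s hp hs hst hd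
    have e2 := (hpair s _ (hsm s) t fun ξ _ => hker s hst _).1
    have e3 : ‖G N s‖ₑ ≤ D s := by
      calc ‖G N s‖ₑ = ‖(G N s - fourierPairing (sineMul (t - s) φ) (F s)) +
            fourierPairing (sineMul (t - s) φ) (F s)‖ₑ := by rw [sub_add_cancel]
        _ ≤ C * dualNorm σ (F s) * (ENNReal.ofReal (t * coshTail (t * Y) N) * W) +
            C * dualNorm σ (F s) * (ENNReal.ofReal t * W) :=
            (enorm_add_le _ _).trans (add_le_add (hd N) e2)
        _ ≤ C * dualNorm σ (F s) * (ENNReal.ofReal 1 * W) +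
            C * dualNorm σ (F s) * (ENNReal.ofReal t * W) := by
            refine add_le_add (mul_le_mul_right (mul_le_mul_left ?_ _) _) le_rfl
            exact ENNReal.ofReal_le_ofReal hN
        _ = D s := by rw [hD]; simp only; rw [ENNReal.ofReal_add zero_le_one ht]; ring
    rw [← toReal_enorm]
    refine ENNReal.toReal_mono ?_ e3
    exact (ENNReal.mul_lt_top (ENNReal.mul_lt_top ENNReal.coe_lt_top hs)
      (ENNReal.mul_lt_top ENNReal.ofReal_lt_top hWfin)).ne
  · rw [intervalIntegrable_iff_integrableOn_Ioc_of_le ht]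
    exact integrable_toReal_of_lintegral_ne_top hDm.aemeasurable hDint.ne
  · rw [← ae_restrict_iff' measurableSet_uIoc, uIoc_of_le ht]
    filter_upwards [hfin, hdiff] with s hs hd
    rw [tendsto_iff_edist_tendsto_0]
    have e0 : Tendsto (fun N => C * dualNorm σ (F s) * (ENNReal.ofReal (t * coshTail (t * Y) N) * W))
        atTop (nhds 0) := by
      have e1 := ENNReal.tendsto_ofReal hlim0
      have e2 := ENNReal.Tendsto.const_mul (a := C * dualNorm σ (F s))
        (ENNReal.Tendsto.mul_const (b := W) e1 (Or.inr hWfin.ne))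
        (Or.inr (ENNReal.mul_lt_top ENNReal.coe_lt_top hs).ne)
      simpa using e2
    refine tendsto_of_tendsto_of_tendsto_of_le_of_le tendsto_const_nhds e0 (fun _ => bot_le)
      fun N => ?_
    simp only [edist_eq_enorm_sub]
    exact hd N

theorem tendsto_sum_taylor_mul {n : ℕ} {φ : 𝓢(Rn n, ℂ)} (hφ : HasCompactSupport φ) {T : 𝓢'(Rn n, ℂ)}
    {fh : Rn n → ℂ} (hf : IsRepresentedBy (𝓕 T) fh) {t : ℝ} (ht : 0 ≤ t) {k : ℕ → ℂ}
    {P : ℕ → ℝ → ℝ} {Q : ℝ → ℝ} (hP : ∀ N, Continuous (P N)) {B : ℝ} (hQ : ∀ y, |Q y| ≤ B)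
    (hk : ∀ N ξ, ∑ M ∈ Finset.range N, (-1) ^ M * (k M * (freqMul^[M] φ) ξ) =
      (P N (2 * Real.pi * ‖ξ‖) : ℂ) * φ ξ)
    {b : ℝ} (herr : ∀ N y X, |t * y| ≤ X → |P N y - Q y| ≤ b * coshTail X N) :
    Tendsto (fun N => ∑ M ∈ Finset.range N, (-1) ^ M * (k M * T (𝓕 (freqMul^[M] φ)))) atTop
      (nhds (∫ ξ, (Q (2 * Real.pi * ‖ξ‖) : ℂ) * (φ ξ * fh ξ))) := by
  obtain ⟨Y, hY0, hY⟩ := exists_freq_bound hφ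
  have h1 : ∀ N, ∑ M ∈ Finset.range N, (-1) ^ M * (k M * T (𝓕 (freqMul^[M] φ))) =
      ∫ ξ, (P N (2 * Real.pi * ‖ξ‖) : ℂ) * (φ ξ * fh ξ) := by
    intro N
    have h2 : ∀ M, Integrable (fun ξ => (-1) ^ M * (k M * ((freqMul^[M] φ) ξ * fh ξ))) := fun M =>
      ((hf (freqMul^[M] φ)).1.const_mul _).const_mul _
    have h3 : (fun ξ => (P N (2 * Real.pi * ‖ξ‖) : ℂ) * (φ ξ * fh ξ)) = fun ξ =>
        ∑ M ∈ Finset.range N, (-1) ^ M * (k M * ((freqMul^[M] φ) ξ * fh ξ)) := by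
      funext ξ
      rw [← mul_assoc, ← hk, Finset.sum_mul]
      exact Finset.sum_congr rfl fun M _ => by ring
    rw [h3, integral_finsetSum _ fun M _ => h2 M]
    refine Finset.sum_congr rfl fun M _ => ?_
    rw [integral_const_mul, integral_const_mul, ← (hf (freqMul^[M] φ)).2]
    rfl
  simp only [h1]
  have hε : Tendsto (fun N => b * coshTail (t * Y) N) atTop (nhds 0) := by
    simpa using (tendsto_coshTail (t * Y)).const_mul b
  refine tendsto_integral_mul_of_le (hf φ).1 (p := fun N ξ => P N (2 * Real.pi * ‖ξ‖))
    (q := fun ξ => Q (2 * Real.pi * ‖ξ‖)) (fun N => ?_) (fun ξ => hQ _) hε fun N ξ hξ => ?_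
  · exact ((hP N).comp (by fun_prop : Continuous (fun ξ : Rn n => 2 * Real.pi * ‖ξ‖))).measurable
  · refine herr N _ _ ?_
    rw [abs_mul, abs_of_nonneg ht]
    exact mul_le_mul_of_nonneg_left (hY ξ (left_ne_zero_of_mul hξ)) ht

theorem IsWavePair.tendsto_taylor {n : ℕ} {U V : ℝ → 𝓢'(Rn n, ℂ)} {F : ℝ → Rn n → ℂ}
    (h : IsWavePair U V F) {φ : 𝓢(Rn n, ℂ)} (hφ : HasCompactSupport φ) {t : ℝ} (ht : 0 ≤ t) :
    Tendsto (fun N => ∑ M ∈ Finset.range N, (-1) ^ M *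
        (taylorKernel (2 * M) t * U 0 (𝓕 (freqMul^[M] φ)) +
        taylorKernel (2 * M + 1) t * V 0 (𝓕 (freqMul^[M] φ)) +
        ∫ s in (0 : ℝ)..t, taylorKernel (2 * M + 1) (t - s) * ∫ x, (𝓕 (freqMul^[M] φ)) x * F s x))
      atTop (nhds (U t (𝓕 φ))) := by
  obtain ⟨A, K, hK, hA, hVb⟩ := h.exists_geometric_bound hφ ht
  obtain ⟨ψ, hψ⟩ : ∃ ψ : ℕ → 𝓢(Rn n, ℂ), ∀ M, 𝓕 (freqMul^[M] φ) = ψ M := ⟨_, fun _ => rfl⟩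
  have hψ0 : 𝓕 φ = ψ 0 := hψ 0
  have hstep : ∀ M, ∀ s ∈ Icc 0 t, V s (ψ M) = V 0 (ψ M) +
      ∫ r in (0 : ℝ)..s, ((∫ x, ψ M x * F r x) - U r (ψ (M + 1))) := by
    intro M s hs
    have := h.snd_fourier_eq (freqMul^[M] φ) hs.1
    rwa [← Function.iterate_succ_apply' (⇑freqMul) M φ, hψ, hψ] at this
  simp only [hψ] at hA hVb ⊢
  rw [hψ0]
  exact tendsto_taylor_wave_system ht (a := fun M => U 0 (ψ M)) (b := fun M => V 0 (ψ M))
    (u := fun M s => U s (ψ M)) (v := fun M s => V s (ψ M)) (F := fun M s => ∫ x, ψ M x * F s x)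
    (fun M => h.intervalIntegrable_fst _ ht) (fun M => h.intervalIntegrable_snd _ ht)
    (fun M => (h (ψ M)).1.2 t ht) (fun M s hs => h.fst_eq _ hs.1) hstep hK hA hVb

theorem IsWavePair.duhamel_of_hasCompactSupport {n : ℕ} (hn : 0 < n) {σ : ℝ} (hσ : 1 / 2 < σ)
    (hσ' : σ < n / 2) {U V : ℝ → 𝓢'(Rn n, ℂ)} {F : ℝ → Rn n → ℂ} (h : IsWavePair U V F)
    (hF : ∀ s, Measurable (F s)) (hFd : ∫⁻ t in Ioi (0 : ℝ), dualNorm σ (F t) < ∞)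
    (hFdm : Measurable (fun t => dualNorm σ (F t))) {fh gh : Rn n → ℂ}
    (hf : IsRepresentedBy (𝓕 (U 0)) fh) (hg : IsRepresentedBy (𝓕 (V 0)) gh)
    {φ : 𝓢(Rn n, ℂ)} (hφ : HasCompactSupport φ) (hE : energy σ φ < ∞) {t : ℝ} (ht : 0 ≤ t) :
    U t (𝓕 φ) = (∫ ξ, (Real.cos (t * (2 * Real.pi * ‖ξ‖)) : ℂ) * (φ ξ * fh ξ)) +
      (∫ ξ, (sineKernel t (2 * Real.pi * ‖ξ‖) : ℂ) * (φ ξ * gh ξ)) +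
      ∫ s in (0 : ℝ)..t, fourierPairing (sineMul (t - s) φ) (F s) := by
  have h1 := h.tendsto_taylor hφ ht
  refine tendsto_nhds_unique h1 ?_
  have h2 := h.tendsto_forcing hn hσ hσ' hF hFd hFdm hφ hE ht
  have h3 := tendsto_sum_taylor_mul hφ hf ht (k := fun M => taylorKernel (2 * M) t)
    (P := fun N y => cosPoly N t y) (Q := fun y => Real.cos (t * y)) (B := 1) (b := 1)
    (fun N => (continuous_cosPoly N).comp (continuous_const.prodMk continuous_id))
    (fun y => Real.abs_cos_le_one _) (fun N ξ => sum_mul_taylor_eq_cosPoly N t φ ξ)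
    (fun N y X hX => by rw [one_mul]; exact abs_cosPoly_sub_le N hX)
  have h4 := tendsto_sum_taylor_mul hφ hg ht (k := fun M => taylorKernel (2 * M + 1) t)
    (P := fun N y => sinePoly N t y) (Q := fun y => sineKernel t y) (B := |t|) (b := |t|)
    (fun N => (continuous_sinePoly N).comp (continuous_const.prodMk continuous_id))
    (fun y => abs_sineKernel_le _ _) (fun N ξ => sum_mul_taylor_eq_sinePoly N t φ ξ)
    (fun N y X hX => abs_sinePoly_sub_le N hX)
  refine ((h3.add h4).add h2).congr fun N => ?_
  rw [← Finset.sum_add_distrib, ← Finset.sum_add_distrib]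
  exact Finset.sum_congr rfl fun M _ => by ring

theorem measurable_fourierPairing {n : ℕ} {Z : Type*} [MeasurableSpace Z] {h G : Z → Rn n → ℂ}
    (hh : Measurable (Function.uncurry h)) (hG : Measurable (Function.uncurry G)) :
    Measurable (fun z => fourierPairing (h z) (G z)) := by
  have h1 : Continuous (fun q : Rn n × Rn n => osc q.2 q.1) := by fun_prop
  have ha : Measurable (fun q : (Z × Rn n) × Rn n => osc q.2 q.1.2) :=
    Measurable.comp (g := fun q : Rn n × Rn n => osc q.2 q.1)
      (f := fun q : (Z × Rn n) × Rn n => (q.1.2, q.2)) h1.measurable (by fun_prop)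
  have hb : Measurable (fun q : (Z × Rn n) × Rn n => h q.1.1 q.2) :=
    Measurable.comp (g := Function.uncurry h)
      (f := fun q : (Z × Rn n) × Rn n => (q.1.1, q.2)) hh (by fun_prop)
  have h2 : Measurable (fun q : (Z × Rn n) × Rn n => osc q.2 q.1.2 * h q.1.1 q.2) := ha.mul hb
  have h3 : Measurable (fun q : Z × Rn n => ∫ ξ, osc ξ q.2 * h q.1 ξ) :=
    (h2.stronglyMeasurable.integral_prod_right' (ν := volume)).measurable
  have h4 : Measurable (fun q : Z × Rn n => (∫ ξ, osc ξ q.2 * h q.1 ξ) * G q.1 q.2) := h3.mul hG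
  exact (h4.stronglyMeasurable.integral_prod_right' (ν := volume)).measurable

theorem measurable_uncurry_sineMul {n : ℕ} {φ : Rn n → ℂ} (hφ : Measurable φ) {Z : Type*}
    [MeasurableSpace Z] {τ : Z → ℝ} (hτ : Measurable τ) :
    Measurable (Function.uncurry fun (z : Z) (ξ : Rn n) => sineMul (τ z) φ ξ) := by
  have h1 : Measurable (fun q : Z × Rn n => sineKernel (τ q.1) (2 * Real.pi * ‖q.2‖)) :=
    continuous_sineKernel.measurable.comp ((hτ.comp measurable_fst).prodMk
      ((measurable_norm.comp measurable_snd).const_mul _))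
  exact (Complex.measurable_ofReal.comp h1).mul (hφ.comp measurable_snd)

theorem tendsto_energy_sub_zero {n : ℕ} {σ : ℝ} {φ : Rn n → ℂ} {Φ : ℕ → Rn n → ℂ} (hφ : Measurable φ)
    (hΦ : ∀ N, Measurable (Φ N)) (hE : energy σ φ < ∞) (hle : ∀ N ξ, ‖Φ N ξ‖ ≤ ‖φ ξ‖)
    (hlim : ∀ ξ, Tendsto (fun N => Φ N ξ) atTop (nhds (φ ξ))) :
    Tendsto (fun N => energy σ (fun ξ => Φ N ξ - φ ξ)) atTop (nhds 0) := by
  have hw : Measurable (fun ξ : Rn n => ENNReal.ofReal (‖ξ‖ ^ (2 * σ))) :=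
    (measurable_norm.pow_const _).ennreal_ofReal
  have h0 : (0 : ℝ≥0∞) = ∫⁻ _ : Rn n, 0 := by simp
  unfold energy
  rw [h0]
  refine tendsto_lintegral_of_dominated_convergence
    (fun ξ => 4 * (ENNReal.ofReal (‖ξ‖ ^ (2 * σ)) * ‖φ ξ‖ₑ ^ 2)) ?_ ?_ ?_ ?_
  · exact fun N => hw.mul (((hΦ N).sub hφ).enorm.pow_const 2)
  · refine fun N => Eventually.of_forall fun ξ => ?_
    have h1 : ‖Φ N ξ - φ ξ‖ₑ ≤ 2 * ‖φ ξ‖ₑ := by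
      rw [← ofReal_norm, ← ofReal_norm, ← ENNReal.ofReal_ofNat, ← ENNReal.ofReal_mul (by norm_num)]
      exact ENNReal.ofReal_le_ofReal ((norm_sub_le _ _).trans (by linarith [hle N ξ]))
    calc _ ≤ ENNReal.ofReal (‖ξ‖ ^ (2 * σ)) * (2 * ‖φ ξ‖ₑ) ^ 2 :=
          mul_le_mul_right (pow_le_pow_left' h1 2) _
      _ = _ := by rw [mul_pow]; norm_num; ring
  · rw [lintegral_const_mul' _ _ (by norm_num)]
    exact (ENNReal.mul_lt_top (by norm_num) hE).ne
  · refine Eventually.of_forall fun ξ => ?_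
    have h1 : Tendsto (fun N => ‖Φ N ξ - φ ξ‖ₑ) atTop (nhds 0) := by
      have := ((hlim ξ).sub_const (φ ξ)).enorm
      simpa using this
    have h2 := ENNReal.Tendsto.const_mul (a := ENNReal.ofReal (‖ξ‖ ^ (2 * σ)))
      (ENNReal.Tendsto.pow (n := 2) h1) (Or.inr ENNReal.ofReal_ne_top)
    simpa using h2

theorem IsWavePair.duhamel {n : ℕ} (hn : 0 < n) {σ : ℝ} (hσ : 1 / 2 < σ)
    (hσ' : σ < n / 2) {U V : ℝ → 𝓢'(Rn n, ℂ)} {F : ℝ → Rn n → ℂ} (h : IsWavePair U V F)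
    (hF : Measurable (Function.uncurry F)) (hFd : ∫⁻ t in Ioi (0 : ℝ), dualNorm σ (F t) < ∞)
    (hFdm : Measurable (fun t => dualNorm σ (F t))) {fh gh : Rn n → ℂ}
    (hf : IsRepresentedBy (𝓕 (U 0)) fh) (hg : IsRepresentedBy (𝓕 (V 0)) gh)
    {φ : 𝓢(Rn n, ℂ)} (hE : energy σ φ < ∞) {t : ℝ} (ht : 0 ≤ t) :
    U t (𝓕 φ) = (∫ ξ, (Real.cos (t * (2 * Real.pi * ‖ξ‖)) : ℂ) * (φ ξ * fh ξ)) +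
      (∫ ξ, (sineKernel t (2 * Real.pi * ‖ξ‖) : ℂ) * (φ ξ * gh ξ)) +
      ∫ s in (0 : ℝ)..t, fourierPairing (sineMul (t - s) φ) (F s) := by
  obtain ⟨Φ, hΦc, hΦle, hΦlim⟩ := SchwartzMap.exists_hasCompactSupport_tendsto φ
  have hFs : ∀ s, Measurable (F s) := fun s => hF.of_uncurry_left
  have hφm : Measurable (φ : Rn n → ℂ) := φ.continuous.measurable
  have hΦm : ∀ N, Measurable (Φ N : Rn n → ℂ) := fun N => (Φ N).continuous.measurable
  have hpt : ∀ ξ, Tendsto (fun N => Φ N ξ) atTop (nhds (φ ξ)) := fun ξ =>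
    ((TemperedDistribution.delta ξ).continuous.tendsto φ).comp hΦlim
  have hEle : ∀ N, energy σ (Φ N) ≤ energy σ φ := fun N =>
    lintegral_mono fun ξ => mul_le_mul_right (pow_le_pow_left' (enorm_le_iff_norm_le.2 (hΦle N ξ)) 2) _
  have hmain := fun N => h.duhamel_of_hasCompactSupport hn hσ hσ' hFs hFd hFdm hf hg (hΦc N)
    ((hEle N).trans_lt hE) ht
  have hleft : Tendsto (fun N => U t (𝓕 (Φ N))) atTop (nhds (U t (𝓕 φ))) :=
    ((𝓕 (U t)).continuous.tendsto φ).comp hΦlim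
  have hdata : ∀ {w : Rn n → ℂ}, Integrable (fun ξ => φ ξ * w ξ) → (∀ N, Integrable (fun ξ => Φ N ξ * w ξ)) →
      ∀ {Q : ℝ → ℝ} {B : ℝ}, Continuous Q → (∀ y, |Q y| ≤ B) →
      Tendsto (fun N => ∫ ξ, (Q (2 * Real.pi * ‖ξ‖) : ℂ) * (Φ N ξ * w ξ)) atTop
        (nhds (∫ ξ, (Q (2 * Real.pi * ‖ξ‖) : ℂ) * (φ ξ * w ξ))) := by
    intro w hw hwN Q B hQ hB
    have hQm : Measurable (fun ξ : Rn n => (Q (2 * Real.pi * ‖ξ‖) : ℂ)) :=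
      Complex.measurable_ofReal.comp (hQ.comp (by fun_prop :
        Continuous (fun ξ : Rn n => 2 * Real.pi * ‖ξ‖))).measurable
    refine tendsto_integral_of_dominated_convergence (fun ξ => B * ‖φ ξ * w ξ‖)
      (fun N => hQm.aestronglyMeasurable.mul (hwN N).aestronglyMeasurable) (hw.norm.const_mul B)
      (fun N => Eventually.of_forall fun ξ => ?_) (Eventually.of_forall fun ξ => ?_)
    · rw [norm_mul, norm_mul, norm_mul, Complex.norm_real, Real.norm_eq_abs]
      have h1 := hB (2 * Real.pi * ‖ξ‖)
      have h2 := hΦle N ξ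
      have h3 : 0 ≤ B := (abs_nonneg _).trans h1
      gcongr
    · exact ((hpt ξ).mul_const _).const_mul _
  have hA := hdata (hf φ).1 (fun N => (hf (Φ N)).1) (Q := fun y => Real.cos (t * y)) (B := 1)
    (by fun_prop) (fun y => Real.abs_cos_le_one _)
  have hB := hdata (hg φ).1 (fun N => (hg (Φ N)).1) (Q := fun y => sineKernel t y) (B := |t|)
    (Continuous.sineKernel continuous_const continuous_id) (fun y => abs_sineKernel_le _ _)
  obtain ⟨C, hC⟩ := exists_fourierPairing_bound n hn hσ hσ'
  have hsub : Ioc (0 : ℝ) t ⊆ Ioi 0 := fun s hs => hs.1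
  have hfin : ∀ᵐ s ∂(volume.restrict (Ioc (0 : ℝ) t)), dualNorm σ (F s) < ∞ :=
    ae_restrict_of_ae_restrict_of_subset hsub (ae_lt_top hFdm hFd.ne)
  have hEsine : ∀ s ∈ Ioc 0 t, ∀ ψ : Rn n → ℂ,
      energy σ (sineMul (t - s) ψ) ≤ ENNReal.ofReal t ^ 2 * energy σ ψ := by
    intro s hs ψ
    refine (energy_sineMul_le _ _ _).trans (mul_le_mul_left (pow_le_pow_left' ?_ 2) _)
    rw [abs_of_nonneg (by linarith [hs.2])]
    exact ENNReal.ofReal_le_ofReal (by linarith [hs.1])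
  have hpair : ∀ s ∈ Ioc 0 t, ∀ ψ : Rn n → ℂ, Measurable ψ → Integrable ψ →
      ‖fourierPairing (sineMul (t - s) ψ) (F s)‖ₑ ≤
        C * dualNorm σ (F s) * (ENNReal.ofReal t * energy σ ψ ^ (1 / 2 : ℝ)) ∧
      (dualNorm σ (F s) < ∞ → energy σ ψ < ∞ →
        Integrable (fun x => (∫ ξ, osc ξ x * sineMul (t - s) ψ ξ) * F s x)) := by
    intro s hs ψ hψ hψi
    have h1 := hC (sineMul (t - s) ψ) (F s) (hFs s) (measurable_sineMul hψ _) (integrable_sineMul hψi _)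
    refine ⟨h1.1.trans (mul_le_mul_right ?_ _), fun hd he => h1.2 hd ((hEsine s hs ψ).trans_lt
      (ENNReal.mul_lt_top (ENNReal.pow_lt_top ENNReal.ofReal_lt_top) he))⟩
    refine (ENNReal.rpow_le_rpow (hEsine s hs ψ) (by norm_num)).trans (le_of_eq ?_)
    rw [ENNReal.mul_rpow_of_nonneg _ _ (by norm_num), ← ENNReal.rpow_natCast, ← ENNReal.rpow_mul]
    norm_num
  set W : ℝ≥0∞ := energy σ φ ^ (1 / 2 : ℝ) with hW
  have hWfin : W < ∞ := ENNReal.rpow_lt_top_of_nonneg (by norm_num) hE.ne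
  have hFC : Tendsto (fun N => ∫ s in (0 : ℝ)..t, fourierPairing (sineMul (t - s) (Φ N)) (F s)) atTop
      (nhds (∫ s in (0 : ℝ)..t, fourierPairing (sineMul (t - s) φ) (F s))) := by
    set D : ℝ → ℝ≥0∞ := fun s => C * dualNorm σ (F s) * (ENNReal.ofReal t * W) with hD
    have hDm : Measurable D := (hFdm.const_mul _).mul_const _
    have hW1 : ENNReal.ofReal t * W ≠ ∞ := (ENNReal.mul_lt_top ENNReal.ofReal_lt_top hWfin).ne
    have hDint : ∫⁻ s in Ioc 0 t, D s < ∞ := by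
      rw [hD, lintegral_mul_const' _ _ hW1, lintegral_const_mul' _ _ ENNReal.coe_ne_top]
      refine ENNReal.mul_lt_top (ENNReal.mul_lt_top ENNReal.coe_lt_top ?_) hW1.lt_top
      exact (lintegral_mono_set hsub).trans_lt hFd
    refine intervalIntegral.tendsto_integral_filter_of_dominated_convergence (fun s => (D s).toReal)
      (Eventually.of_forall fun N => ?_) (Eventually.of_forall fun N => ?_) ?_ ?_
    · exact (measurable_fourierPairing (measurable_uncurry_sineMul (hΦm N)
        (measurable_const.sub measurable_id)) hF).aestronglyMeasurable
    · rw [← ae_restrict_iff' measurableSet_uIoc, uIoc_of_le ht]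
      filter_upwards [hfin, ae_restrict_mem measurableSet_Ioc] with s hs hst
      rw [← toReal_enorm]
      refine ENNReal.toReal_mono ?_ ?_
      · exact (ENNReal.mul_lt_top (ENNReal.mul_lt_top ENNReal.coe_lt_top hs) hW1.lt_top).ne
      · refine (hpair s hst _ (hΦm N) (Φ N).integrable).1.trans ?_
        exact mul_le_mul_right (mul_le_mul_right (ENNReal.rpow_le_rpow (hEle N) (by norm_num)) _) _
    · rw [intervalIntegrable_iff_integrableOn_Ioc_of_le ht]
      exact integrable_toReal_of_lintegral_ne_top hDm.aemeasurable hDint.ne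
    · rw [← ae_restrict_iff' measurableSet_uIoc, uIoc_of_le ht]
      filter_upwards [hfin, ae_restrict_mem measurableSet_Ioc] with s hs hst
      rw [tendsto_iff_edist_tendsto_0]
      have e0 : Tendsto (fun N => C * dualNorm σ (F s) * (ENNReal.ofReal t *
          energy σ (fun ξ => Φ N ξ - φ ξ) ^ (1 / 2 : ℝ))) atTop (nhds 0) := by
        have e1 := (tendsto_energy_sub_zero hφm hΦm hE hΦle hpt).ennrpow_const (1 / 2 : ℝ)
        have e2 := ENNReal.Tendsto.const_mul (a := C * dualNorm σ (F s))
          (ENNReal.Tendsto.const_mul (a := ENNReal.ofReal t) e1 (Or.inr ENNReal.ofReal_ne_top))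
          (Or.inr (ENNReal.mul_lt_top ENNReal.coe_lt_top hs).ne)
        simpa using e2
      refine tendsto_of_tendsto_of_tendsto_of_le_of_le tendsto_const_nhds e0 (fun _ => bot_le)
        fun N => ?_
      simp only [edist_eq_enorm_sub]
      have e3 := fourierPairing_sub (integrable_sineMul (Φ N).integrable (t - s))
        (integrable_sineMul φ.integrable (t - s))
        ((hpair s hst _ (hΦm N) (Φ N).integrable).2 hs ((hEle N).trans_lt hE))
        ((hpair s hst _ hφm φ.integrable).2 hs hE)
      have e4 : (fun ξ => sineMul (t - s) (Φ N) ξ - sineMul (t - s) φ ξ) =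
          sineMul (t - s) (fun ξ => Φ N ξ - φ ξ) := by
        funext ξ; simp only [sineMul]; ring
      rw [← e3, e4]
      exact (hpair s hst _ ((hΦm N).sub hφm) ((Φ N).integrable.sub φ.integrable)).1
  exact tendsto_nhds_unique hleft (((hA.add hB).add hFC).congr fun N => (hmain N).symm)

/-! ### Cosine and sine waves -/

theorem measurable_weight_sphereSq {n : ℕ} {v : ℝ → Rn n → ℂ} (hv : Measurable (Function.uncurry v))
    (P w : ℝ) : Measurable (fun z : ℝ × Ioi (0 : ℝ) =>
      ENNReal.ofReal (z.2.1 ^ w) * sphereSq (v z.1) z.2.1 ^ (P / 2)) := by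
  have h1 : Measurable (fun z : ℝ × Ioi (0 : ℝ) => z.2.1) := measurable_subtype_coe.comp measurable_snd
  exact (h1.pow_const w).ennreal_ofReal.mul ((Measurable.sphereSq hv measurable_fst h1).pow_const _)

theorem sphereSq_add_le {n : ℕ} {f g : Rn n → ℂ} (hf : Measurable f) (r : ℝ) :
    sphereSq (fun x => f x + g x) r ≤ 2 * sphereSq f r + 2 * sphereSq g r := by
  unfold sphereSq
  have hm : Measurable (fun ω : unitSphere n => 2 * ‖f (r • ω.1)‖ₑ ^ 2) :=
    ((hf.comp (measurable_subtype_coe.const_smul r)).enorm.pow_const 2).const_mul 2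
  rw [← lintegral_const_mul' _ _ (by norm_num), ← lintegral_const_mul' _ _ (by norm_num),
    ← lintegral_add_left hm]
  refine lintegral_mono fun ω => ?_
  have h1 := ENNReal.rpow_add_le_mul_rpow_add_rpow ‖f (r • ω.1)‖ₑ ‖g (r • ω.1)‖ₑ
    (p := 2) (by norm_num)
  norm_num at h1
  simp only
  rw [← mul_add]
  exact (pow_le_pow_left' (enorm_add_le _ _) 2).trans h1

theorem mixedEnergy_add_le {n : ℕ} {P w : ℝ} (hP : 2 ≤ P) {v₁ v₂ : ℝ → Rn n → ℂ}
    (h₁ : Measurable (Function.uncurry v₁)) :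
    mixedEnergy P w (fun t x => v₁ t x + v₂ t x) ≤
      2 ^ P * (mixedEnergy P w v₁ + mixedEnergy P w v₂) := by
  have hP0 : 0 ≤ P / 2 := by linarith
  have hm := measurable_weight_sphereSq h₁ P w
  have h2top : (2 : ℝ≥0∞) ^ P ≠ ∞ := ENNReal.rpow_ne_top_of_nonneg (by linarith) (by norm_num)
  have hpt : ∀ t, ∀ r : Ioi (0 : ℝ), ENNReal.ofReal (r.1 ^ w) *
      sphereSq (fun x => v₁ t x + v₂ t x) r.1 ^ (P / 2) ≤ 2 ^ P *
      (ENNReal.ofReal (r.1 ^ w) * sphereSq (v₁ t) r.1 ^ (P / 2) +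
        ENNReal.ofReal (r.1 ^ w) * sphereSq (v₂ t) r.1 ^ (P / 2)) := by
    intro t r
    have e1 := sphereSq_add_le (g := v₂ t) (h₁.of_uncurry_left (x := t)) r.1
    have e2 := ENNReal.rpow_add_le_mul_rpow_add_rpow (sphereSq (v₁ t) r.1) (sphereSq (v₂ t) r.1)
      (p := P / 2) (by linarith)
    calc _ ≤ ENNReal.ofReal (r.1 ^ w) * (2 * (sphereSq (v₁ t) r.1 + sphereSq (v₂ t) r.1)) ^ (P / 2) := by
          rw [mul_add]
          exact mul_le_mul_right (ENNReal.rpow_le_rpow e1 hP0) _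
      _ ≤ ENNReal.ofReal (r.1 ^ w) * (2 ^ (P / 2) * (2 ^ (P / 2) *
          (sphereSq (v₁ t) r.1 ^ (P / 2) + sphereSq (v₂ t) r.1 ^ (P / 2)))) := by
          rw [ENNReal.mul_rpow_of_nonneg _ _ hP0]
          refine mul_le_mul_right (mul_le_mul_right (e2.trans (mul_le_mul_left ?_ _)) _) _
          exact ENNReal.rpow_le_rpow_of_exponent_le (by norm_num) (by linarith)
      _ = _ := by
          rw [← mul_assoc (2 ^ (P / 2)), ← ENNReal.rpow_add _ _ (by norm_num) (by norm_num), add_halves]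
          ring
  unfold mixedEnergy
  calc _ ≤ ∫⁻ t, ∫⁻ r : Ioi (0 : ℝ), 2 ^ P *
      (ENNReal.ofReal (r.1 ^ w) * sphereSq (v₁ t) r.1 ^ (P / 2) +
        ENNReal.ofReal (r.1 ^ w) * sphereSq (v₂ t) r.1 ^ (P / 2)) ∂(Measure.volumeIoiPow (n - 1)) :=
        lintegral_mono fun t => lintegral_mono fun r => hpt t r
    _ = ∫⁻ t, 2 ^ P * ((∫⁻ r : Ioi (0 : ℝ), ENNReal.ofReal (r.1 ^ w) * sphereSq (v₁ t) r.1 ^ (P / 2)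
          ∂(Measure.volumeIoiPow (n - 1))) + ∫⁻ r : Ioi (0 : ℝ),
        ENNReal.ofReal (r.1 ^ w) * sphereSq (v₂ t) r.1 ^ (P / 2) ∂(Measure.volumeIoiPow (n - 1))) := by
        refine lintegral_congr fun t => ?_
        rw [lintegral_const_mul' _ _ h2top, lintegral_add_left]
        exact hm.of_uncurry_left (f := fun t (r : Ioi (0 : ℝ)) =>
          ENNReal.ofReal (r.1 ^ w) * sphereSq (v₁ t) r.1 ^ (P / 2))
    _ = _ := by
        rw [lintegral_const_mul' _ _ h2top, lintegral_add_left]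
        exact hm.lintegral_prod_right'

theorem mixedEnergy_const_mul {n : ℕ} {P w : ℝ} (hP : 0 < P) (c : ℂ) (v : ℝ → Rn n → ℂ) :
    mixedEnergy P w (fun t x => c * v t x) = ‖c‖ₑ ^ P * mixedEnergy P w v := by
  have hc : ‖c‖ₑ ^ P ≠ ∞ := ENNReal.rpow_ne_top_of_nonneg hP.le enorm_ne_top
  have h1 : ∀ t r, sphereSq (fun x => c * v t x) r ^ (P / 2) = ‖c‖ₑ ^ P * sphereSq (v t) r ^ (P / 2) := by
    intro t r
    unfold sphereSq
    simp only [enorm_mul, mul_pow]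
    rw [lintegral_const_mul' _ _ (ENNReal.pow_ne_top enorm_ne_top),
      ENNReal.mul_rpow_of_nonneg _ _ (by linarith), ← ENNReal.rpow_natCast, ← ENNReal.rpow_mul]
    congr 2
    push_cast; ring
  unfold mixedEnergy
  rw [← lintegral_const_mul' _ _ hc]
  refine lintegral_congr fun t => ?_
  rw [← lintegral_const_mul' _ _ hc]
  refine lintegral_congr fun r => ?_
  rw [h1]; ring

theorem energy_comp_neg {n : ℕ} (s : ℝ) (w : Rn n → ℂ) : energy s (fun ξ => w (-ξ)) = energy s w := by
  unfold energy
  rw [← lintegral_neg_eq_self (fun ξ => ENNReal.ofReal (‖ξ‖ ^ (2 * s)) * ‖w ξ‖ₑ ^ 2)]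
  simp only [norm_neg]

theorem osc_neg_left {V : Type*} [NormedAddCommGroup V] [InnerProductSpace ℝ V] (w x : V) :
    osc (-w) x = osc w (-x) := by
  unfold osc; rw [inner_neg_left, inner_neg_right]

theorem cos_eq_osc (t y : ℝ) : (Real.cos (t * (2 * Real.pi * y)) : ℂ) =
    1 / 2 * (osc t (1 * y) + osc t (-1 * y)) := by
  rw [Complex.ofReal_cos, Complex.cos]
  unfold osc
  simp only [RCLike.inner_apply, conj_trivial]
  push_cast
  ring_nf

theorem sin_eq_osc (t y : ℝ) : (Real.sin (t * (2 * Real.pi * y)) : ℂ) =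
    Complex.I / 2 * (osc t (1 * y) - osc t (-1 * y)) := by
  rw [Complex.ofReal_sin, Complex.sin]
  unfold osc
  simp only [RCLike.inner_apply, conj_trivial]
  push_cast
  ring_nf

theorem integrable_halfWave_integrand {n : ℕ} {h : Rn n → ℂ} (hh : Integrable h) (ς t : ℝ) (x : Rn n) :
    Integrable (fun ξ => osc ξ x * (osc t (ς * ‖ξ‖) * h ξ)) := by
  refine integrable_osc_mul ?_ x
  refine hh.bdd_mul (c := 1) ?_ (Eventually.of_forall fun z => (norm_osc _ _).le)
  have h1 : Continuous (fun ξ : Rn n => osc t (ς * ‖ξ‖)) := by fun_prop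
  exact h1.aestronglyMeasurable

/-- The wave `cos(t√-Δ)` with initial data given by the inverse Fourier transform of `w`. -/
def cosWave {n : ℕ} (w : Rn n → ℂ) (t : ℝ) (x : Rn n) : ℂ :=
  ∫ ξ, osc ξ (-x) * ((Real.cos (t * (2 * Real.pi * ‖ξ‖)) : ℂ) * w ξ)

/-- The wave `sin(t√-Δ)/√-Δ` with initial velocity given by the inverse Fourier transform of `w`. -/
def sineWave {n : ℕ} (w : Rn n → ℂ) (t : ℝ) (x : Rn n) : ℂ :=
  ∫ ξ, osc ξ (-x) * sineMul t w ξ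

theorem cosWave_eq {n : ℕ} {w : Rn n → ℂ} (hw : Integrable w) (t : ℝ) (x : Rn n) :
    cosWave w t x = 1 / 2 * (halfWave 1 (fun ξ => w (-ξ)) t x + halfWave (-1) (fun ξ => w (-ξ)) t x) := by
  have hw' : Integrable (fun ξ => w (-ξ)) := hw.comp_neg
  unfold cosWave halfWave
  rw [← integral_add (integrable_halfWave_integrand hw' _ _ _) (integrable_halfWave_integrand hw' _ _ _),
    ← integral_const_mul, ← integral_neg_eq_self]
  congr 1; ext ξ
  rw [osc_neg_left, neg_neg, norm_neg, cos_eq_osc]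
  ring

theorem sineWave_eq {n : ℕ} (hn : 0 < n) {w : Rn n → ℂ}
    (hw : Integrable (fun ξ => ((2 * Real.pi * ‖ξ‖ : ℝ) : ℂ)⁻¹ * w ξ)) (t : ℝ) (x : Rn n) :
    sineWave w t x = Complex.I / 2 *
      (halfWave 1 (fun ξ => ((2 * Real.pi * ‖ξ‖ : ℝ) : ℂ)⁻¹ * w (-ξ)) t x -
        halfWave (-1) (fun ξ => ((2 * Real.pi * ‖ξ‖ : ℝ) : ℂ)⁻¹ * w (-ξ)) t x) := by
  have : Nonempty (Fin n) := ⟨⟨0, hn⟩⟩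
  have hw' : Integrable (fun ξ => ((2 * Real.pi * ‖ξ‖ : ℝ) : ℂ)⁻¹ * w (-ξ)) := by
    simpa only [norm_neg] using hw.comp_neg
  unfold sineWave halfWave
  rw [← integral_sub (integrable_halfWave_integrand hw' _ _ _) (integrable_halfWave_integrand hw' _ _ _),
    ← integral_const_mul, ← integral_neg_eq_self]
  have hae : ∀ᵐ ξ : Rn n, ξ ≠ 0 := by
    rw [ae_iff]; simp
  refine integral_congr_ae ?_
  filter_upwards [hae] with ξ hξ
  have h0 : 2 * Real.pi * ‖ξ‖ ≠ 0 := by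
    have := norm_pos_iff.2 hξ
    positivity
  rw [osc_neg_left, neg_neg, sineMul, norm_neg, sineKernel_of_ne_zero _ h0, Complex.ofReal_div, sin_eq_osc,
    div_eq_mul_inv]
  ring

theorem mixedEnergy_combination_le {n : ℕ} {P w : ℝ} (hP : 2 ≤ P) {v₁ v₂ : ℝ → Rn n → ℂ}
    (h₁ : Measurable (Function.uncurry v₁)) {c d : ℂ} (hc : ‖c‖ ≤ 1) (hd : ‖d‖ ≤ 1) :
    mixedEnergy P w (fun t x => c * (v₁ t x + d * v₂ t x)) ≤
      2 ^ P * (mixedEnergy P w v₁ + mixedEnergy P w v₂) := by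
  have hone : ∀ e : ℂ, ‖e‖ ≤ 1 → ‖e‖ₑ ^ P ≤ 1 := fun e he =>
    ENNReal.rpow_le_one (by rw [← ofReal_norm]; exact ENNReal.ofReal_le_one.2 he) (by linarith)
  rw [mixedEnergy_const_mul (by linarith)]
  refine (mul_le_of_le_one_left bot_le (hone c hc)).trans ((mixedEnergy_add_le hP h₁).trans ?_)
  rw [mixedEnergy_const_mul (by linarith)]
  exact mul_le_mul_right (add_le_add le_rfl (mul_le_of_le_one_left bot_le (hone d hd))) _

theorem exists_cosWave_bound (n : ℕ) (hn : 0 < n) {P γ : ℝ} (hP : 2 ≤ P) (hγ : 0 ≤ γ)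
    (hγ₁ : 1 / 2 - 1 / P < γ) (hγ₂ : γ < n / 2 - 1 / P) :
    ∃ C : ℝ≥0, ∀ h : Rn n → ℂ, Measurable h → Integrable h →
    mixedEnergy P (P * (n / 2 - γ) - (n + 1)) (cosWave h) ≤ C * energy γ h ^ (P / 2) := by
  obtain ⟨C, hC⟩ := exists_halfWave_bound n hn hP hγ hγ₁ hγ₂
  refine ⟨2 ^ P * (2 * C), fun h hhm hh => ?_⟩
  have hm : Measurable (fun ξ => h (-ξ)) := hhm.comp measurable_neg
  have h1 : cosWave h = fun t x => 1 / 2 * (halfWave 1 (fun ξ => h (-ξ)) t x +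
      1 * halfWave (-1) (fun ξ => h (-ξ)) t x) := by
    funext t x
    rw [cosWave_eq hh, one_mul]
  rw [h1]
  refine (mixedEnergy_combination_le hP (measurable_halfWave 1 hm) (by norm_num) (by norm_num)).trans ?_
  have e1 := hC 1 (by simp) _ hm hh.comp_neg
  have e2 := hC (-1) (by simp) _ hm hh.comp_neg
  rw [energy_comp_neg] at e1 e2
  refine (mul_le_mul_right (add_le_add e1 e2) _).trans (le_of_eq ?_)
  rw [ENNReal.coe_mul, ENNReal.coe_mul, ENNReal.coe_rpow_of_nonneg _ (by linarith)]
  push_cast; ring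

theorem lintegral_ball_rpow_lt_top {n : ℕ} (hn : 0 < n) {a : ℝ} (ha : a < n) :
    ∫⁻ ξ : Rn n in Metric.ball 0 1, ENNReal.ofReal (‖ξ‖ ^ (-a)) < ∞ := by
  have hm : Measurable (fun ξ : Rn n => (Metric.ball (0 : Rn n) 1).indicator
      (fun ξ => ENNReal.ofReal (‖ξ‖ ^ (-a))) ξ) :=
    (measurable_norm.pow_const _).ennreal_ofReal.indicator measurableSet_ball
  rw [← lintegral_indicator measurableSet_ball, lintegral_polar hn hm]
  have h1 : ∀ r : Ioi (0 : ℝ), ∫⁻ ω : unitSphere n, (Metric.ball (0 : Rn n) 1).indicator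
      (fun ξ => ENNReal.ofReal (‖ξ‖ ^ (-a))) (r.1 • ω.1) ∂(sphereMeasure n) =
      (Iio (1 : ℝ)).indicator (fun r => ENNReal.ofReal (r ^ (-a))) r.1 * sphereMeasure n univ := by
    intro r
    rw [← lintegral_const]
    refine lintegral_congr fun ω => ?_
    have h2 : ‖r.1 • ω.1‖ = r.1 := by
      have h3 : ‖ω.1‖ = 1 := by simp
      rw [norm_smul, h3, mul_one, Real.norm_of_nonneg (le_of_lt r.2)]
    simp only [indicator, mem_ball_zero_iff, h2, mem_Iio]
  simp only [h1]
  have hmi : Measurable ((Iio (1 : ℝ)).indicator (fun r : ℝ => ENNReal.ofReal (r ^ (-a)))) :=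
    (measurable_id.pow_const _).ennreal_ofReal.indicator measurableSet_Iio
  rw [lintegral_mul_const' _ _ (measure_ne_top _ _), lintegral_volumeIoiPow _ hmi]
  refine ENNReal.mul_lt_top ?_ (measure_lt_top _ _)
  have h3 : ∫⁻ r in Ioi (0 : ℝ), ENNReal.ofReal (r ^ (n - 1)) *
      (Iio (1 : ℝ)).indicator (fun r : ℝ => ENNReal.ofReal (r ^ (-a))) r =
      ∫⁻ r in Ioo (0 : ℝ) 1, ENNReal.ofReal (r ^ ((n : ℝ) - 1 - a)) := by
    rw [← lintegral_indicator measurableSet_Ioi, ← lintegral_indicator measurableSet_Ioo]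
    refine lintegral_congr fun r => ?_
    by_cases h0 : 0 < r <;> by_cases h4 : r < 1 <;> simp only [indicator, mem_Ioi, mem_Iio, mem_Ioo, h0, h4,
      and_self, and_true, and_false, if_true, if_false, mul_zero]
    rw [← ENNReal.ofReal_mul (by positivity), ← Real.rpow_natCast, ← Real.rpow_add h0, Nat.cast_sub hn]
    congr 2; push_cast; ring
  rw [h3]
  have h5 := (intervalIntegral.intervalIntegrable_rpow' (a := 0) (b := 1) (r := (n : ℝ) - 1 - a)
    (by linarith)).1
  have h6 := (h5.mono_set (Ioo_subset_Ioc_self)).2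
  refine lt_of_le_of_lt (lintegral_mono fun r => ?_) h6
  rw [← ofReal_norm]
  exact ENNReal.ofReal_le_ofReal (Real.le_norm_self _)

theorem integrable_inv_norm_mul {n : ℕ} (hn : 0 < n) {γ : ℝ} (hγ : 2 * γ < n) {w : Rn n → ℂ}
    (hw : Measurable w) (hwi : Integrable w) (hE : energy (γ - 1) w < ∞) :
    Integrable (fun ξ => ((2 * Real.pi * ‖ξ‖ : ℝ) : ℂ)⁻¹ * w ξ) := by
  have : Nonempty (Fin n) := ⟨⟨0, hn⟩⟩
  have hm : Measurable (fun ξ : Rn n => ((2 * Real.pi * ‖ξ‖ : ℝ) : ℂ)⁻¹ * w ξ) :=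
    (Complex.measurable_ofReal.comp (measurable_norm.const_mul _)).inv.mul hw
  have hnorm : ∀ ξ : Rn n, ‖((2 * Real.pi * ‖ξ‖ : ℝ) : ℂ)⁻¹ * w ξ‖ ≤ ‖ξ‖⁻¹ * ‖w ξ‖ := by
    intro ξ
    rw [norm_mul, norm_inv, Complex.norm_real, Real.norm_of_nonneg (by positivity)]
    refine mul_le_mul_of_nonneg_right ?_ (norm_nonneg _)
    rw [mul_inv]
    refine mul_le_of_le_one_left (by positivity) (inv_le_one_of_one_le₀ ?_)
    linarith [Real.pi_gt_three]
  rw [← integrableOn_univ, ← union_compl_self (Metric.ball (0 : Rn n) 1)]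
  refine IntegrableOn.union ⟨hm.aestronglyMeasurable, ?_⟩ ?_
  · have hae : ∀ᵐ ξ : Rn n ∂(volume.restrict (Metric.ball 0 1)), ξ ≠ 0 :=
      ae_restrict_of_ae (by rw [ae_iff]; simp)
    have hcs := lintegral_mul_sq_le (μ := volume.restrict (Metric.ball (0 : Rn n) 1))
      (f := fun ξ => ENNReal.ofReal (‖ξ‖ ^ (-γ))) (g := fun ξ => ENNReal.ofReal (‖ξ‖ ^ (γ - 1)) * ‖w ξ‖ₑ)
      ((measurable_norm.pow_const _).ennreal_ofReal.aemeasurable)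
      (((measurable_norm.pow_const _).ennreal_ofReal.mul hw.enorm).aemeasurable)
    have e1 : ∀ ξ : Rn n, ENNReal.ofReal (‖ξ‖ ^ (-γ)) ^ 2 = ENNReal.ofReal (‖ξ‖ ^ (-(2 * γ))) := by
      intro ξ
      rw [← ENNReal.ofReal_pow (by positivity), ← Real.rpow_natCast, ← Real.rpow_mul (norm_nonneg _)]
      congr 2; push_cast; ring
    have e2 : ∀ ξ : Rn n, (ENNReal.ofReal (‖ξ‖ ^ (γ - 1)) * ‖w ξ‖ₑ) ^ 2 =
        ENNReal.ofReal (‖ξ‖ ^ (2 * (γ - 1))) * ‖w ξ‖ₑ ^ 2 := by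
      intro ξ
      rw [mul_pow, ← ENNReal.ofReal_pow (by positivity), ← Real.rpow_natCast,
        ← Real.rpow_mul (norm_nonneg _)]
      congr 3; push_cast; ring
    simp only [e1, e2] at hcs
    have e3 : (∫⁻ ξ in Metric.ball (0 : Rn n) 1, ENNReal.ofReal (‖ξ‖ ^ (-γ)) *
        (ENNReal.ofReal (‖ξ‖ ^ (γ - 1)) * ‖w ξ‖ₑ)) ^ 2 < ∞ :=
      hcs.trans_lt (ENNReal.mul_lt_top (lintegral_ball_rpow_lt_top hn hγ)
        ((setLIntegral_le_lintegral _ _).trans_lt hE))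
    have e4 : ∫⁻ ξ in Metric.ball (0 : Rn n) 1, ENNReal.ofReal (‖ξ‖ ^ (-γ)) *
        (ENNReal.ofReal (‖ξ‖ ^ (γ - 1)) * ‖w ξ‖ₑ) < ∞ := by
      by_contra hcon
      rw [not_lt, top_le_iff] at hcon
      rw [hcon] at e3
      simp at e3
    refine lt_of_le_of_lt (lintegral_mono_ae ?_) e4
    filter_upwards [hae] with ξ hξ
    have hp := norm_pos_iff.2 hξ
    rw [← mul_assoc, ← ENNReal.ofReal_mul (by positivity), ← Real.rpow_add hp,
      show -γ + (γ - 1) = -1 by ring, Real.rpow_neg_one, ← ofReal_norm (w ξ),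
      ← ENNReal.ofReal_mul (by positivity), ← ofReal_norm]
    exact ENNReal.ofReal_le_ofReal (hnorm ξ)
  · refine (hwi.norm.integrableOn).mono' hm.aestronglyMeasurable ?_
    filter_upwards [ae_restrict_mem measurableSet_ball.compl] with ξ hξ
    refine (hnorm ξ).trans (mul_le_of_le_one_left (norm_nonneg _) (inv_le_one_of_one_le₀ ?_))
    simpa using hξ

theorem exists_sineWave_bound (n : ℕ) (hn : 0 < n) {P γ : ℝ} (hP : 2 ≤ P) (hγ : 0 ≤ γ)
    (hγ₁ : 1 / 2 - 1 / P < γ) (hγ₂ : γ < n / 2 - 1 / P) :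
    ∃ C : ℝ≥0, ∀ h : Rn n → ℂ, Measurable h → Integrable h → energy (γ - 1) h < ∞ →
    mixedEnergy P (P * (n / 2 - γ) - (n + 1)) (sineWave h) ≤ C * energy (γ - 1) h ^ (P / 2) := by
  obtain ⟨C, hC⟩ := exists_halfWave_bound n hn hP hγ hγ₁ hγ₂
  have : Nonempty (Fin n) := ⟨⟨0, hn⟩⟩
  have h2γ : 2 * γ < n := by
    have : 0 < 1 / P := by positivity
    linarith
  refine ⟨2 ^ P * (2 * C), fun h hhm hh hE => ?_⟩
  have hi := integrable_inv_norm_mul hn h2γ hhm hh hE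
  set k : Rn n → ℂ := fun ξ => ((2 * Real.pi * ‖ξ‖ : ℝ) : ℂ)⁻¹ * h (-ξ) with hk
  have hki : Integrable k := by
    have := hi.comp_neg
    simpa only [norm_neg] using this
  have hm : Measurable k :=
    (Complex.measurable_ofReal.comp (measurable_norm.const_mul _)).inv.mul (hhm.comp measurable_neg)
  have h1 : sineWave h = fun t x => Complex.I / 2 * (halfWave 1 k t x + (-1) * halfWave (-1) k t x) := by
    funext t x
    rw [sineWave_eq hn hi]; ring
  have hen : energy γ k ≤ energy (γ - 1) h := by
    rw [← energy_comp_neg (γ - 1) h]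
    unfold energy
    have hae : ∀ᵐ ξ : Rn n, ξ ≠ 0 := by rw [ae_iff]; simp
    refine lintegral_mono_ae ?_
    filter_upwards [hae] with ξ hξ
    have hp := norm_pos_iff.2 hξ
    rw [hk]
    simp only
    rw [enorm_mul, mul_pow, ← mul_assoc]
    refine mul_le_mul_left ?_ _
    rw [← ofReal_norm, norm_inv, Complex.norm_real, Real.norm_of_nonneg (by positivity),
      ← ENNReal.ofReal_pow (by positivity), ← ENNReal.ofReal_mul (by positivity)]
    refine ENNReal.ofReal_le_ofReal ?_
    rw [show 2 * (γ - 1) = 2 * γ + -2 by ring, Real.rpow_add hp]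
    refine mul_le_mul_of_nonneg_left ?_ (by positivity)
    rw [Real.rpow_neg hp.le, inv_pow]
    norm_num
    refine inv_anti₀ (by positivity) (pow_le_pow_left₀ hp.le ?_ 2)
    have := Real.pi_gt_three
    nlinarith
  rw [h1]
  refine (mixedEnergy_combination_le hP (measurable_halfWave 1 hm) (by norm_num) (by norm_num)).trans ?_
  have e1 := (hC 1 (by simp) _ hm hki).trans
    (mul_le_mul_right (ENNReal.rpow_le_rpow hen (by linarith : 0 ≤ P / 2)) _)
  have e2 := (hC (-1) (by simp) _ hm hki).trans
    (mul_le_mul_right (ENNReal.rpow_le_rpow hen (by linarith : 0 ≤ P / 2)) _)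
  refine (mul_le_mul_right (add_le_add e1 e2) _).trans (le_of_eq ?_)
  rw [ENNReal.coe_mul, ENNReal.coe_mul, ENNReal.coe_rpow_of_nonneg _ (by linarith)]
  push_cast; ring

/-! ### Fatou's lemma and Minkowski's inequality for the mixed energy -/

/-- Fatou's lemma for the mixed energy with respect to a measure in time. -/
theorem lintegral_sphereSq_le_of_tendsto {n : ℕ} {μ : Measure ℝ} {P w : ℝ} (hP : 0 ≤ P)
    {v : ℝ → Rn n → ℂ} {V : ℕ → ℝ → Rn n → ℂ} (hV : ∀ k, Measurable (Function.uncurry (V k)))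
    (hlim : ∀ᵐ t ∂μ, ∀ᵐ r : Ioi (0 : ℝ) ∂(Measure.volumeIoiPow (n - 1)),
      ∀ᵐ ω ∂(sphereMeasure n), Tendsto (fun k => V k t (r.1 • ω.1)) atTop (nhds (v t (r.1 • ω.1))))
    {B : ℝ≥0∞} (hB : ∀ k, ∫⁻ t, ∫⁻ r : Ioi (0 : ℝ), ENNReal.ofReal (r.1 ^ w) *
      sphereSq (V k t) r.1 ^ (P / 2) ∂(Measure.volumeIoiPow (n - 1)) ∂μ ≤ B) :
    ∫⁻ t, ∫⁻ r : Ioi (0 : ℝ), ENNReal.ofReal (r.1 ^ w) *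
      sphereSq (v t) r.1 ^ (P / 2) ∂(Measure.volumeIoiPow (n - 1)) ∂μ ≤ B := by
  have hm := fun k => measurable_weight_sphereSq (hV k) P w
  have h1 : ∀ᵐ t ∂μ, ∀ᵐ r : Ioi (0 : ℝ) ∂(Measure.volumeIoiPow (n - 1)),
      ENNReal.ofReal (r.1 ^ w) * sphereSq (v t) r.1 ^ (P / 2) ≤
      liminf (fun k => ENNReal.ofReal (r.1 ^ w) * sphereSq (V k t) r.1 ^ (P / 2)) atTop := by
    filter_upwards [hlim] with t ht
    filter_upwards [ht] with r hr
    have h2 : sphereSq (v t) r.1 ≤ liminf (fun k => sphereSq (V k t) r.1) atTop := by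
      unfold sphereSq
      refine le_trans (lintegral_mono_ae ?_) (lintegral_liminf_le fun k => ?_)
      · filter_upwards [hr] with ω hω
        have h3 : Tendsto (fun k => ‖V k t (r.1 • ω.1)‖ₑ ^ 2) atTop
            (nhds (‖v t (r.1 • ω.1)‖ₑ ^ 2)) := ENNReal.Tendsto.pow hω.enorm
        exact h3.liminf_eq.ge
      · have h4 : Measurable (V k t) := (hV k).of_uncurry_left
        exact (h4.comp (measurable_subtype_coe.const_smul r.1)).enorm.pow_const 2
    set φ : ℝ≥0∞ → ℝ≥0∞ := fun y => ENNReal.ofReal (r.1 ^ w) * y ^ (P / 2) with hφ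
    have hmono : Monotone φ := fun a b hab =>
      mul_le_mul_right (ENNReal.rpow_le_rpow hab (by linarith)) _
    have hcont : Continuous φ :=
      (ENNReal.continuous_const_mul ENNReal.ofReal_ne_top).comp ENNReal.continuous_rpow_const
    exact (hmono h2).trans (hmono.map_liminf_of_continuousAt _ hcont.continuousAt).le
  calc _ ≤ ∫⁻ t, ∫⁻ r : Ioi (0 : ℝ), liminf (fun k => ENNReal.ofReal (r.1 ^ w) *
        sphereSq (V k t) r.1 ^ (P / 2)) atTop ∂(Measure.volumeIoiPow (n - 1)) ∂μ :=
        lintegral_mono_ae (h1.mono fun t ht => lintegral_mono_ae ht)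
    _ ≤ ∫⁻ t, liminf (fun k => ∫⁻ r : Ioi (0 : ℝ), ENNReal.ofReal (r.1 ^ w) *
        sphereSq (V k t) r.1 ^ (P / 2) ∂(Measure.volumeIoiPow (n - 1))) atTop ∂μ := by
        refine lintegral_mono fun t => lintegral_liminf_le fun k => ?_
        exact (hm k).of_uncurry_left (f := fun t (r : Ioi (0 : ℝ)) =>
          ENNReal.ofReal (r.1 ^ w) * sphereSq (V k t) r.1 ^ (P / 2))
    _ ≤ liminf (fun k => ∫⁻ t, ∫⁻ r : Ioi (0 : ℝ), ENNReal.ofReal (r.1 ^ w) *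
        sphereSq (V k t) r.1 ^ (P / 2) ∂(Measure.volumeIoiPow (n - 1)) ∂μ) atTop :=
        lintegral_liminf_le fun k => (hm k).lintegral_prod_right'
    _ ≤ B := liminf_le_of_le (by isBoundedDefault) fun b hb => by
        obtain ⟨k, hk⟩ := hb.exists
        exact hk.trans (hB k)

theorem mixedEnergy_le_of_lintegral {n : ℕ} {P w : ℝ} (hP : 2 ≤ P) {v : ℝ → Rn n → ℂ}
    {μ : Measure ℝ} [SFinite μ] {Q : ℝ → ℝ → Rn n → ℂ}
    (hQ : Measurable (fun z : (ℝ × ℝ) × Rn n => Q z.1.1 z.1.2 z.2))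
    (hv : ∀ t x, ‖v t x‖ₑ ≤ ∫⁻ s, ‖Q s t x‖ₑ ∂μ) {K : ℝ≥0∞} (hK : K ≠ ∞) {D : ℝ → ℝ≥0∞}
    (hD : ∀ᵐ s ∂μ, mixedEnergy P w (Q s) ≤ K * D s ^ P) :
    mixedEnergy P w v ≤ K * (∫⁻ s, D s ∂μ) ^ P := by
  have hP0 : 0 < P := by linarith
  have hS : Measurable (fun z : ℝ × (ℝ × Ioi (0 : ℝ)) => sphereSq (Q z.1 z.2.1) z.2.2.1) :=
    Measurable.sphereSq (f := fun a : ℝ × ℝ => Q a.1 a.2) hQ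
      (a := fun z : ℝ × (ℝ × Ioi (0 : ℝ)) => (z.1, z.2.1)) (ρ := fun z => z.2.2.1) (by fun_prop)
      (measurable_subtype_coe.comp (measurable_snd.comp measurable_snd))
  set g : ℝ → ℝ × Ioi (0 : ℝ) → ℝ≥0∞ := fun s z =>
    ENNReal.ofReal (z.2.1 ^ (w / P)) * sphereSq (Q s z.1) z.2.1 ^ (1 / 2 : ℝ) with hg
  have hgm : Measurable (Function.uncurry g) := by
    have h1 : Measurable (fun z : ℝ × (ℝ × Ioi (0 : ℝ)) => z.2.2.1) :=
      measurable_subtype_coe.comp (measurable_snd.comp measurable_snd)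
    exact (h1.pow_const (w / P)).ennreal_ofReal.mul (hS.pow_const _)
  have hgP : ∀ s z, g s z ^ P = ENNReal.ofReal (z.2.1 ^ w) * sphereSq (Q s z.1) z.2.1 ^ (P / 2) := by
    intro s z
    have hr : 0 < z.2.1 := z.2.2
    simp only [hg]
    rw [ENNReal.mul_rpow_of_nonneg _ _ hP0.le, ← ENNReal.rpow_mul,
      ENNReal.ofReal_rpow_of_nonneg (by positivity) hP0.le, ← Real.rpow_mul hr.le,
      div_mul_cancel₀ _ hP0.ne']
    congr 2; ring
  have hpt : ∀ t, ∀ r : Ioi (0 : ℝ), ENNReal.ofReal (r.1 ^ w) * sphereSq (v t) r.1 ^ (P / 2) ≤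
      (∫⁻ s, g s (t, r) ∂μ) ^ P := by
    intro t r
    have hr : 0 < r.1 := r.2
    have hQm : Measurable (Function.uncurry fun s (ω : unitSphere n) => ‖Q s t (r.1 • ω.1)‖ₑ) := by
      have h1 : Measurable (fun z : ℝ × unitSphere n => (((z.1, t), r.1 • z.2.1) : (ℝ × ℝ) × Rn n)) :=
        (measurable_fst.prodMk measurable_const).prodMk
          ((measurable_subtype_coe.comp measurable_snd).const_smul r.1)
      exact (hQ.comp h1).enorm
    have h1 : sphereSq (v t) r.1 ≤ (∫⁻ s, sphereSq (Q s t) r.1 ^ (1 / 2 : ℝ) ∂μ) ^ (2 : ℝ) := by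
      have h2 := lintegral_rpow_lintegral_le (ν := μ) (μ := sphereMeasure n) hQm (p := 2) (by norm_num)
      unfold sphereSq
      simp only [← ENNReal.rpow_two]
      refine le_trans (lintegral_mono fun ω => ?_) h2
      exact ENNReal.rpow_le_rpow (hv t _) (by norm_num)
    have h3 : ENNReal.ofReal (r.1 ^ (w / P)) ≠ ∞ := ENNReal.ofReal_ne_top
    simp only [hg]
    rw [lintegral_const_mul' _ _ h3, ENNReal.mul_rpow_of_nonneg _ _ hP0.le,
      ENNReal.ofReal_rpow_of_nonneg (by positivity) hP0.le, ← Real.rpow_mul hr.le,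
      div_mul_cancel₀ _ hP0.ne']
    refine mul_le_mul_right ((ENNReal.rpow_le_rpow h1 (by linarith)).trans (le_of_eq ?_)) _
    rw [← ENNReal.rpow_mul]
    congr 1; ring
  set μr := (Measure.volumeIoiPow (n - 1)) with hμr
  have hGm : Measurable (fun z : ℝ × Ioi (0 : ℝ) => (∫⁻ s, g s z ∂μ) ^ P) :=
    ((hgm.comp measurable_swap).lintegral_prod_right' (ν := μ)).pow_const P
  have hQe : ∀ s, ∫⁻ z, g s z ^ P ∂((volume : Measure ℝ).prod μr) = mixedEnergy P w (Q s) := by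
    intro s
    have h1 : Measurable (fun z => g s z ^ P) := (hgm.of_uncurry_left (x := s)).pow_const P
    rw [lintegral_prod _ h1.aemeasurable]
    simp only [hgP]
    rfl
  calc mixedEnergy P w v ≤ ∫⁻ t, ∫⁻ r, (∫⁻ s, g s (t, r) ∂μ) ^ P ∂μr :=
        lintegral_mono fun t => lintegral_mono fun r => hpt t r
    _ = ∫⁻ z, (∫⁻ s, g s z ∂μ) ^ P ∂((volume : Measure ℝ).prod μr) :=
        (lintegral_prod _ hGm.aemeasurable).symm
    _ ≤ (∫⁻ s, (∫⁻ z, g s z ^ P ∂((volume : Measure ℝ).prod μr)) ^ (1 / P) ∂μ) ^ P :=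
        lintegral_rpow_lintegral_le hgm (by linarith)
    _ ≤ (∫⁻ s, K ^ (1 / P) * D s ∂μ) ^ P := by
        refine ENNReal.rpow_le_rpow (lintegral_mono_ae ?_) hP0.le
        filter_upwards [hD] with s hs
        rw [hQe]
        refine (ENNReal.rpow_le_rpow hs (by positivity)).trans (le_of_eq ?_)
        rw [ENNReal.mul_rpow_of_nonneg _ _ (by positivity), ← ENNReal.rpow_mul,
          mul_one_div_cancel hP0.ne', ENNReal.rpow_one]
    _ = _ := by
        rw [lintegral_const_mul' _ _ (ENNReal.rpow_ne_top_of_nonneg (by positivity) hK),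
          ENNReal.mul_rpow_of_nonneg _ _ hP0.le, ← ENNReal.rpow_mul, one_div_mul_cancel hP0.ne',
          ENNReal.rpow_one]

/-! ### The forcing term -/

theorem fourierPairing_sineMul_eq {n : ℕ} {ζ G : Rn n → ℂ} (hζ : Integrable ζ) (hG : Integrable G)
    (τ : ℝ) (x : Rn n) :
    fourierPairing (sineMul τ (fun ξ => osc ξ (-x) * ζ ξ)) G =
      sineWave (fun ξ => ζ ξ * ∫ y, osc y ξ * G y) τ x := by
  have h1 : Integrable (sineMul τ (fun ξ => osc ξ (-x) * ζ ξ)) :=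
    integrable_sineMul (integrable_osc_mul hζ (-x)) τ
  have hi : Integrable (Function.uncurry fun (y ξ : Rn n) =>
      osc ξ y * (G y * sineMul τ (fun ξ => osc ξ (-x) * ζ ξ) ξ)) (volume.prod volume) := by
    refine (hG.mul_prod h1).bdd_mul (c := 1) ?_ (Eventually.of_forall fun z => (norm_osc _ _).le)
    have h1 : Continuous (fun z : Rn n × Rn n => osc z.2 z.1) := by fun_prop
    exact h1.aestronglyMeasurable
  unfold fourierPairing sineWave
  calc _ = ∫ y, ∫ ξ, osc ξ y * (G y * sineMul τ (fun ξ => osc ξ (-x) * ζ ξ) ξ) := by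
        congr 1; ext y
        rw [← integral_mul_const]
        congr 1; ext ξ; ring
    _ = ∫ ξ, ∫ y, osc ξ y * (G y * sineMul τ (fun ξ => osc ξ (-x) * ζ ξ) ξ) := integral_integral_swap hi
    _ = _ := by
        congr 1; ext ξ
        simp only [sineMul]
        have h2 : ∀ a b c d : ℂ, a * (b * (c * d)) = (a * (b * c)) * d := fun a b c d => by ring
        rw [h2, ← integral_const_mul]
        congr 1; ext y
        rw [osc_comm ξ y]; ring

theorem energy_osc_mul {n : ℕ} (s : ℝ) (ζ : Rn n → ℂ) (x : Rn n) :
    energy s (fun ξ => osc ξ x * ζ ξ) = energy s ζ := by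
  unfold energy
  refine lintegral_congr fun ξ => ?_
  rw [enorm_mul, ← ofReal_norm (osc ξ x), norm_osc, ENNReal.ofReal_one, one_mul]

theorem dualNorm_mono {n : ℕ} {s : ℝ} {F G : Rn n → ℂ} (h : ∀ x, ‖F x‖ ≤ ‖G x‖) :
    dualNorm s F ≤ dualNorm s G := by
  refine lintegral_mono fun r => mul_le_mul_right (ENNReal.rpow_le_rpow ?_ (by norm_num)) _
  exact lintegral_mono fun ω => pow_le_pow_left' (enorm_le_iff_norm_le.2 (h _)) 2

theorem measurable_uncurry_sineMul_osc {n : ℕ} {ζ : Rn n → ℂ} (hζ : Measurable ζ) {Z : Type*}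
    [MeasurableSpace Z] {τ : Z → ℝ} (hτ : Measurable τ) {X : Z → Rn n} (hX : Measurable X) :
    Measurable (Function.uncurry fun (z : Z) (ξ : Rn n) =>
      sineMul (τ z) (fun ξ => osc ξ (-X z) * ζ ξ) ξ) := by
  have h1 : Measurable (fun q : Z × Rn n => sineKernel (τ q.1) (2 * Real.pi * ‖q.2‖)) :=
    continuous_sineKernel.measurable.comp ((hτ.comp measurable_fst).prodMk
      ((measurable_norm.comp measurable_snd).const_mul _))
  have h2 : Continuous (fun q : Rn n × Rn n => osc q.2 (-q.1)) := by fun_prop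
  have h3 : Measurable (fun q : Z × Rn n => osc q.2 (-X q.1)) :=
    Measurable.comp (g := fun q : Rn n × Rn n => osc q.2 (-q.1))
      (f := fun q : Z × Rn n => (X q.1, q.2)) h2.measurable
      ((hX.comp measurable_fst).prodMk measurable_snd)
  exact (Complex.measurable_ofReal.comp h1).mul (h3.mul (hζ.comp measurable_snd))

theorem exists_instant_forcing_bound (n : ℕ) (hn : 0 < n) {P γ : ℝ} (hP : 2 ≤ P) (hγ : 0 ≤ γ)
    (hγ₁ : 1 / 2 - 1 / P < γ) (hγ₂ : γ < n / 2 - 1 / P) (hγ₃ : 1 / 2 < 1 - γ) (hγ₄ : 1 - γ < n / 2) :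
    ∃ C : ℝ≥0, ∀ ζ G : Rn n → ℂ, Measurable ζ → Integrable ζ → (∀ ξ, ‖ζ ξ‖ ≤ 1) →
    energy (1 - γ) ζ < ∞ → Measurable G → dualNorm (1 - γ) G < ∞ →
    mixedEnergy P (P * (n / 2 - γ) - (n + 1))
      (fun t x => fourierPairing (sineMul t (fun ξ => osc ξ (-x) * ζ ξ)) G) ≤
      C * dualNorm (1 - γ) G ^ P := by
  obtain ⟨C₁, hC₁⟩ := exists_sineWave_bound n hn hP hγ hγ₁ hγ₂
  obtain ⟨C₂, hC₂⟩ := exists_dual_trace_bound n hn hγ₃ hγ₄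
  obtain ⟨C₃, hC₃⟩ := exists_fourierPairing_bound n hn hγ₃ hγ₄
  refine ⟨C₁ * C₂ ^ (P / 2), fun ζ G hζm hζi hζ1 hζE hG hGd => ?_⟩
  set S : ℕ → Set (Rn n) := fun R => {y | ‖y‖ ≤ R} ∩ {y | ‖G y‖ ≤ R} with hS
  have hSm : ∀ R, MeasurableSet (S R) := fun R =>
    (measurableSet_le measurable_norm measurable_const).inter
      (measurableSet_le hG.norm measurable_const)
  set GR : ℕ → Rn n → ℂ := fun R => (S R).indicator G with hGR
  have hGRm : ∀ R, Measurable (GR R) := fun R => hG.indicator (hSm R)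
  have hGRle : ∀ R y, ‖GR R y‖ ≤ ‖G y‖ := fun R y => norm_indicator_le_norm_self _ _
  have hGRi : ∀ R, Integrable (GR R) := by
    intro R
    rw [hGR, integrable_indicator_iff (hSm R)]
    have hfin : volume (S R) < ∞ := by
      refine (measure_mono (t := Metric.closedBall 0 (R : ℝ)) fun ξ hξ => ?_).trans_lt
        measure_closedBall_lt_top
      have h1 : ‖ξ‖ ≤ R := hξ.1
      simpa using h1
    refine Measure.integrableOn_of_bounded (M := R) hfin.ne hG.aestronglyMeasurable ?_
    filter_upwards [ae_restrict_mem (hSm R)] with y hy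
    exact hy.2
  have hmeas : ∀ R, Measurable (Function.uncurry fun (t : ℝ) (x : Rn n) =>
      fourierPairing (sineMul t (fun ξ => osc ξ (-x) * ζ ξ)) (GR R)) := by
    intro R
    exact measurable_fourierPairing (Z := ℝ × Rn n)
      (h := fun z => sineMul z.1 (fun ξ => osc ξ (-z.2) * ζ ξ)) (G := fun _ => GR R)
      (measurable_uncurry_sineMul_osc hζm measurable_fst measurable_snd)
      ((hGRm R).comp measurable_snd)
  refine lintegral_sphereSq_le_of_tendsto (μ := volume) (by linarith) hmeas ?_ fun R => ?_
  · refine Eventually.of_forall fun t => Eventually.of_forall fun r => Eventually.of_forall fun ω => ?_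
    set x := r.1 • ω.1
    have hm : Measurable (sineMul t (fun ξ => osc ξ (-x) * ζ ξ)) := by
      have := measurable_uncurry_sineMul_osc hζm (Z := Unit) (τ := fun _ => t) measurable_const
        (X := fun _ => x) measurable_const
      exact this.of_uncurry_left (x := ())
    have hi : Integrable (sineMul t (fun ξ => osc ξ (-x) * ζ ξ)) :=
      integrable_sineMul (integrable_osc_mul hζi (-x)) t
    have hE : energy (1 - γ) (sineMul t (fun ξ => osc ξ (-x) * ζ ξ)) < ∞ := by
      refine (energy_sineMul_le _ _ _).trans_lt
        (ENNReal.mul_lt_top (ENNReal.pow_lt_top ENNReal.ofReal_lt_top) ?_)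
      rwa [energy_osc_mul]
    have hint := (hC₃ _ G hG hm hi).2 hGd hE
    have hFm := measurable_fourierIntegral hm
    refine tendsto_integral_of_dominated_convergence _
      (fun R => (hFm.mul (hGRm R)).aestronglyMeasurable) hint.norm (fun R => Eventually.of_forall fun y => ?_)
      (Eventually.of_forall fun y => ?_)
    · rw [norm_mul, norm_mul]
      exact mul_le_mul_of_nonneg_left (hGRle R y) (norm_nonneg _)
    · refine tendsto_const_nhds.congr' ?_
      obtain ⟨R₀, hR₀⟩ := exists_nat_ge (max ‖y‖ ‖G y‖)
      filter_upwards [eventually_ge_atTop R₀] with R hR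
      have h1 : max ‖y‖ ‖G y‖ ≤ R := hR₀.trans (by exact_mod_cast hR)
      have h2 : y ∈ S R := ⟨(le_max_left _ _).trans h1, (le_max_right _ _).trans h1⟩
      rw [hGR]
      simp only
      rw [indicator_of_mem h2]
  · have hGhat : Measurable (fun ξ => ∫ y, osc y ξ * GR R y) := measurable_fourierIntegral (hGRm R)
    set k : Rn n → ℂ := fun ξ => ζ ξ * ∫ y, osc y ξ * GR R y with hk
    have hkm : Measurable k := hζm.mul hGhat
    have hki : Integrable k := by
      have : Integrable (fun ξ => (∫ y, osc y ξ * GR R y) * ζ ξ) :=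
        hζi.bdd_mul (c := ∫ y, ‖GR R y‖) hGhat.aestronglyMeasurable
          (Eventually.of_forall fun ξ => norm_fourierIntegral_le ξ)
      refine this.congr (Eventually.of_forall fun ξ => ?_)
      simp only [hk]; ring
    have hkE : energy (γ - 1) k ≤ C₂ * dualNorm (1 - γ) G ^ 2 := by
      calc energy (γ - 1) k ≤ energy (-(1 - γ)) (fun ξ => ∫ y, osc y ξ * GR R y) := by
            rw [neg_sub]
            refine lintegral_mono fun ξ => mul_le_mul_right (pow_le_pow_left' ?_ 2) _
            rw [hk]
            simp only
            rw [enorm_mul]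
            refine mul_le_of_le_one_left bot_le ?_
            rw [← ofReal_norm]
            exact ENNReal.ofReal_le_one.2 (hζ1 ξ)
        _ ≤ C₂ * dualNorm (1 - γ) (GR R) ^ 2 := hC₂ _ (hGRm R) (hGRi R)
        _ ≤ _ := mul_le_mul_right (pow_le_pow_left' (dualNorm_mono (hGRle R)) 2) _
    have hkE' : energy (γ - 1) k < ∞ :=
      hkE.trans_lt (ENNReal.mul_lt_top ENNReal.coe_lt_top (ENNReal.pow_lt_top hGd))
    have h1 := hC₁ k hkm hki hkE'
    have h2 : (fun t x => fourierPairing (sineMul t (fun ξ => osc ξ (-x) * ζ ξ)) (GR R)) = sineWave k := by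
      funext t x
      exact fourierPairing_sineMul_eq hζi (hGRi R) t x
    calc _ = mixedEnergy P (P * (n / 2 - γ) - (n + 1)) (sineWave k) := by rw [← h2]; rfl
      _ ≤ _ := h1
      _ ≤ C₁ * (C₂ * dualNorm (1 - γ) G ^ 2) ^ (P / 2) :=
          mul_le_mul_right (ENNReal.rpow_le_rpow hkE (by linarith)) _
      _ = _ := by
          rw [ENNReal.mul_rpow_of_nonneg _ _ (by linarith), ← ENNReal.rpow_natCast (dualNorm _ _),
            ← ENNReal.rpow_mul, ENNReal.coe_mul, ENNReal.coe_rpow_of_nonneg _ (by linarith), mul_assoc]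
          congr 3; push_cast; ring

/-- The contribution of the forcing term to the solution, smoothed by the multiplier `ζ`. -/
def forcedWave {n : ℕ} (ζ : Rn n → ℂ) (F : ℝ → Rn n → ℂ) (t : ℝ) (x : Rn n) : ℂ :=
  ∫ s in Ioc 0 t, fourierPairing (sineMul (t - s) (fun ξ => osc ξ (-x) * ζ ξ)) (F s)

theorem measurable_forcedWave_kernel {n : ℕ} {ζ : Rn n → ℂ} (hζ : Measurable ζ) {F : ℝ → Rn n → ℂ}
    (hF : Measurable (Function.uncurry F)) : Measurable (fun z : (ℝ × ℝ) × Rn n =>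
      fourierPairing (sineMul (z.1.2 - z.1.1) (fun ξ => osc ξ (-z.2) * ζ ξ)) (F z.1.1)) := by
  refine measurable_fourierPairing (Z := (ℝ × ℝ) × Rn n)
      (h := fun z => sineMul (z.1.2 - z.1.1) (fun ξ => osc ξ (-z.2) * ζ ξ)) (G := fun z => F z.1.1)
      (measurable_uncurry_sineMul_osc hζ (by fun_prop) measurable_snd) ?_
  exact hF.comp (f := fun q : ((ℝ × ℝ) × Rn n) × Rn n => (q.1.1.1, q.2)) (by fun_prop)

theorem measurable_forcedWave {n : ℕ} {ζ : Rn n → ℂ} (hζ : Measurable ζ) {F : ℝ → Rn n → ℂ}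
    (hF : Measurable (Function.uncurry F)) : Measurable (Function.uncurry (forcedWave ζ F)) := by
  have h1 : Measurable (fun q : (ℝ × Rn n) × ℝ =>
      fourierPairing (sineMul (q.1.1 - q.2) (fun ξ => osc ξ (-q.1.2) * ζ ξ)) (F q.2)) :=
    (measurable_forcedWave_kernel hζ hF).comp
      (f := fun q : (ℝ × Rn n) × ℝ => ((q.2, q.1.1), q.1.2)) (by fun_prop)
  have hset : MeasurableSet {q : (ℝ × Rn n) × ℝ | q.2 ∈ Ioc 0 q.1.1} := by
    have e : {q : (ℝ × Rn n) × ℝ | q.2 ∈ Ioc 0 q.1.1} =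
        {q : (ℝ × Rn n) × ℝ | 0 < q.2} ∩ {q : (ℝ × Rn n) × ℝ | q.2 ≤ q.1.1} := rfl
    rw [e]
    exact (measurableSet_lt measurable_const measurable_snd).inter
      (measurableSet_le measurable_snd (measurable_fst.comp measurable_fst))
  have h2 := ((h1.indicator hset).stronglyMeasurable.integral_prod_right' (ν := volume)).measurable
  convert h2 using 1
  funext z
  rw [Function.uncurry, forcedWave, ← integral_indicator measurableSet_Ioc]
  rfl

theorem exists_forcedWave_bound (n : ℕ) (hn : 0 < n) {P γ : ℝ} (hP : 2 ≤ P) (hγ : 0 ≤ γ)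
    (hγ₁ : 1 / 2 - 1 / P < γ) (hγ₂ : γ < n / 2 - 1 / P) (hγ₃ : 1 / 2 < 1 - γ) (hγ₄ : 1 - γ < n / 2) :
    ∃ C : ℝ≥0, ∀ (ζ : Rn n → ℂ) (F : ℝ → Rn n → ℂ), Measurable ζ → Integrable ζ → (∀ ξ, ‖ζ ξ‖ ≤ 1) →
    energy (1 - γ) ζ < ∞ → Measurable (Function.uncurry F) →
    (∀ᵐ s ∂(volume.restrict (Ioi (0 : ℝ))), dualNorm (1 - γ) (F s) < ∞) →
    mixedEnergy P (P * (n / 2 - γ) - (n + 1)) (forcedWave ζ F) ≤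
      C * (∫⁻ s in Ioi (0 : ℝ), dualNorm (1 - γ) (F s)) ^ P := by
  obtain ⟨C, hC⟩ := exists_instant_forcing_bound n hn hP hγ hγ₁ hγ₂ hγ₃ hγ₄
  refine ⟨C, fun ζ F hζm hζi hζ1 hζE hF hFd => ?_⟩
  refine mixedEnergy_le_of_lintegral hP (μ := volume.restrict (Ioi (0 : ℝ)))
    (Q := fun s t x => fourierPairing (sineMul (t - s) (fun ξ => osc ξ (-x) * ζ ξ)) (F s))
    (measurable_forcedWave_kernel hζm hF) (fun t x => ?_) ENNReal.coe_ne_top ?_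
  · refine (enorm_integral_le_lintegral_enorm _).trans (lintegral_mono_set fun s hs => hs.1)
  · filter_upwards [hFd] with s hs
    refine le_trans (le_of_eq ?_) (hC ζ (F s) hζm hζi hζ1 hζE hF.of_uncurry_left hs)
    unfold mixedEnergy
    exact lintegral_sub_right_eq_self (fun t => ∫⁻ r : Ioi (0 : ℝ),
      ENNReal.ofReal (r.1 ^ (P * (n / 2 - γ) - (n + 1))) * sphereSq (fun x =>
        fourierPairing (sineMul t (fun ξ => osc ξ (-x) * ζ ξ)) (F s)) r.1 ^ (P / 2)
        ∂(Measure.volumeIoiPow (n - 1))) s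

/-! ### Mollification of tempered distributions -/

theorem IsRepresentedBy.locallyIntegrable {n : ℕ} {T : 𝓢'(Rn n, ℂ)} {h : Rn n → ℂ}
    (hT : IsRepresentedBy T h) : LocallyIntegrable h := by
  intro x
  let b : ContDiffBump x := ⟨1, 2, one_pos, one_lt_two⟩
  have hc : HasCompactSupport (fun y => (b y : ℂ)) :=
    b.hasCompactSupport.comp_left (g := ((↑) : ℝ → ℂ)) Complex.ofReal_zero
  have hd : ContDiff ℝ ((⊤ : ℕ∞) : WithTop ℕ∞) (fun y => (b y : ℂ)) :=
    Complex.ofRealCLM.contDiff.comp b.contDiff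
  refine ⟨Metric.ball x 1, Metric.ball_mem_nhds x one_pos, ?_⟩
  refine ((hT (hc.toSchwartzMap hd)).1.integrableOn (s := Metric.ball x 1)).congr_fun
    (fun y hy => ?_) measurableSet_ball
  have h1 : b y = 1 := b.one_of_mem_closedBall (Metric.ball_subset_closedBall hy)
  simp [h1]

/-- An approximate identity of Schwartz functions which recovers almost everywhere the function
representing a tempered distribution. -/
theorem exists_mollifiers (n : ℕ) : ∃ η : ℕ → 𝓢(Rn n, ℂ), (∀ k, ∫ x, ‖η k x‖ ≤ 1) ∧
    ∀ (T : 𝓢'(Rn n, ℂ)) (h : Rn n → ℂ), IsRepresentedBy T h →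
      ∀ᵐ x, Tendsto (fun k => T (SchwartzMap.compSubConstCLM ℂ x (η k))) atTop (nhds (h x)) := by
  let b : ℕ → ContDiffBump (0 : Rn n) := fun k =>
    ⟨1 / (k + 1), 2 * (1 / (k + 1)), by positivity, by
      have : (0 : ℝ) < 1 / (k + 1) := by positivity
      linarith⟩
  have hc : ∀ k, HasCompactSupport (fun y => ((b k).normed volume y : ℂ)) := fun k =>
    (b k).hasCompactSupport_normed.comp_left (g := ((↑) : ℝ → ℂ)) Complex.ofReal_zero
  have hd : ∀ k, ContDiff ℝ ((⊤ : ℕ∞) : WithTop ℕ∞) (fun y => ((b k).normed volume y : ℂ)) := fun k =>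
    Complex.ofRealCLM.contDiff.comp (b k).contDiff_normed
  refine ⟨fun k => (hc k).toSchwartzMap (hd k), fun k => ?_, fun T h hT => ?_⟩
  · have h1 : ∀ x, ‖(hc k).toSchwartzMap (hd k) x‖ = (b k).normed volume x := fun x => by
      rw [HasCompactSupport.toSchwartzMap_toFun, Complex.norm_real,
        Real.norm_of_nonneg ((b k).nonneg_normed x)]
    simp only [h1]
    exact (b k).integral_normed.le
  · have h1 : Tendsto (fun k => (b k).rOut) atTop (nhds 0) := by
      have := (tendsto_one_div_add_atTop_nhds_zero_nat (𝕜 := ℝ)).const_mul 2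
      rwa [mul_zero] at this
    have h2 := ContDiffBump.ae_convolution_tendsto_right_of_locallyIntegrable (μ := volume) (K := 2)
      (φ := b) h1 (Eventually.of_forall fun k => le_rfl) hT.locallyIntegrable
    filter_upwards [h2] with x hx
    refine hx.congr fun k => ?_
    rw [(hT _).2, convolution_lsmul_swap]
    refine integral_congr_ae (Eventually.of_forall fun y => ?_)
    simp only [SchwartzMap.compSubConstCLM_apply, HasCompactSupport.toSchwartzMap_toFun]
    rw [← neg_sub, (b k).normed_neg, Complex.real_smul]

theorem SchwartzMap.fourierInv_eq_osc {n : ℕ} (η : 𝓢(Rn n, ℂ)) (ξ : Rn n) :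
    (𝓕⁻ η) ξ = ∫ y, osc y (-ξ) * η y := by
  rw [SchwartzMap.fourierInv_coe, Real.fourierInv_eq_fourier_neg, fourier_eq_osc]

theorem SchwartzMap.fourierInv_compSubConstCLM {n : ℕ} (η : 𝓢(Rn n, ℂ)) (x ξ : Rn n) :
    (𝓕⁻ (SchwartzMap.compSubConstCLM ℂ x η)) ξ = osc ξ (-x) * (𝓕⁻ η) ξ := by
  rw [fourierInv_eq_osc, fourierInv_eq_osc, ← integral_const_mul,
    ← integral_add_right_eq_self _ x]
  refine integral_congr_ae (Eventually.of_forall fun y => ?_)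
  have h1 : osc (y + x) (-ξ) = osc ξ (-x) * osc y (-ξ) := by
    rw [osc, osc, osc, ← Complex.exp_add, inner_add_left, inner_neg_right, inner_neg_right,
      inner_neg_right, real_inner_comm x ξ]
    congr 1
    push_cast; ring
  simp only [SchwartzMap.compSubConstCLM_apply, add_sub_cancel_right]
  rw [h1, mul_assoc]

theorem SchwartzMap.norm_fourierInv_le {n : ℕ} {η : 𝓢(Rn n, ℂ)} (hη : ∫ x, ‖η x‖ ≤ 1) (ξ : Rn n) :
    ‖(𝓕⁻ η) ξ‖ ≤ 1 := by
  rw [fourierInv_eq_osc]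
  refine (norm_integral_le_integral_norm _).trans (le_trans (le_of_eq ?_) hη)
  simp only [norm_mul, norm_osc, one_mul]

theorem SchwartzMap.energy_lt_top {n : ℕ} {s : ℝ} (hs : 0 ≤ s) (hs' : s ≤ 1) (φ : 𝓢(Rn n, ℂ)) :
    energy s φ < ∞ := by
  obtain ⟨B, hB0, hB⟩ := φ.decay 0 0
  have hB' : ∀ x, ‖φ x‖ ≤ B := fun x => by simpa using hB x
  have h1 : Integrable (fun x => B * (‖φ x‖ + ‖x‖ ^ 2 * ‖φ x‖)) :=
    (φ.integrable.norm.add (φ.integrable_pow_mul volume 2)).const_mul B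
  refine lt_of_le_of_lt (lintegral_mono fun ξ => ?_) h1.2
  rw [← ofReal_norm (φ ξ), ← ENNReal.ofReal_pow (norm_nonneg _), ← ENNReal.ofReal_mul (by positivity),
    ← ofReal_norm]
  refine ENNReal.ofReal_le_ofReal (le_trans ?_ (Real.le_norm_self _))
  have h2 : ‖ξ‖ ^ (2 * s) ≤ 1 + ‖ξ‖ ^ 2 := by
    rcases le_total ‖ξ‖ 1 with h | h
    · exact (Real.rpow_le_one (norm_nonneg _) h (by linarith)).trans (by nlinarith [sq_nonneg ‖ξ‖])
    · refine (Real.rpow_le_rpow_of_exponent_le h (show 2 * s ≤ (2 : ℕ) by push_cast; linarith)).trans ?_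
      rw [Real.rpow_natCast]; linarith
  calc ‖ξ‖ ^ (2 * s) * ‖φ ξ‖ ^ 2 ≤ (1 + ‖ξ‖ ^ 2) * (B * ‖φ ξ‖) := by
        refine mul_le_mul h2 ?_ (by positivity) (by positivity)
        rw [sq]; exact mul_le_mul_of_nonneg_right (hB' ξ) (norm_nonneg _)
    _ = _ := by ring

/-! ### The mollified solution -/

theorem measurable_sineWave {n : ℕ} {w : Rn n → ℂ} (hw : Measurable w) :
    Measurable (Function.uncurry (sineWave w)) := by
  have h1 := ((measurable_uncurry_sineMul_osc hw (Z := ℝ × Rn n) measurable_fst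
    measurable_snd).stronglyMeasurable.integral_prod_right (ν := volume)).measurable
  convert h1 using 1
  funext z
  refine integral_congr_ae (Eventually.of_forall fun ξ => ?_)
  simp only [sineMul]
  ring

theorem measurable_cosWave {n : ℕ} {w : Rn n → ℂ} (hw : Measurable w) (hwi : Integrable w) :
    Measurable (Function.uncurry (cosWave w)) := by
  have hm : Measurable (fun ξ => w (-ξ)) := hw.comp measurable_neg
  have h1 := ((measurable_halfWave 1 hm).add (measurable_halfWave (-1) hm)).const_mul (1 / 2 : ℂ)
  convert h1 using 1
  funext z
  exact cosWave_eq hwi z.1 z.2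

theorem IsWavePair.mollified_eq {n : ℕ} (hn : 0 < n) {σ : ℝ} (hσ : 1 / 2 < σ) (hσ₁ : σ ≤ 1)
    (hσ' : σ < n / 2) {U V : ℝ → 𝓢'(Rn n, ℂ)} {F : ℝ → Rn n → ℂ} (h : IsWavePair U V F)
    (hF : Measurable (Function.uncurry F)) (hFd : ∫⁻ t in Ioi (0 : ℝ), dualNorm σ (F t) < ∞)
    (hFdm : Measurable (fun t => dualNorm σ (F t))) {fh gh : Rn n → ℂ}
    (hf : IsRepresentedBy (𝓕 (U 0)) fh) (hg : IsRepresentedBy (𝓕 (V 0)) gh)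
    (η : 𝓢(Rn n, ℂ)) {t : ℝ} (ht : 0 ≤ t) (x : Rn n) :
    U t (SchwartzMap.compSubConstCLM ℂ x η) = cosWave (fun ξ => (𝓕⁻ η) ξ * fh ξ) t x +
      sineWave (fun ξ => (𝓕⁻ η) ξ * gh ξ) t x + forcedWave (𝓕⁻ η : 𝓢(Rn n, ℂ)) F t x := by
  set φ : 𝓢(Rn n, ℂ) := 𝓕⁻ (SchwartzMap.compSubConstCLM ℂ x η) with hφ
  have h1 := h.duhamel hn hσ hσ' hF hFd hFdm hf hg (φ := φ)
    (SchwartzMap.energy_lt_top (by linarith) hσ₁ φ) ht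
  have h2 : 𝓕 φ = SchwartzMap.compSubConstCLM ℂ x η := by
    rw [hφ, FourierTransform.fourier_fourierInv_eq]
  have h3 : (φ : Rn n → ℂ) = fun ξ => osc ξ (-x) * (𝓕⁻ η) ξ :=
    funext fun ξ => SchwartzMap.fourierInv_compSubConstCLM η x ξ
  rw [← h2, h1, h3]
  unfold cosWave sineWave forcedWave
  rw [intervalIntegral.integral_of_le ht]
  congr 2
  · refine integral_congr_ae (Eventually.of_forall fun ξ => ?_)
    simp only
    ring
  · refine integral_congr_ae (Eventually.of_forall fun ξ => ?_)
    simp only [sineMul]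
    ring

theorem energy_mul_le_energy {n : ℕ} (s : ℝ) {ζ h : Rn n → ℂ} (hζ : ∀ ξ, ‖ζ ξ‖ ≤ 1) :
    energy s (fun ξ => ζ ξ * h ξ) ≤ energy s h := by
  refine lintegral_mono fun ξ => mul_le_mul_right (pow_le_pow_left' ?_ 2) _
  rw [enorm_mul]
  refine mul_le_of_le_one_left bot_le ?_
  rw [← ofReal_norm]
  exact ENNReal.ofReal_le_one.2 (hζ ξ)

theorem measurable_dualNorm {n : ℕ} (s : ℝ) {F : ℝ → Rn n → ℂ} (hF : Measurable (Function.uncurry F)) :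
    Measurable (fun t => dualNorm s (F t)) := by
  have h1 := measurable_weight_sphereSq hF 1 (s - n / 2)
  exact h1.lintegral_prod_right'

theorem exists_mollified_bound (n : ℕ) (hn : 0 < n) {P γ : ℝ} (hP : 2 ≤ P) (hγ : 0 ≤ γ)
    (hγ₁ : 1 / 2 - 1 / P < γ) (hγ₂ : γ < n / 2 - 1 / P) (hγ₃ : 1 / 2 < 1 - γ) (hγ₄ : 1 - γ < n / 2) :
    ∃ C : ℝ≥0, ∀ (ζ : 𝓢(Rn n, ℂ)) (F : ℝ → Rn n → ℂ) (fh gh : Rn n → ℂ), (∀ ξ, ‖ζ ξ‖ ≤ 1) →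
    Measurable (Function.uncurry F) → Measurable fh → Measurable gh →
    Integrable (fun ξ => ζ ξ * fh ξ) → Integrable (fun ξ => ζ ξ * gh ξ) → energy (γ - 1) gh < ∞ →
    ∫⁻ t in Ioi (0 : ℝ), dualNorm (1 - γ) (F t) < ∞ →
    mixedEnergy P (P * (n / 2 - γ) - (n + 1)) (fun t x => cosWave (fun ξ => ζ ξ * fh ξ) t x +
      sineWave (fun ξ => ζ ξ * gh ξ) t x + forcedWave ζ F t x) ≤
      C * (energy γ fh ^ (P / 2) + energy (γ - 1) gh ^ (P / 2) +
        (∫⁻ t in Ioi (0 : ℝ), dualNorm (1 - γ) (F t)) ^ P) := by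
  obtain ⟨C₁, hC₁⟩ := exists_cosWave_bound n hn hP hγ hγ₁ hγ₂
  obtain ⟨C₂, hC₂⟩ := exists_sineWave_bound n hn hP hγ hγ₁ hγ₂
  obtain ⟨C₃, hC₃⟩ := exists_forcedWave_bound n hn hP hγ hγ₁ hγ₂ hγ₃ hγ₄
  refine ⟨2 ^ P * (2 ^ P * C₁ + 2 ^ P * C₂ + C₃), fun ζ F fh gh hζ hF hfm hgm hfi hgi hgE hFd => ?_⟩
  have hζm : Measurable (ζ : Rn n → ℂ) := ζ.continuous.measurable
  have hPh : 0 ≤ P / 2 := by linarith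
  have e1 := (hC₁ _ (hζm.mul hfm) hfi).trans
    (mul_le_mul_right (ENNReal.rpow_le_rpow (energy_mul_le_energy γ hζ) hPh) _)
  have e2 := (hC₂ _ (hζm.mul hgm) hgi ((energy_mul_le_energy _ hζ).trans_lt hgE)).trans
    (mul_le_mul_right (ENNReal.rpow_le_rpow (energy_mul_le_energy (γ - 1) hζ) hPh) _)
  have e3 := hC₃ ζ F hζm ζ.integrable hζ (ζ.energy_lt_top (by linarith) (by linarith)) hF
    (ae_lt_top (measurable_dualNorm _ hF) hFd.ne)
  have m1 := measurable_cosWave (hζm.mul hfm) hfi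
  have m2 := measurable_sineWave (hζm.mul hgm)
  have s1 := mixedEnergy_add_le (w := P * (n / 2 - γ) - (n + 1)) hP
    (v₁ := fun t x => cosWave (fun ξ => ζ ξ * fh ξ) t x + sineWave (fun ξ => ζ ξ * gh ξ) t x)
    (v₂ := forcedWave ζ F) (m1.add m2)
  have s2 := mixedEnergy_add_le (w := P * (n / 2 - γ) - (n + 1)) hP
    (v₁ := cosWave (fun ξ => ζ ξ * fh ξ)) (v₂ := sineWave (fun ξ => ζ ξ * gh ξ)) m1
  set a := energy γ fh ^ (P / 2)
  set b := energy (γ - 1) gh ^ (P / 2)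
  set d := (∫⁻ t in Ioi (0 : ℝ), dualNorm (1 - γ) (F t)) ^ P
  have hc : ((2 ^ P * (2 ^ P * C₁ + 2 ^ P * C₂ + C₃) : ℝ≥0) : ℝ≥0∞) =
      2 ^ P * (2 ^ P * C₁ + 2 ^ P * C₂ + C₃) := by
    push_cast
    rw [ENNReal.coe_rpow_of_nonneg _ (by linarith)]
    rfl
  rw [hc]
  calc _ ≤ _ := s1
    _ ≤ 2 ^ P * (2 ^ P * (C₁ * a + C₂ * b) + C₃ * d) :=
        mul_le_mul_right (add_le_add (s2.trans (mul_le_mul_right (add_le_add e1 e2) _)) e3) _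
    _ ≤ 2 ^ P * ((2 ^ P * C₁ + 2 ^ P * C₂ + C₃) * a + (2 ^ P * C₁ + 2 ^ P * C₂ + C₃) * b +
        (2 ^ P * C₁ + 2 ^ P * C₂ + C₃) * d) := by
        refine mul_le_mul_right ?_ _
        rw [mul_add, ← mul_assoc, ← mul_assoc]
        refine add_le_add (add_le_add ?_ ?_) ?_ <;> refine mul_le_mul_left ?_ _
        · rw [add_assoc]; exact le_self_add
        · exact le_add_right le_add_self
        · exact le_add_self
    _ = _ := by ring

theorem exists_solution_bound (n : ℕ) (hn : 0 < n) {P γ : ℝ} (hP : 2 ≤ P) (hγ : 0 ≤ γ)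
    (hγ₁ : 1 / 2 - 1 / P < γ) (hγ₂ : γ < n / 2 - 1 / P) (hγ₃ : 1 / 2 < 1 - γ) (hγ₄ : 1 - γ < n / 2) :
    ∃ C : ℝ≥0, ∀ (U V : ℝ → 𝓢'(Rn n, ℂ)) (F u : ℝ → Rn n → ℂ) (fh gh : Rn n → ℂ), IsWavePair U V F →
    (∀ᵐ t ∂(volume.restrict (Ioi (0 : ℝ))), IsRepresentedBy (U t) (u t)) →
    Measurable (Function.uncurry F) → Measurable fh → Measurable gh →
    IsRepresentedBy (𝓕 (U 0)) fh → IsRepresentedBy (𝓕 (V 0)) gh → energy (γ - 1) gh < ∞ →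
    ∫⁻ t in Ioi (0 : ℝ), dualNorm (1 - γ) (F t) < ∞ →
    ∫⁻ t in Ioi (0 : ℝ), ∫⁻ r : Ioi (0 : ℝ), ENNReal.ofReal (r.1 ^ (P * (n / 2 - γ) - (n + 1))) *
      sphereSq (u t) r.1 ^ (P / 2) ∂(Measure.volumeIoiPow (n - 1)) ≤
      C * (energy γ fh ^ (P / 2) + energy (γ - 1) gh ^ (P / 2) +
        (∫⁻ t in Ioi (0 : ℝ), dualNorm (1 - γ) (F t)) ^ P) := by
  obtain ⟨C, hC⟩ := exists_mollified_bound n hn hP hγ hγ₁ hγ₂ hγ₃ hγ₄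
  obtain ⟨η, hη, hlim⟩ := exists_mollifiers n
  refine ⟨C, fun U V F u fh gh h hu hF hfm hgm hf hg hgE hFd => ?_⟩
  have hFdm := measurable_dualNorm (1 - γ) hF
  have hζm : ∀ k, Measurable ((𝓕⁻ (η k) : 𝓢(Rn n, ℂ)) : Rn n → ℂ) := fun k =>
    (𝓕⁻ (η k) : 𝓢(Rn n, ℂ)).continuous.measurable
  obtain ⟨W, hW⟩ : ∃ W : ℕ → ℝ → Rn n → ℂ, ∀ k, W k = fun t x =>
      cosWave (fun ξ => (𝓕⁻ (η k)) ξ * fh ξ) t x + sineWave (fun ξ => (𝓕⁻ (η k)) ξ * gh ξ) t x +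
      forcedWave (𝓕⁻ (η k) : 𝓢(Rn n, ℂ)) F t x := ⟨_, fun k => rfl⟩
  have hWm : ∀ k, Measurable (Function.uncurry (W k)) := by
    intro k
    have m1 := measurable_cosWave ((hζm k).mul hfm) (hf (𝓕⁻ (η k))).1
    have m2 := measurable_sineWave ((hζm k).mul hgm)
    have m3 := measurable_forcedWave (hζm k) hF
    rw [hW]
    exact (m1.add m2).add m3
  have hWlim : ∀ᵐ t ∂(volume.restrict (Ioi (0 : ℝ))),
      ∀ᵐ x, Tendsto (fun k => W k t x) atTop (nhds (u t x)) := by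
    filter_upwards [hu, ae_restrict_mem measurableSet_Ioi] with t ht ht0
    filter_upwards [hlim _ _ ht] with x hx
    refine hx.congr fun k => ?_
    rw [hW]
    exact h.mollified_eq hn hγ₃ (by linarith) hγ₄ hF hFd hFdm hf hg (η k) (le_of_lt ht0) x
  have hWb : ∀ k, mixedEnergy P (P * (n / 2 - γ) - (n + 1)) (W k) ≤
      C * (energy γ fh ^ (P / 2) + energy (γ - 1) gh ^ (P / 2) +
        (∫⁻ t in Ioi (0 : ℝ), dualNorm (1 - γ) (F t)) ^ P) := by
    intro k
    rw [hW]
    exact hC (𝓕⁻ (η k)) F fh gh (SchwartzMap.norm_fourierInv_le (hη k)) hF hfm hgm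
      (hf (𝓕⁻ (η k))).1 (hg (𝓕⁻ (η k))).1 hgE hFd
  have hWpolar : ∀ᵐ t ∂(volume.restrict (Ioi (0 : ℝ))),
      ∀ᵐ r : Ioi (0 : ℝ) ∂(Measure.volumeIoiPow (n - 1)), ∀ᵐ ω ∂(sphereMeasure n),
        Tendsto (fun k => W k t (r.1 • ω.1)) atTop (nhds (u t (r.1 • ω.1))) :=
    hWlim.mono fun t ht => ae_polar (p := fun x => Tendsto (fun k => W k t x) atTop (nhds (u t x))) hn ht
  clear hW
  refine lintegral_sphereSq_le_of_tendsto (V := W) (by linarith) hWm hWpolar fun k => ?_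
  exact le_trans (setLIntegral_le_lintegral _ _) (hWb k)

/-! ### The norms of the estimate -/

theorem eLpNorm_sphere_radialWeight {n : ℕ} (a : ℝ) (h : ℝ → Rn n → ℂ) (t : ℝ) (r : Ioi (0 : ℝ)) :
    eLpNorm (fun ω : unitSphere n => radialWeight a h t (r.1 • ω.1)) 2 (sphereMeasure n) =
      ENNReal.ofReal (r.1 ^ a) * sphereSq (h t) r.1 ^ (1 / 2 : ℝ) := by
  have hr : 0 < r.1 := r.2
  have h1 : ∀ ω : unitSphere n, ‖radialWeight a h t (r.1 • ω.1)‖ₑ ^ (2 : ℝ) =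
      ENNReal.ofReal (r.1 ^ a) ^ 2 * ‖h t (r.1 • ω.1)‖ₑ ^ 2 := by
    intro ω
    have h2 : ‖r.1 • ω.1‖ = r.1 := by
      have h3 : ‖ω.1‖ = 1 := by simp
      rw [norm_smul, h3, mul_one, Real.norm_of_nonneg hr.le]
    rw [radialWeight, h2, enorm_mul, ENNReal.rpow_two, mul_pow, ← ofReal_norm, Complex.norm_real,
      Real.norm_of_nonneg (by positivity)]
  rw [eLpNorm_eq_lintegral_rpow_enorm_toReal (by norm_num) (by norm_num), ENNReal.toReal_ofNat]
  simp only [h1]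
  rw [lintegral_const_mul' _ _ (ENNReal.pow_ne_top ENNReal.ofReal_ne_top),
    ENNReal.mul_rpow_of_nonneg _ _ (by norm_num), ← ENNReal.rpow_natCast, ← ENNReal.rpow_mul]
  norm_num
  rfl

theorem mixedNorm_radialWeight {n : ℕ} {p : ℝ≥0∞} (hp₀ : p ≠ 0) (hp : p ≠ ∞) (a : ℝ)
    (h : ℝ → Rn n → ℂ) :
    mixedNorm p (radialWeight a h) = (∫⁻ t in Ioi (0 : ℝ), ∫⁻ r : Ioi (0 : ℝ),
      ENNReal.ofReal (r.1 ^ (p.toReal * a)) * sphereSq (h t) r.1 ^ (p.toReal / 2)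
        ∂(Measure.volumeIoiPow (n - 1))) ^ (1 / p.toReal) := by
  have hP : 0 < p.toReal := ENNReal.toReal_pos hp₀ hp
  unfold mixedNorm
  rw [eLpNorm_eq_lintegral_rpow_enorm_toReal hp₀ hp]
  congr 1
  refine lintegral_congr fun t => ?_
  rw [enorm_eq_self, eLpNorm_eq_lintegral_rpow_enorm_toReal hp₀ hp, ← ENNReal.rpow_mul,
    one_div_mul_cancel hP.ne', ENNReal.rpow_one]
  refine lintegral_congr fun r => ?_
  have hr : 0 < r.1 := r.2
  rw [enorm_eq_self, eLpNorm_sphere_radialWeight, ENNReal.mul_rpow_of_nonneg _ _ hP.le,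
    ← ENNReal.rpow_mul, ENNReal.ofReal_rpow_of_nonneg (by positivity) hP.le, ← Real.rpow_mul hr.le]
  rw [mul_comm a, one_div_mul_eq_div]

theorem mixedNorm_one_radialWeight {n : ℕ} (γ : ℝ) (F : ℝ → Rn n → ℂ) :
    mixedNorm 1 (radialWeight (-((n : ℝ) / 2) + 1 - γ) F) =
      ∫⁻ t in Ioi (0 : ℝ), dualNorm (1 - γ) (F t) := by
  rw [mixedNorm_radialWeight one_ne_zero ENNReal.one_ne_top, ENNReal.toReal_one, one_div_one,
    ENNReal.rpow_one, one_mul, show -((n : ℝ) / 2) + 1 - γ = 1 - γ - n / 2 by ring]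
  rfl

theorem eLpNorm_rpow_norm_mul {n : ℕ} (s : ℝ) (h : Rn n → ℂ) :
    eLpNorm (fun ξ => (((2 * Real.pi * ‖ξ‖) ^ s : ℝ) : ℂ) * h ξ) 2 volume =
      ENNReal.ofReal ((2 * Real.pi) ^ s) * energy s h ^ (1 / 2 : ℝ) := by
  have h1 : ∀ ξ, ‖(((2 * Real.pi * ‖ξ‖) ^ s : ℝ) : ℂ) * h ξ‖ₑ ^ (2 : ℝ) =
      ENNReal.ofReal ((2 * Real.pi) ^ s) ^ 2 * (ENNReal.ofReal (‖ξ‖ ^ (2 * s)) * ‖h ξ‖ₑ ^ 2) := by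
    intro ξ
    rw [enorm_mul, ENNReal.rpow_two, mul_pow, ← ofReal_norm, Complex.norm_real,
      Real.norm_of_nonneg (by positivity), Real.mul_rpow (by positivity) (by positivity),
      ENNReal.ofReal_mul (by positivity), mul_pow, mul_assoc,
      ← ENNReal.ofReal_pow (show 0 ≤ ‖ξ‖ ^ s by positivity),
      ← Real.rpow_natCast (‖ξ‖ ^ s), ← Real.rpow_mul (norm_nonneg _)]
    congr 4; push_cast; rw [mul_comm]
  rw [eLpNorm_eq_lintegral_rpow_enorm_toReal (by norm_num) (by norm_num), ENNReal.toReal_ofNat]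
  simp only [h1]
  rw [lintegral_const_mul' _ _ (ENNReal.pow_ne_top ENNReal.ofReal_ne_top),
    ENNReal.mul_rpow_of_nonneg _ _ (by norm_num), ← ENNReal.rpow_natCast, ← ENNReal.rpow_mul]
  norm_num
  rfl

/-! ### Invariance under modification on null sets -/

theorem IsRepresentedBy.congr {n : ℕ} {T : 𝓢'(Rn n, ℂ)} {h k : Rn n → ℂ} (hT : IsRepresentedBy T h)
    (hk : h =ᵐ[volume] k) : IsRepresentedBy T k := fun ψ => by
  have h1 : (fun x => ψ x * h x) =ᵐ[volume] fun x => ψ x * k x := by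
    filter_upwards [hk] with x hx
    rw [hx]
  exact ⟨(hT ψ).1.congr h1, (hT ψ).2.trans (integral_congr_ae h1)⟩

theorem energy_congr_ae {n : ℕ} (s : ℝ) {h k : Rn n → ℂ} (hk : h =ᵐ[volume] k) :
    energy s h = energy s k := by
  refine lintegral_congr_ae ?_
  filter_upwards [hk] with x hx
  rw [hx]

theorem IsRepresentedBy.exists_measurable {n : ℕ} {T : 𝓢'(Rn n, ℂ)} {h : Rn n → ℂ}
    (hT : IsRepresentedBy T h) :
    ∃ k, Measurable k ∧ IsRepresentedBy T k ∧ ∀ s, energy s k = energy s h := by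
  have h1 := hT.locallyIntegrable.aestronglyMeasurable
  exact ⟨h1.mk h, h1.stronglyMeasurable_mk.measurable, hT.congr h1.ae_eq_mk,
    fun s => (energy_congr_ae s h1.ae_eq_mk).symm⟩

theorem dualNorm_congr_ae {n : ℕ} (hn : 0 < n) (s : ℝ) {F G : Rn n → ℂ} (h : F =ᵐ[volume] G) :
    dualNorm s F = dualNorm s G := by
  refine lintegral_congr_ae ?_
  filter_upwards [sphereSq_congr_ae hn h] with r hr
  rw [hr]

theorem IsWavePair.congr {n : ℕ} {U V : ℝ → 𝓢'(Rn n, ℂ)} {F G : ℝ → Rn n → ℂ}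
    (h : IsWavePair U V F) (hFG : ∀ᵐ t ∂(volume.restrict (Ioi (0 : ℝ))), F t =ᵐ[volume] G t) :
    IsWavePair U V G := by
  intro ψ
  have h1 : ∀ᵐ t ∂(volume.restrict (Ioi (0 : ℝ))),
      (fun x => ψ x * F t x) =ᵐ[volume] fun x => ψ x * G t x := by
    filter_upwards [hFG] with t ht
    filter_upwards [ht] with x hx
    rw [hx]
  have h2 : ∀ t : ℝ, 0 ≤ t → ∀ᵐ s ∂(volume.restrict (uIoc 0 t)),
      ∫ x, ψ x * F s x = ∫ x, ψ x * G s x := by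
    intro t ht
    rw [uIoc_of_le ht]
    exact ae_restrict_of_ae_restrict_of_subset (fun s hs => hs.1) (h1.mono fun s hs => integral_congr_ae hs)
  obtain ⟨⟨ha, hb⟩, hc⟩ := h ψ
  refine ⟨⟨?_, fun t ht => (hb t ht).congr_ae (h2 t ht)⟩, fun t ht => ⟨(hc t ht).1, ?_⟩⟩
  · filter_upwards [ha, h1] with t hat h1t
    exact hat.congr h1t
  · rw [(hc t ht).2]
    congr 1
    refine intervalIntegral.integral_congr_ae_restrict ?_
    filter_upwards [h2 t ht] with s hs
    rw [hs]

/-! ### The estimate -/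

theorem rpow_sum_le {P : ℝ} (hP : 1 ≤ P) (C a b d : ℝ≥0∞) :
    (C * (a ^ (P / 2) + b ^ (P / 2) + d ^ P)) ^ (1 / P) ≤
      C ^ (1 / P) * (a ^ (1 / 2 : ℝ) + b ^ (1 / 2 : ℝ) + d) := by
  have hP0 : 0 < P := by linarith
  have h0 : 0 ≤ 1 / P := by positivity
  have h1 : 1 / P ≤ 1 := (div_le_one hP0).2 hP
  have h2 : ∀ y : ℝ≥0∞, (y ^ (P / 2)) ^ (1 / P) = y ^ (1 / 2 : ℝ) := fun y => by
    rw [← ENNReal.rpow_mul]; congr 1; field_simp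
  have h3 : (d ^ P) ^ (1 / P) = d := by
    rw [← ENNReal.rpow_mul, mul_one_div_cancel hP0.ne', ENNReal.rpow_one]
  rw [ENNReal.mul_rpow_of_nonneg _ _ h0]
  refine mul_le_mul_right ((ENNReal.rpow_add_le_add_rpow _ _ h0 h1).trans ?_) _
  rw [h3]
  refine add_le_add ((ENNReal.rpow_add_le_add_rpow _ _ h0 h1).trans ?_) le_rfl
  rw [h2, h2]

theorem exists_represented_bound (n : ℕ) (hn : 0 < n) {p : ℝ≥0∞} (hp : 2 ≤ p) (hp' : p ≠ ∞) {γ : ℝ}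
    (hγ : 0 ≤ γ) (hγ₁ : 1 / 2 - 1 / p.toReal < γ) (hγ₂ : γ < n / 2 - 1 / p.toReal)
    (hγ₃ : 1 / 2 < 1 - γ) (hγ₄ : 1 - γ < n / 2) :
    ∃ C : ℝ≥0, 0 < C ∧ ∀ (f g : 𝓢'(Rn n, ℂ)) (F u : ℝ → Rn n → ℂ), IsWaveSolution f g F u →
    ∀ fh gh, IsRepresentedBy (𝓕 f) fh → IsRepresentedBy (𝓕 g) gh →
      mixedNorm p (radialWeight ((n : ℝ) / 2 - ((n : ℝ) + 1) * (1 / p.toReal) - γ) u) ≤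
        C * (eLpNorm (fun ξ => (((2 * Real.pi * ‖ξ‖) ^ γ : ℝ) : ℂ) * fh ξ) 2 volume +
          eLpNorm (fun ξ => (((2 * Real.pi * ‖ξ‖) ^ (γ - 1) : ℝ) : ℂ) * gh ξ) 2 volume +
          mixedNorm 1 (radialWeight (-((n : ℝ) / 2) + 1 - γ) F)) := by
  have hP : 2 ≤ p.toReal := by
    have := ENNReal.toReal_mono hp' hp
    simpa using this
  have hp₀ : p ≠ 0 := (lt_of_lt_of_le (by norm_num) hp).ne'
  obtain ⟨C, hC⟩ := exists_solution_bound n hn hP hγ hγ₁ hγ₂ hγ₃ hγ₄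
  set c₁ : ℝ := (2 * Real.pi) ^ γ with hc₁
  set c₂ : ℝ := (2 * Real.pi) ^ (γ - 1) with hc₂
  have hc₁0 : 0 < c₁ := by positivity
  have hc₂0 : 0 < c₂ := by positivity
  set K : ℝ≥0 := C ^ (1 / p.toReal) * ((c₁⁻¹).toNNReal + (c₂⁻¹).toNNReal + 1) + 1 with hK
  have hK0 : 0 < K := by positivity
  refine ⟨K, hK0, fun f g F u hu fh gh hf hg => ?_⟩
  rw [eLpNorm_rpow_norm_mul, eLpNorm_rpow_norm_mul, mixedNorm_one_radialWeight]
  obtain ⟨fh', hfm, hf', hfE⟩ := hf.exists_measurable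
  obtain ⟨gh', hgm, hg', hgE⟩ := hg.exists_measurable
  rw [← hfE, ← hgE]
  have hKt : ((K : ℝ≥0∞)) ≠ 0 := by exact_mod_cast hK0.ne'
  by_cases hgt : energy (γ - 1) gh' = ∞
  · have h1 : ENNReal.ofReal c₂ * energy (γ - 1) gh' ^ (1 / 2 : ℝ) = ∞ := by
      rw [hgt, ENNReal.top_rpow_of_pos (by norm_num), ENNReal.mul_top (by simpa using hc₂0)]
    rw [h1, add_top, top_add, ENNReal.mul_top hKt]
    exact le_top
  by_cases hD : ∫⁻ t in Ioi (0 : ℝ), dualNorm (1 - γ) (F t) = ∞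
  · rw [hD, add_top, ENNReal.mul_top hKt]
    exact le_top
  set G : ℝ → Rn n → ℂ := Function.curry (hu.measurable_forcing.mk (Function.uncurry F)) with hG
  have hGm : Measurable (Function.uncurry G) := by
    rw [hG, Function.uncurry_curry]
    exact hu.measurable_forcing.stronglyMeasurable_mk.measurable
  have hFG : ∀ᵐ t ∂(volume.restrict (Ioi (0 : ℝ))), F t =ᵐ[volume] G t :=
    Measure.ae_ae_of_ae_prod hu.measurable_forcing.ae_eq_mk
  have hDG : ∫⁻ t in Ioi (0 : ℝ), dualNorm (1 - γ) (F t) =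
      ∫⁻ t in Ioi (0 : ℝ), dualNorm (1 - γ) (G t) :=
    lintegral_congr_ae (hFG.mono fun t ht => dualNorm_congr_ae hn _ ht)
  rw [hDG] at hD ⊢
  obtain ⟨U, V, hU, rfl, rfl, hUV⟩ := hu.equation
  have hw : IsWavePair U V F := fun ψ => ⟨hu.integrable_forcing ψ, hUV ψ⟩
  have key := hC U V G u fh' gh' (hw.congr hFG) hU hGm hfm hgm hf' hg'
    (lt_top_iff_ne_top.2 hgt) (lt_top_iff_ne_top.2 hD)
  rw [mixedNorm_radialWeight hp₀ hp', show p.toReal * ((n : ℝ) / 2 - ((n : ℝ) + 1) * (1 / p.toReal) - γ) =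
    p.toReal * (n / 2 - γ) - (n + 1) by
      have : p.toReal ≠ 0 := by linarith
      field_simp
      ring]
  refine (ENNReal.rpow_le_rpow key (by positivity)).trans ((rpow_sum_le (by linarith) _ _ _ _).trans ?_)
  have hinv : ∀ c : ℝ, 0 < c → ∀ y : ℝ≥0∞, y = ENNReal.ofReal c⁻¹ * (ENNReal.ofReal c * y) := by
    intro c hc y
    rw [← mul_assoc, ← ENNReal.ofReal_mul (by positivity), inv_mul_cancel₀ hc.ne', ENNReal.ofReal_one,
      one_mul]
  set a := energy γ fh' ^ (1 / 2 : ℝ)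
  set b := energy (γ - 1) gh' ^ (1 / 2 : ℝ)
  set d := ∫⁻ t in Ioi (0 : ℝ), dualNorm (1 - γ) (G t)
  set q₁ := ENNReal.ofReal c₁⁻¹
  set q₂ := ENNReal.ofReal c₂⁻¹
  have hKc : (K : ℝ≥0∞) = (C : ℝ≥0∞) ^ (1 / p.toReal) * (q₁ + q₂ + 1) + 1 := by
    rw [hK]
    push_cast
    rw [ENNReal.coe_rpow_of_nonneg _ (by positivity)]
    rfl
  calc (C : ℝ≥0∞) ^ (1 / p.toReal) * (a + b + d)
      ≤ (C : ℝ≥0∞) ^ (1 / p.toReal) * ((q₁ + q₂ + 1) *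
          (ENNReal.ofReal c₁ * a + ENNReal.ofReal c₂ * b + d)) := by
        refine mul_le_mul_right ?_ _
        rw [mul_add, mul_add]
        refine add_le_add (add_le_add ?_ ?_) ?_
        · nth_rw 1 [hinv c₁ hc₁0 a]
          exact mul_le_mul_left (by rw [add_assoc]; exact le_self_add) _
        · nth_rw 1 [hinv c₂ hc₂0 b]
          exact mul_le_mul_left (le_add_right le_add_self) _
        · exact le_mul_of_one_le_left bot_le le_add_self
    _ ≤ _ := by
        rw [← mul_assoc, hKc]
        exact mul_le_mul_left le_self_add _

end

theorem lemma3p1 (n : ℕ) (p : ℝ≥0∞) (γ : ℝ) (hp : 2 ≤ p)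
    (hγ₁ : 1 / 2 - (p⁻¹).toReal < γ) (hγ₂ : γ < (n : ℝ) / 2 - (p⁻¹).toReal)
    (hγ₃ : 1 / 2 < 1 - γ) (hγ₄ : 1 - γ < (n : ℝ) / 2) :
    ∃ C : ℝ≥0, ∀ (f g : 𝓢'(Rn n, ℂ)) (F u : ℝ → Rn n → ℂ), IsWaveSolution f g F u →
      mixedNorm p (radialWeight ((n : ℝ) / 2 - ((n : ℝ) + 1) * (p⁻¹).toReal - γ) u) ≤
        (C : ℝ≥0∞) * (homSobolevNorm γ f + homSobolevNorm (γ - 1) g +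
          mixedNorm 1 (radialWeight (-((n : ℝ) / 2) + 1 - γ) F)) := by
  have hp' : p ≠ ∞ := by
    rintro rfl
    rw [ENNReal.inv_top, ENNReal.toReal_zero] at hγ₁
    linarith
  have hn : 0 < n := by
    rcases Nat.eq_zero_or_pos n with rfl | h
    · rw [Nat.cast_zero] at hγ₄
      linarith
    · exact h
  have hP : 2 ≤ p.toReal := by
    have := ENNReal.toReal_mono hp' hp
    simpa using this
  have hinv : (p⁻¹).toReal = 1 / p.toReal := by rw [ENNReal.toReal_inv, one_div]
  rw [hinv] at hγ₁ hγ₂ ⊢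
  have hγ : 0 ≤ γ := by
    have : 1 / p.toReal ≤ 1 / 2 := one_div_le_one_div_of_le (by norm_num) hP
    linarith
  obtain ⟨C, hC0, hC⟩ := exists_represented_bound n hn hp hp' hγ hγ₁ hγ₂ hγ₃ hγ₄
  refine ⟨C, fun f g F u hu => ?_⟩
  have hCt : (C : ℝ≥0∞) ≠ 0 := by exact_mod_cast hC0.ne'
  rw [mul_comm (C : ℝ≥0∞), ← ENNReal.div_le_iff hCt ENNReal.coe_ne_top, add_assoc, ← tsub_le_iff_right]
  refine le_iInf₂ fun fh hf => ?_
  rw [tsub_le_iff_right, add_left_comm, ← tsub_le_iff_right]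
  refine le_iInf₂ fun gh hg => ?_
  rw [tsub_le_iff_right, ENNReal.div_le_iff hCt ENNReal.coe_ne_top, mul_comm _ (C : ℝ≥0∞), add_left_comm, ← add_assoc]
  exact hC f g F u hu fh gh hf hg
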